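/- Let $G$ be a finite connected undirected multigraph without loops on the vertices $0,\dots,n-1$ ($n\ge 1$), and let $b_{ij}=b_{ji}\ge 0$ be the number of edges between $i$ and $j$. A divisor on $G$ is a vector $D\in\mathbb{Z}^n$ ($D_v$ chips at the vertex $v$); it is effective if $D_v\ge 0$ for all $v$. In a move of the chip-firing game one vertex lends, or borrows, one chip along each edge incident with it; two divisors are equivalent if one can be reached from the other by a finite sequence of moves. The rank $r(D)$ is one less than the minimum number of chips that must be removed from $D$ so that the resulting divisor is not equivalent to an effective divisor (so $r(D)\ge -1$). Write a pair $(G,D)$ as a word over a fixed finite alphabet, with all numbers in binary: for each vertex $i=0,\dots,n-1$ in turn, the integer $D_i$ and then the multiplicities $b_{ij}$ for $j=0,\dots,i-1$, separated by delimiters. **Theorem.** The problem of deciding, given a connected multigraph $G$ and a divisor $D$ on $G$, whether $r(D)\ge 0$ is contained in $\mathrm{NP}\cap\mathrm{co\text{-}NP}$. That is, let $L$ be the set of the words that describe a pair $(G,D)$ with $G$ connected and $r(D)\ge 0$. Then both $L$ and its complement in the set of all words belong to $\mathrm{NP}$, where a language $L'$ is in $\mathrm{NP}$ if there are a polynomial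 $p$ and a Turing machine $V$ running in polynomial time such that, for every word $x$, one has $x\in L'$ if and only if $V$ accepts $(x,y)$ for some word $y$ (over a finite alphabet) of length at most $p(|x|)$. -/

import Mathlib

/-! ### Finite multigraphs, divisors, chip firing and rank -/

/-- A finite undirected loopless multigraph on the vertex set `V`: `mult u v` is the number of
edges between `u` and `v`. -/
structure Multigraph (V : Type) where
  mult : V → V → ℕ
  mult_symm : ∀ u v, mult u v = mult v u
  mult_self : ∀ v, mult v v = 0

namespace Multigraph

variable {V : Type}

/-- The simple graph obtained by forgetting the multiplicities of the edges. -/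
def toSimpleGraph (G : Multigraph V) : SimpleGraph V where
  Adj u v := 0 < G.mult u v
  symm := ⟨fun u v h => by rw [G.mult_symm v u]; exact h⟩
  loopless := ⟨fun v h => by rw [G.mult_self v] at h; exact lt_irrefl 0 h⟩

/-- The multigraph is connected (in particular it has at least one vertex). -/
def Connected (G : Multigraph V) : Prop := G.toSimpleGraph.Connected

variable [Fintype V] [DecidableEq V]

/-- The divisor `D` after the vertex `v` has lent one chip along each edge incident with it. -/
def lend (G : Multigraph V) (v : V) (D : V → ℤ) : V → ℤ := fun u =>
  if u = v then D v - ∑ x, (G.mult v x : ℤ) else D u + (G.mult v u : ℤ)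

/-- The divisor `D` after the vertex `v` has borrowed one chip along each edge incident with it. -/
def borrow (G : Multigraph V) (v : V) (D : V → ℤ) : V → ℤ := fun u =>
  if u = v then D v + ∑ x, (G.mult v x : ℤ) else D u - (G.mult v u : ℤ)

/-- One move of the chip-firing game: some vertex lends or borrows. -/
def Move (G : Multigraph V) (D D' : V → ℤ) : Prop :=
  ∃ v, D' = G.lend v D ∨ D' = G.borrow v D

/-- `D'` can be reached from `D` by a finite sequence of moves of the chip-firing game. -/
def Equivalent (G : Multigraph V) (D D' : V → ℤ) : Prop :=
  Relation.ReflTransGen G.Move D D'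

/-- The divisor `D` is equivalent to an effective divisor. -/
def EquivToEffective (G : Multigraph V) (D : V → ℤ) : Prop :=
  ∃ D' : V → ℤ, G.Equivalent D D' ∧ ∀ v, 0 ≤ D' v

/-- The numbers `k` such that some `k` chips can be removed from `D` in such a way that the
resulting divisor is not equivalent to an effective one. -/
def removalNumbers (G : Multigraph V) (D : V → ℤ) : Set ℕ :=
  {k | ∃ E : V → ℕ, ∑ v, E v = k ∧ ¬ G.EquivToEffective (fun v => D v - (E v : ℤ))}

/-- The rank `r(D)`: one less than the minimum number of chips that must be removed from `D` so
that the resulting divisor is not equivalent to an effective divisor. -/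
noncomputable def rank (G : Multigraph V) (D : V → ℤ) : ℤ := (sInf (G.removalNumbers D) : ℕ) - 1

theorem Move.sum_eq {G : Multigraph V} {D D' : V → ℤ} (h : G.Move D D') :
    ∑ v, D' v = ∑ v, D v := by
  obtain ⟨v, h⟩ := h
  have key : ∀ s : ℤ, ∑ u, (if u = v then D v - s * ∑ x, (G.mult v x : ℤ)
      else D u + s * (G.mult v u : ℤ)) = ∑ u, D u := by
    intro s
    have h1 : ∀ u, (if u = v then D v - s * ∑ x, (G.mult v x : ℤ)
        else D u + s * (G.mult v u : ℤ))
        = D u + s * (G.mult v u : ℤ) - (if u = v then s * ∑ x, (G.mult v x : ℤ) else 0) := by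
      intro u
      split_ifs with hu
      · subst hu
        simp [G.mult_self]
      · simp
    simp only [h1, Finset.sum_sub_distrib, Finset.sum_add_distrib, Finset.sum_ite_eq',
      Finset.mem_univ, if_true, ← Finset.mul_sum]
    ring
  rcases h with rfl | rfl
  · simpa [lend] using key 1
  · simpa [borrow, sub_eq_add_neg] using key (-1)

theorem Equivalent.sum_eq {G : Multigraph V} {D D' : V → ℤ} (h : G.Equivalent D D') :
    ∑ v, D' v = ∑ v, D v := by
  induction h with
  | refl => rfl
  | tail _ h ih => exact h.sum_eq.trans ih

/-- The minimum in the definition of the rank is a minimum over a nonempty set. -/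
theorem removalNumbers_nonempty [Nonempty V] (G : Multigraph V) (D : V → ℤ) :
    (G.removalNumbers D).Nonempty := by
  let v₀ : V := Classical.arbitrary V
  refine ⟨_, fun v => if v = v₀ then ((∑ v, D v).toNat + 1) else 0, rfl, ?_⟩
  rintro ⟨D', h, hD'⟩
  have h1 := h.sum_eq
  have h2 : 0 ≤ ∑ v, D' v := Finset.sum_nonneg fun v _ => hD' v
  rw [h1, Finset.sum_sub_distrib] at h2
  simp only [Nat.cast_ite, Nat.cast_zero, Finset.sum_ite_eq', Finset.mem_univ, if_true,
    Nat.cast_add, Nat.cast_one] at h2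
  have h3 := Int.self_le_toNat (∑ v, D v)
  linarith

end Multigraph

/-! ### The complexity classes `NP` and `coNP` -/

/-- The class `NP` of languages over the finite alphabet `α`: there are a polynomial `p` and a
polynomial-time Turing machine `V` (a verifier) such that a word `x` is in the language if and only
if `V` accepts `(x, y)` for some certificate `y` of length at most `p (|x|)`. The pair `(x, y)` is
written on the input as the word `x` followed by the word `y`, the two over disjoint alphabets. -/
def classNP (α : Type) [Fintype α] : Set (Set (List α)) :=
  {L | ∃ (Γ : Type) (_ : Fintype Γ) (p : Polynomial ℕ) (V : List α × List Γ → Bool),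
    Nonempty (Turing.TM2ComputableInPolyTime
      (Computability.encodingProd (Computability.encodingList α)
        (Computability.encodingList Γ)).encode
      Computability.encodeBool V) ∧
    ∀ x : List α, x ∈ L ↔ ∃ y : List Γ, y.length ≤ p.eval x.length ∧ V (x, y) = true}

/-- The class `coNP`: the languages over `α` whose complement in the set of all words is in `NP`. -/
def classCoNP (α : Type) [Fintype α] : Set (Set (List α)) :=
  {L | Lᶜ ∈ classNP α}

/-! ### The decision problem -/

/-- The alphabet in which instances are written. -/
inductive InstSym
  | zero
  | one
  | minus
  | comma
  | semicolon
  deriving DecidableEq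

instance : Fintype InstSym where
  elems := {InstSym.zero, InstSym.one, InstSym.minus, InstSym.comma, InstSym.semicolon}
  complete x := by cases x <;> decide

/-- The binary expansion of a natural number, least significant digit first, without superfluous
zeros (the empty word for `0`). -/
def encodeNatSym (m : ℕ) : List InstSym :=
  (Nat.bits m).map fun b => if b then InstSym.one else InstSym.zero

/-- An integer in binary: a sign, if it is negative, and its absolute value. -/
def encodeIntSym (z : ℤ) : List InstSym :=
  (if z < 0 then [InstSym.minus] else []) ++ encodeNatSym z.natAbs

/-- The `i`-th row of an instance: the number of chips at the vertex `i`, and then, each preceded by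
a comma, the multiplicities of the edges between `i` and the vertices `j < i`, in increasing order
of `j`; a semicolon ends the row. -/
def encodeRow {n : ℕ} (G : Multigraph (Fin n)) (D : Fin n → ℤ) (i : Fin n) : List InstSym :=
  encodeIntSym (D i) ++
    ((List.finRange n).filter (fun j => j < i)).flatMap
      (fun j => InstSym.comma :: encodeNatSym (G.mult i j)) ++ [InstSym.semicolon]

/-- The word that describes the multigraph `G` on the vertices `0, …, n - 1` and the divisor `D` on
it: the rows of all vertices, one after the other. As the adjacency matrix is symmetric with zero
diagonal, its entries below the diagonal determine it. -/
def encodeInstance {n : ℕ} (G : Multigraph (Fin n)) (D : Fin n → ℤ) : List InstSym :=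
  (List.finRange n).flatMap (encodeRow G D)

/-- The problem of deciding whether `r(D) ≥ 0`, as a language: the words that describe a connected
multigraph `G` and a divisor `D` on it with `r(D) ≥ 0`. -/
def rankNonnegProblem : Set (List InstSym) :=
  {x | ∃ (n : ℕ) (G : Multigraph (Fin n)) (D : Fin n → ℤ),
    G.Connected ∧ 0 ≤ G.rank D ∧ encodeInstance G D = x}

/-! ### Regular expressions denote regular languages -/

open scoped Computability

namespace Language

variable {α : Type*}

/-! If every vertex `v` lends `f v` times, the divisor changes by the Laplacian `G.lap f`, and `0 ≤
r(D)` says that some `D - G.lap f` is effective (`equivalent_iff`, `rank_nonneg_iff`). Such a script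
`f` serves as a certificate once its entries are small. On a connected graph, the drop of `f` along
an edge is at most the flux out of a superlevel set of `f`, hence at most `∑ |G.lap f|`. If the
total debt of `D - G.lap f` does not exceed that of `D`, this sum is at most `4 * ∑ |D v|`. As
constants lie in the kernel of the Laplacian, `f` can be shifted to natural numbers with
polynomially many digits (`Connected.exists_nat_script`).

For the opposite answer the certificate records a burning process in the manner of Dhar: a script
`f` and labels `t` such that every `v` has, in `D - G.lap f`, fewer chips than edges to vertices of
smaller label. This excludes an effective divisor by a maximum principle
(`not_equivToEffective_of_script`): if `D - G.lap g` were effective, then among the maximisers of `g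
- f` the one with least label would be in debt. Certificates exist
(`Connected.exists_script_of_not_equivToEffective`): take a script of minimal total debt, normalised
to vanish at a vertex `q` in debt and with the largest possible sum. No set avoiding `q` can then
lend to its outside without a vertex getting into debt, so a fire started at `q` burns everything,
and the order of burning gives `t`.

Connectedness is certified by labels such that every vertex but `0` has a neighbour with a smaller
one, and refuted by a colouring without edges between different colours. The complement also
contains the malformed words; these have two symbols that may not follow each other, a wrong last
symbol, or a row of wrong length.

The checks are carried out by nondeterministic programs: regular expressions over elementary
instructions, whose words are the runs. A machine that simulates a finite automaton for the regular
expression and executes the actions on stacks can use a run as certificate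
(`mem_classNP_of_stackProgram`). Programs on numbers are translated to stack programs with
polynomial overhead (`mem_classNP_of_numProgram`). It then remains to show, for each of the two
languages, that its words have short runs with small numbers (`Can`) and that other words have no
complete run (`Must` with `False`). -/

theorem IsRegular.mul {L M : Language α} (hL : L.IsRegular) (hM : M.IsRegular) :
    (L * M).IsRegular := by
  rw [isRegular_iff_finite_range_leftQuotient] at *
  -- A factorisation of `x ++ y` cuts either after `x` or inside it. Hence the quotient by `x` is
  -- determined by the quotient of `L` by `x` and the set of quotients of `M` by those suffixes of
  -- `x` that remain after a word of `L`. There are finitely many such pairs.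
  refine ((hL.prod hM.powerset).image
    (fun p => ({y | y ∈ p.1 * M ∨ ∃ A ∈ p.2, y ∈ A} : Language α))).subset ?_
  rintro _ ⟨x, rfl⟩
  refine ⟨(L.leftQuotient x, {A | ∃ u ∈ L, ∃ v, x = u ++ v ∧ A = M.leftQuotient v}),
    ⟨⟨x, rfl⟩, ?_⟩, ?_⟩
  · rintro _ ⟨u, -, v, -, rfl⟩
    exact ⟨v, rfl⟩
  · ext y
    show (_ ∨ _) ↔ x ++ y ∈ L * M
    simp only [mem_mul, Set.mem_ofPred_eq]
    constructor
    · rintro (⟨a, ha, b, hb, rfl⟩ | ⟨_, ⟨u, hu, v, rfl, rfl⟩, hy⟩)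
      · exact ⟨x ++ a, ha, b, hb, by simp⟩
      · exact ⟨u, hu, v ++ y, hy, by simp⟩
    · rintro ⟨a, ha, b, hb, h⟩
      rcases List.append_eq_append_iff.1 h with ⟨c, rfl, rfl⟩ | ⟨c, rfl, rfl⟩
      · exact Or.inr ⟨_, ⟨a, ha, c, rfl, rfl⟩, hb⟩
      · exact Or.inl ⟨c, ha, b, hb, rfl⟩

/-- The word `v` is the part inside `x` of the factor in which `x` ends; if a factor ends exactly
with `x`, it is that whole factor, whose quotient contains the empty word. For empty `x` there need
not be such a factor. -/
theorem leftQuotient_kstar {L : Language α} {x y : List α} (hx : x ≠ []) :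
    x ++ y ∈ L∗ ↔ ∃ u ∈ L∗, ∃ v, x = u ++ v ∧ y ∈ L.leftQuotient v * L∗ := by
  constructor
  · intro h
    obtain ⟨S, hS, hL⟩ := mem_kstar.1 h
    clear h
    induction S generalizing x with
    | nil => simp_all
    | cons w S ih =>
      rw [List.flatten_cons] at hS
      have hL' : ∀ z ∈ S, z ∈ L := fun z hz => hL z (by simp [hz])
      have hw : w ∈ L := hL w (by simp)
      rcases List.append_eq_append_iff.1 hS with ⟨c, rfl, rfl⟩ | ⟨c, rfl, h⟩
      · exact ⟨[], nil_mem_kstar L, x, rfl, mem_mul.2 ⟨c, hw, _, join_mem_kstar hL', rfl⟩⟩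
      · by_cases hc : c = []
        · subst hc
          refine ⟨[], nil_mem_kstar L, w ++ [], rfl, mem_mul.2 ⟨[], by simpa using hw, y, ?_, rfl⟩⟩
          rw [List.nil_append] at h
          exact h ▸ join_mem_kstar hL'
        · obtain ⟨u, hu, v, rfl, hy⟩ := ih hc h.symm hL'
          obtain ⟨S', rfl, hS'⟩ := mem_kstar.1 hu
          refine ⟨(w :: S').flatten, join_mem_kstar ?_, v, by simp, hy⟩
          simp only [List.mem_cons, forall_eq_or_imp]
          exact ⟨hw, hS'⟩
  · rintro ⟨u, hu, v, rfl, hy⟩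
    obtain ⟨a, ha, b, hb, rfl⟩ := mem_mul.1 hy
    obtain ⟨S, rfl, hS⟩ := mem_kstar.1 hu
    obtain ⟨S', rfl, hS'⟩ := mem_kstar.1 hb
    refine mem_kstar.2 ⟨S ++ [v ++ a] ++ S', by simp, ?_⟩
    intro z hz
    simp only [List.mem_append, List.mem_singleton] at hz
    rcases hz with (hz | rfl) | hz
    · exact hS z hz
    · exact ha
    · exact hS' z hz

theorem IsRegular.kstar {L : Language α} (hL : L.IsRegular) : (L∗).IsRegular := by
  rw [isRegular_iff_finite_range_leftQuotient] at *
  -- The quotient by a nonempty word is fixed by a set of quotients of `L`; the empty word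
  -- contributes `L∗` itself.
  refine ((hL.powerset.image
    (fun p => ({y | ∃ A ∈ p, y ∈ A * L∗} : Language α))).insert (L∗)).subset ?_
  rintro _ ⟨x, rfl⟩
  by_cases hx : x = []
  · subst hx
    exact Or.inl rfl
  refine Or.inr ⟨{A | ∃ u ∈ L∗, ∃ v, x = u ++ v ∧ A = L.leftQuotient v}, ?_, ?_⟩
  · rintro _ ⟨u, -, v, -, rfl⟩
    exact ⟨v, rfl⟩
  · ext y
    refine Iff.trans ?_ (leftQuotient_kstar hx).symm
    constructor
    · rintro ⟨_, ⟨u, hu, v, h, rfl⟩, hy⟩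
      exact ⟨u, hu, v, h, hy⟩
    · rintro ⟨u, hu, v, h, hy⟩
      exact ⟨_, ⟨u, hu, v, h, rfl⟩, hy⟩

/-- All quotients consist of suffixes of `w`. This covers the three base cases of regular
expressions. -/
theorem isRegular_of_forall_eq {L : Language α} (hL : ∃ w, ∀ x ∈ L, x = w) :
    L.IsRegular := by
  obtain ⟨w, hw⟩ := hL
  rw [isRegular_iff_finite_range_leftQuotient]
  refine ((w.tails.finite_toSet.powerset).image (fun p => (p : Language α))).subset ?_
  rintro _ ⟨x, rfl⟩
  refine ⟨L.leftQuotient x, ?_, rfl⟩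
  intro y hy
  exact (List.mem_tails _ _).2 ⟨x, hw _ hy⟩

end Language

/-- This makes the control flow of a program checkable with finite memory: a machine that reads a
run only has to remember a state of the automaton. -/
theorem RegularExpression.isRegular_matches' {α : Type*} (P : RegularExpression α) :
    P.matches'.IsRegular := by
  induction P with
  | zero => exact Language.isRegular_of_forall_eq ⟨[], fun x hx => hx.elim⟩
  | epsilon => exact Language.isRegular_of_forall_eq ⟨[], fun x hx => hx⟩
  | char a => exact Language.isRegular_of_forall_eq ⟨[a], fun x hx => hx⟩
  | plus P Q hP hQ => exact hP.add hQ
  | comp P Q hP hQ => exact hP.mul hQ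
  | star P hP => exact hP.kstar

/-! ### Runs of nondeterministic programs -/

section Runs

variable {A S : Type*} (step : A → S → S → Prop)

/-- The word of actions `w` leads from the first state to the second. -/
def RunPath : List A → S → S → Prop
  | [], s, s' => s = s'
  | a :: w, s, s' => ∃ t, step a s t ∧ RunPath w t s'

/-- Every run of the program `P` from `s` ends in a state with the property `Q`. -/
def Must (P : RegularExpression A) (s : S) (Q : S → Prop) : Prop :=
  ∀ w ∈ P.matches', ∀ s', RunPath step w s s' → Q s'

/-- Some run of the program `P` from `s` ends in a state which, together with the length of the
run, has the property `Q`. -/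
def Can (P : RegularExpression A) (s : S) (Q : ℕ → S → Prop) : Prop :=
  ∃ w ∈ P.matches', ∃ s', RunPath step w s s' ∧ Q w.length s'

variable {step}

theorem path_append {u v : List A} {s s' : S} :
    RunPath step (u ++ v) s s' ↔ ∃ t, RunPath step u s t ∧ RunPath step v t s' := by
  induction u generalizing s with
  | nil => simp [RunPath]
  | cons a u ih =>
    simp only [List.cons_append, RunPath, ih]
    constructor
    · rintro ⟨t, h, r, h1, h2⟩
      exact ⟨r, ⟨t, h, h1⟩, h2⟩
    · rintro ⟨r, ⟨t, h, h1⟩, h2⟩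
      exact ⟨t, h, r, h1, h2⟩

theorem Must.mono {P : RegularExpression A} {s : S} {Q Q' : S → Prop} (h : Must step P s Q)
    (hQ : ∀ s', Q s' → Q' s') : Must step P s Q' := fun w hw s' hp => hQ _ (h w hw s' hp)

theorem Can.mono {P : RegularExpression A} {s : S} {Q Q' : ℕ → S → Prop} (h : Can step P s Q)
    (hQ : ∀ m s', Q m s' → Q' m s') : Can step P s Q' := by
  obtain ⟨w, hw, s', hp, h⟩ := h
  exact ⟨w, hw, s', hp, hQ _ _ h⟩

/-- The rules for the constructors form a calculus of preconditions, by which programs are analysed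
without mentioning words. The number in `Can` accumulates the length of the run. -/
theorem must_char {a : A} {s : S} {Q : S → Prop} :
    Must step (.char a) s Q ↔ ∀ s', step a s s' → Q s' := by
  constructor
  · exact fun h s' hs => h [a] rfl s' ⟨s', hs, rfl⟩
  · rintro h w hw s' hp
    obtain rfl : w = [a] := hw
    obtain ⟨t, h1, rfl⟩ := hp
    exact h _ h1

theorem can_char {a : A} {s : S} {Q : ℕ → S → Prop} :
    Can step (.char a) s Q ↔ ∃ s', step a s s' ∧ Q 1 s' := by
  constructor
  · rintro ⟨w, hw, s', hp, h⟩
    obtain rfl : w = [a] := hw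
    obtain ⟨t, h1, rfl⟩ := hp
    exact ⟨_, h1, h⟩
  · rintro ⟨s', hs, h⟩
    exact ⟨[a], rfl, s', ⟨s', hs, rfl⟩, h⟩

theorem must_one {s : S} {Q : S → Prop} : Must step 1 s Q ↔ Q s := by
  constructor
  · exact fun h => h [] rfl s rfl
  · rintro h w hw s' hp
    obtain rfl : w = [] := hw
    obtain rfl : s = s' := hp
    exact h

theorem can_one {s : S} {Q : ℕ → S → Prop} : Can step 1 s Q ↔ Q 0 s := by
  constructor
  · rintro ⟨w, hw, s', hp, h⟩
    obtain rfl : w = [] := hw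
    obtain rfl : s = s' := hp
    exact h
  · exact fun h => ⟨[], rfl, s, rfl, h⟩

theorem must_zero {s : S} {Q : S → Prop} : Must step 0 s Q ↔ True :=
  ⟨fun _ => trivial, fun _ _ hw => hw.elim⟩

theorem must_add {P P' : RegularExpression A} {s : S} {Q : S → Prop} :
    Must step (P + P') s Q ↔ Must step P s Q ∧ Must step P' s Q := by
  constructor
  · exact fun h => ⟨fun w hw => h w (Or.inl hw), fun w hw => h w (Or.inr hw)⟩
  · rintro ⟨h, h'⟩ w (hw | hw)
    exacts [h w hw, h' w hw]

theorem can_add {P P' : RegularExpression A} {s : S} {Q : ℕ → S → Prop} :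
    Can step (P + P') s Q ↔ Can step P s Q ∨ Can step P' s Q := by
  constructor
  · rintro ⟨w, hw | hw, h⟩
    exacts [Or.inl ⟨w, hw, h⟩, Or.inr ⟨w, hw, h⟩]
  · rintro (⟨w, hw, h⟩ | ⟨w, hw, h⟩)
    exacts [⟨w, Or.inl hw, h⟩, ⟨w, Or.inr hw, h⟩]

theorem must_mul {P P' : RegularExpression A} {s : S} {Q : S → Prop} :
    Must step (P * P') s Q ↔ Must step P s fun t => Must step P' t Q := by
  constructor
  · intro h u hu t ht v hv s' hs'
    exact h (u ++ v) (Language.mem_mul.2 ⟨u, hu, v, hv, rfl⟩) s' (path_append.2 ⟨t, ht, hs'⟩)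
  · intro h w hw s' hp
    obtain ⟨u, hu, v, hv, rfl⟩ := Language.mem_mul.1 hw
    obtain ⟨t, h1, h2⟩ := path_append.1 hp
    exact h u hu t h1 v hv s' h2

theorem can_mul {P P' : RegularExpression A} {s : S} {Q : ℕ → S → Prop} :
    Can step (P * P') s Q ↔ Can step P s fun m t => Can step P' t fun n s' => Q (m + n) s' := by
  constructor
  · rintro ⟨w, hw, s', hp, h⟩
    obtain ⟨u, hu, v, hv, rfl⟩ := Language.mem_mul.1 hw
    obtain ⟨t, h1, h2⟩ := path_append.1 hp
    exact ⟨u, hu, t, h1, v, hv, s', h2, by simpa using h⟩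
  · rintro ⟨u, hu, t, h1, v, hv, s', h2, h⟩
    exact ⟨u ++ v, Language.mem_mul.2 ⟨u, hu, v, hv, rfl⟩, s', path_append.2 ⟨t, h1, h2⟩,
      by simpa using h⟩

/-- Invariants of loops. -/
theorem must_star {P : RegularExpression A} {I : S → Prop}
    (hI : ∀ s, I s → Must step P s I) {s : S} (hs : I s) : Must step P.star s I := by
  intro w hw s' hp
  obtain ⟨L, rfl, hL⟩ := Language.mem_kstar.1 hw
  clear hw
  induction L generalizing s with
  | nil =>
    obtain rfl : s = s' := hp
    exact hs
  | cons u L ih =>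
    rw [List.flatten_cons, path_append] at hp
    obtain ⟨t, h1, h2⟩ := hp
    exact ih (hI s hs u (hL u (by simp)) t h1) (fun z hz => hL z (by simp [hz])) h2

theorem can_star_zero {P : RegularExpression A} {s : S} {Q : ℕ → S → Prop} (h : Q 0 s) :
    Can step P.star s Q := ⟨[], Language.nil_mem_kstar _, s, rfl, h⟩

theorem can_star_succ {P : RegularExpression A} {s : S} {Q : ℕ → S → Prop}
    (h : Can step P s fun m t => Can step P.star t fun n s' => Q (m + n) s') :
    Can step P.star s Q := by
  obtain ⟨u, hu, t, h1, v, hv, s', h2, h⟩ := h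
  obtain ⟨L, rfl, hL⟩ := Language.mem_kstar.1 hv
  refine ⟨(u :: L).flatten, Language.join_mem_kstar ?_, s', ?_, ?_⟩
  · simpa using ⟨hu, hL⟩
  · exact path_append.2 ⟨t, h1, h2⟩
  · simpa using h

/-- Soundness is proved in the form `Must` with `False`, acceptance is stated as `Can`; this is the
passage between them. -/
theorem not_must_false_iff {P : RegularExpression A} {s : S} :
    ¬ Must step P s (fun _ => False) ↔ Can step P s fun _ _ => True := by
  simp [Must, Can]

end Runs

/-! ### Stack programs and their execution by Turing machines -/

/-- The elementary actions on a family of stacks of symbols: pushing a symbol, popping a given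
symbol, and testing for emptiness. -/
inductive StackAct (K : Type)
  | push (k : K) (a : InstSym)
  | pop (k : K) (a : InstSym)
  | empty (k : K)
  deriving DecidableEq, Fintype

/-- The effect of an action on the stacks. -/
def StackAct.Step {K : Type} [DecidableEq K] : StackAct K → (K → List InstSym) →
    (K → List InstSym) → Prop
  | push k a, c, c' => c' = Function.update c k (a :: c k)
  | pop k a, c, c' => ∃ l, c k = a :: l ∧ c' = Function.update c k l
  | empty k, c, c' => c k = [] ∧ c' = c

/-! ### A Turing machine that replays a run given as certificate -/

namespace StackMachine

open Turing Turing.TM2 StateTransition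

/-- The stacks of the verifier: the input, the output and the work stacks. -/
inductive Stack (K : Type)
  | input
  | output
  | work (k : K)
  deriving DecidableEq, Fintype

/-- The labels of the verifier. -/
inductive Label (K : Type)
  | main
  | load (a : InstSym)
  | exec (a : StackAct K)
  | clear
  deriving Fintype

variable {K : Type} [DecidableEq K] {Q : Type}

/-- The alphabets of the stacks of the verifier. -/
abbrev Alphabet : Stack K → Type
  | .input => InstSym ⊕ StackAct K
  | .output => Bool
  | .work _ => InstSym

/-- The internal states of the verifier: the state of the automaton that reads the certificate
(`none` after a failure), the last symbol read and a flag. -/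
abbrev Var (K Q : Type) := Option Q × Option (InstSym ⊕ StackAct K) × Bool

/-- The contents of all stacks. -/
def contents (i : List (InstSym ⊕ StackAct K)) (o : List Bool) (c : K → List InstSym) :
    ∀ k : Stack K, List (Alphabet k)
  | .input => i
  | .output => o
  | .work k => c k

theorem update_input (i i' : List (InstSym ⊕ StackAct K)) (o : List Bool)
    (c : K → List InstSym) :
    Function.update (contents i o c) .input i' = contents i' o c := by
  funext k
  cases k <;> simp [Function.update, contents]

theorem update_output (i : List (InstSym ⊕ StackAct K)) (o o' : List Bool)
    (c : K → List InstSym) :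
    Function.update (contents i o c) .output o' = contents i o' c := by
  funext k
  cases k <;> simp [Function.update, contents]

theorem update_work (i : List (InstSym ⊕ StackAct K)) (o : List Bool)
    (c : K → List InstSym) (k : K) (l : List InstSym) :
    Function.update (contents i o c) (.work k) l = contents i o (Function.update c k l) := by
  funext j
  cases j with
  | input => simp [Function.update, contents]
  | output => simp [Function.update, contents]
  | work j =>
    by_cases h : j = k
    · subst h
      simp [contents]
    · have : Stack.work j ≠ Stack.work k := by simpa using h
      rw [Function.update_of_ne this]
      simp [contents, Function.update_of_ne h]

/-- Pop a symbol from each of some work contents; the flag records whether there was one. -/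
def popAll : List K → Stmt (Alphabet (K := K)) (Label K) (Var K Q) →
    Stmt (Alphabet (K := K)) (Label K) (Var K Q)
  | [], q => q
  | k :: l, q => .pop (.work k) (fun s o => (s.1, s.2.1, s.2.2 || o.isSome)) (popAll l q)


/-- A single machine step removes the top layer of all work stacks, so clearing takes time
proportional to the highest stack. Without repetitions in `l` every stack is popped once. -/
theorem stepAux_popAll (l : List K) (hl : l.Nodup)
    (q : Stmt (Alphabet (K := K)) (Label K) (Var K Q)) (v : Var K Q)
    (i : List (InstSym ⊕ StackAct K)) (o : List Bool) (c : K → List InstSym) :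
    stepAux (popAll l q) v (contents i o c) =
      stepAux q (v.1, v.2.1, v.2.2 || l.any fun k => (c k).head?.isSome)
        (contents i o fun k => if k ∈ l then (c k).tail else c k) := by
  induction l generalizing v c with
  | nil => simp [popAll]
  | cons k l ih =>
    rw [List.nodup_cons] at hl
    rw [popAll, stepAux, update_work, ih hl.2]
    have h1 : (l.any fun j => (Function.update c k (contents i o c (.work k)).tail j).head?.isSome) =
        l.any fun j => (c j).head?.isSome := by
      rw [Bool.eq_iff_iff]
      simp only [List.any_eq_true]
      refine exists_congr fun j => and_congr_right fun hj => ?_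
      have : j ≠ k := fun h => hl.1 (h ▸ hj)
      rw [Function.update_of_ne this]
    have h2 : (fun j => if j ∈ l then (Function.update c k (contents i o c (.work k)).tail j).tail
        else Function.update c k (contents i o c (.work k)).tail j) =
        fun j => if j ∈ k :: l then (c j).tail else c j := by
      funext j
      by_cases hj : j = k
      · subst hj
        simp [hl.1, contents]
      · simp [hj]
    rw [h1, h2]
    simp [contents, Bool.or_assoc]

variable [Fintype K] [Fintype Q]

open Classical in
/-- The program of the verifier. -/
noncomputable def prog (M : DFA (StackAct K) Q) (k₀ : K) :
    Label K → Stmt (Alphabet (K := K)) (Label K) (Var K Q)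
  | .main => .pop .input (fun s o => (s.1, o, s.2.2)) <| .goto fun s =>
      match s.2.1 with
      | none => .clear
      | some (.inl a) => .load a
      | some (.inr a) => .exec a
  | .load a => .push (.work k₀) (fun _ => a) <| .goto fun _ => .main
  | .exec (.push k a) => .push (.work k) (fun _ => a) <|
      .load (fun s => (s.1.map (M.step · (.push k a)), s.2)) <| .goto fun _ => .main
  | .exec (.pop k a) => .pop (.work k) (fun s o =>
      (if o = some a then s.1.map (M.step · (.pop k a)) else none, s.2)) <| .goto fun _ => .main
  | .exec (.empty k) => .peek (.work k) (fun s o =>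
      (if o = none then s.1.map (M.step · (.empty k)) else none, s.2)) <| .goto fun _ => .main
  -- The prescribed halting configuration has the initial internal state and only the output stack
  -- filled. Hence the flag makes the label repeat until no work stack had a symbol, and the state
  -- is reset after the answer has been written.
  | .clear => .load (fun s => (s.1, none, false)) <| popAll Finset.univ.toList <|
      .branch (fun s => s.2.2) (.goto fun _ => .clear) <|
      .push .output (fun s => decide (∃ q ∈ M.accept, s.1 = some q)) <|
      .load (fun _ => (some M.start, none, false)) .halt

/-- The verifier. -/
noncomputable def verifier (M : DFA (StackAct K) Q) (k₀ : K) : FinTM2 where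
  K := Stack K
  k₀ := .input
  k₁ := .output
  Γ := Alphabet
  Λ := Label K
  main := .main
  σ := Var K Q
  initialState := (some M.start, none, false)
  Γk₀Fin := inferInstanceAs (Fintype (InstSym ⊕ StackAct K))
  m := prog M k₀

variable (M : DFA (StackAct K) Q) (k₀ : K)

/-- The configurations of the verifier. -/
def cfg (l : Option (Label K)) (v : Var K Q) (i : List (InstSym ⊕ StackAct K)) (o : List Bool)
    (c : K → List InstSym) : (verifier M k₀).Cfg := ⟨l, v, contents i o c⟩

/-- The verifier gets from one configuration to another in at most `n` steps. -/
def Reach (n : ℕ) (a b : (verifier M k₀).Cfg) : Prop :=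
  Nonempty (EvalsToInTime (verifier M k₀).step a (some b) n)

variable {M k₀}

theorem Reach.trans {m n : ℕ} {a b c : (verifier M k₀).Cfg} (h : Reach M k₀ m a b)
    (h' : Reach M k₀ n b c) : Reach M k₀ (m + n) a c := by
  obtain ⟨h⟩ := h
  obtain ⟨h'⟩ := h'
  exact ⟨Nat.add_comm n m ▸ EvalsToInTime.trans _ _ _ _ _ _ h h'⟩

theorem Reach.single {l : Label K} {v : Var K Q} {i : List (InstSym ⊕ StackAct K)}
    {o : List Bool} {c : K → List InstSym} {b : (verifier M k₀).Cfg}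
    (h : stepAux (prog M k₀ l) v (contents i o c) = b) :
    Reach M k₀ 1 (cfg M k₀ (some l) v i o c) b :=
  ⟨⟨⟨1, congrArg some h⟩, le_rfl⟩⟩

theorem Reach.refl (a : (verifier M k₀).Cfg) : Reach M k₀ 0 a a := ⟨EvalsToInTime.refl _ _⟩

theorem Reach.mono {m n : ℕ} {a b : (verifier M k₀).Cfg} (h : Reach M k₀ m a b) (hmn : m ≤ n) :
    Reach M k₀ n a b := by
  obtain ⟨h⟩ := h
  exact ⟨⟨h.toEvalsTo, h.steps_le_m.trans hmn⟩⟩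

theorem reach_load (x : List InstSym) (i : List (InstSym ⊕ StackAct K)) (v : Var K Q)
    (c : K → List InstSym) :
    ∃ v' : Var K Q, v'.1 = v.1 ∧ Reach M k₀ (2 * x.length)
      (cfg M k₀ (some .main) v (x.map .inl ++ i) [] c)
      (cfg M k₀ (some .main) v' i [] (Function.update c k₀ (x.reverse ++ c k₀))) := by
  induction x generalizing v c with
  | nil => exact ⟨v, rfl, by simpa using Reach.refl _⟩
  | cons a x ih =>
    obtain ⟨v', hv', h⟩ := ih (v.1, some (.inl a), v.2.2) (Function.update c k₀ (a :: c k₀))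
    refine ⟨v', hv', ?_⟩
    have h1 : Reach M k₀ 1 (cfg M k₀ (some .main) v ((a :: x).map .inl ++ i) [] c)
        (cfg M k₀ (some (.load a)) (v.1, some (.inl a), v.2.2) (x.map .inl ++ i) [] c) := by
      apply Reach.single
      simp [prog, cfg, update_input, contents]
      rfl
    have h2 : Reach M k₀ 1
        (cfg M k₀ (some (.load a)) (v.1, some (.inl a), v.2.2) (x.map .inl ++ i) [] c)
        (cfg M k₀ (some .main) (v.1, some (.inl a), v.2.2) (x.map .inl ++ i) []
          (Function.update c k₀ (a :: c k₀))) := by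
      apply Reach.single
      simp [prog, cfg, update_work, contents]
      rfl
    have h3 := (h1.trans h2).trans h
    simp only [Function.update_self, Function.update_idem] at h3
    refine (Reach.mono h3 (by simp; omega)).trans (n := 0) ?_
    simpa using Reach.refl _

/-- A failed pop or test does not stop the machine: the automaton state becomes `none` and stays so,
while the rest of the certificate is consumed. The time is therefore the same for good and bad
certificates. -/
theorem reach_exec (y : List (StackAct K)) (v : Var K Q) (c : K → List InstSym) {H : ℕ}
    (hH : ∀ k, (c k).length ≤ H) :
    ∃ (v' : Var K Q) (c' : K → List InstSym), (∀ k, (c' k).length ≤ H + y.length) ∧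
      Reach M k₀ (2 * y.length) (cfg M k₀ (some .main) v (y.map .inr) [] c)
        (cfg M k₀ (some .main) v' [] [] c') ∧
      ((∃ q ∈ M.accept, v'.1 = some q) ↔
        ∃ q, v.1 = some q ∧ M.evalFrom q y ∈ M.accept ∧ ∃ c'', RunPath StackAct.Step y c c'') := by
  induction y generalizing v c H with
  | nil =>
    refine ⟨v, c, hH, Reach.refl _, ?_⟩
    simp only [DFA.evalFrom_nil, RunPath]
    constructor
    · rintro ⟨q, h, h'⟩
      exact ⟨q, h', h, c, rfl⟩
    · rintro ⟨q, h, h', -⟩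
      exact ⟨q, h', h⟩
  | cons a y ih =>
    have h1 : Reach M k₀ 1 (cfg M k₀ (some .main) v ((a :: y).map .inr) [] c)
        (cfg M k₀ (some (.exec a)) (v.1, some (.inr a), v.2.2) (y.map .inr) [] c) := by
      apply Reach.single
      simp [prog, cfg, update_input, contents]
      rfl
    -- After a failed action the stacks `c₁` do not belong to a run, but then `v₁.1 = none` makes
    -- the left side of the equivalence false, and the right side is false for lack of a path.
    obtain ⟨v₁, c₁, hlen, h2, hq⟩ : ∃ (v₁ : Var K Q) (c₁ : K → List InstSym),
        (∀ k, (c₁ k).length ≤ H + 1) ∧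
        Reach M k₀ 1 (cfg M k₀ (some (.exec a)) (v.1, some (.inr a), v.2.2) (y.map .inr) [] c)
          (cfg M k₀ (some .main) v₁ (y.map .inr) [] c₁) ∧
        ∀ q, v₁.1 = some q ∧ (∃ c'', RunPath StackAct.Step y c₁ c'') ↔
          (∃ q', v.1 = some q' ∧ M.step q' a = q) ∧
            ∃ c'', RunPath StackAct.Step (a :: y) c c'' := by
      cases a with
      | push k a =>
        refine ⟨(v.1.map (M.step · (.push k a)), some (.inr (.push k a)), v.2.2),
          Function.update c k (a :: c k), fun j => ?_, ?_, fun q => ?_⟩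
        · have := hH j
          by_cases hj : j = k
          · subst hj
            simp [this]
          · simp [Function.update_of_ne hj]
            omega
        · apply Reach.single
          simp [prog, cfg, update_work, contents]
          rfl
        · simp [RunPath, StackAct.Step]
      | pop k a =>
        refine ⟨(if (c k).head? = some a then v.1.map (M.step · (.pop k a)) else none,
          some (.inr (.pop k a)), v.2.2),
          Function.update c k (c k).tail, fun j => ?_, ?_, fun q => ?_⟩
        · have := hH j
          by_cases hj : j = k
          · subst hj
            simp
            omega
          · simp [Function.update_of_ne hj]
            omega
        · apply Reach.single
          simp only [prog, cfg, update_work, contents, stepAux]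
          rfl
        · cases hc : c k with
          | nil => simp [RunPath, StackAct.Step, hc]
          | cons b l =>
            by_cases hb : b = a
            · subst hb
              simp [RunPath, StackAct.Step, hc]
            · simp [RunPath, StackAct.Step, hc, hb]
      | empty k =>
        refine ⟨(if (c k).head? = none then v.1.map (M.step · (.empty k)) else none,
          some (.inr (.empty k)), v.2.2), c, fun j => ?_, ?_, fun q => ?_⟩
        · have := hH j
          omega
        · apply Reach.single
          simp only [prog, cfg, contents, stepAux]
          rfl
        · cases hc : c k with
          | nil => simp [RunPath, StackAct.Step, hc]
          | cons b l => simp [RunPath, StackAct.Step, hc]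
    obtain ⟨v', c', hlen', h3, hv'⟩ := ih v₁ c₁ hlen
    refine ⟨v', c', fun k => (hlen' k).trans (by simp; omega),
      ((h1.trans h2).trans h3).mono (by simp; omega), hv'.trans ?_⟩
    constructor
    · rintro ⟨q, h, hacc, h'⟩
      obtain ⟨⟨q', h4, rfl⟩, h5⟩ := (hq q).1 ⟨h, h'⟩
      exact ⟨q', h4, by simpa [DFA.evalFrom_cons] using hacc, h5⟩
    · rintro ⟨q', h, hacc, h'⟩
      obtain ⟨h4, h5⟩ := (hq _).2 ⟨⟨q', h, rfl⟩, h'⟩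
      exact ⟨_, h4, by simpa [DFA.evalFrom_cons] using hacc, h5⟩

open Classical in
-- Induction on the height: each step lowers all stacks by one, and a last step finds them empty and
-- halts.
theorem reach_clear (H : ℕ) (v : Var K Q) (c : K → List InstSym) (hH : ∀ k, (c k).length ≤ H) :
    Reach M k₀ (H + 1) (cfg M k₀ (some .clear) v [] [] c)
      (cfg M k₀ none (some M.start, none, false) []
        [decide (∃ q ∈ M.accept, v.1 = some q)] fun _ => []) := by
  have key : ∀ (v : Var K Q) c, stepAux (prog M k₀ .clear) v (contents [] [] c) =
      if ∃ k, c k ≠ [] then cfg M k₀ (some .clear) (v.1, none, true) [] [] (fun k => (c k).tail)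
      else cfg M k₀ none (some M.start, none, false) []
        [decide (∃ q ∈ M.accept, v.1 = some q)] fun k => (c k).tail := by
    intro v c
    have h1 : (Finset.univ.toList.any fun k => (c k).head?.isSome) = decide (∃ k, c k ≠ []) := by
      rw [Bool.eq_iff_iff]
      simp [List.any_eq_true]
    rw [prog, stepAux, stepAux_popAll _ (Finset.nodup_toList _), h1]
    by_cases h : ∃ k, c k ≠ []
    · simp [cfg, h]
      rfl
    · simp only [h]
      simp [cfg, update_output, contents]
      rfl
  induction H generalizing v c with
  | zero =>
    have h0 : ∀ k, c k = [] := fun k => List.length_eq_zero_iff.1 (Nat.le_zero.1 (hH k))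
    apply Reach.single
    rw [key, if_neg (by simpa using h0)]
    simp only [h0, List.tail_nil]
    rfl
  | succ H ih =>
    by_cases h : ∃ k, c k ≠ []
    · have h1 : Reach M k₀ 1 (cfg M k₀ (some .clear) v [] [] c)
          (cfg M k₀ (some .clear) (v.1, none, true) [] [] (fun k => (c k).tail)) := by
        apply Reach.single
        rw [key, if_pos h]
      refine (h1.trans (ih (v.1, none, true) (fun k => (c k).tail) ?_)).mono (by omega)
      intro k
      have := hH k
      simp
      omega
    · have h0 : ∀ k, c k = [] := by simpa using h
      refine Reach.mono (m := 1) ?_ (by omega)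
      apply Reach.single
      rw [key, if_neg (by simpa using h0)]
      simp only [h0, List.tail_nil]
      rfl

theorem initList_eq (i : List (InstSym ⊕ StackAct K)) :
    initList (verifier M k₀) i =
      cfg M k₀ (some .main) (some M.start, none, false) i [] fun _ => [] := by
  have h : (initList (verifier M k₀) i).stk = contents i [] fun _ => [] := by
    funext k
    cases k <;> rfl
  exact congrArg (fun s => (⟨some .main, (some M.start, none, false), s⟩ : (verifier M k₀).Cfg)) h

theorem haltList_eq (o : List Bool) :
    haltList (verifier M k₀) o =
      cfg M k₀ none (some M.start, none, false) [] o fun _ => [] := by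
  have h : (haltList (verifier M k₀) o).stk = contents [] o fun _ => [] := by
    funext k
    cases k <;> rfl
  exact congrArg (fun s => (⟨none, (some M.start, none, false), s⟩ : (verifier M k₀).Cfg)) h

end StackMachine

open Turing in
open Classical in
/-- A language is in `NP` if it consists of the words on which a stack program has an accepting run
of polynomial length. -/
theorem mem_classNP_of_stackProgram {K : Type} [DecidableEq K] [Fintype K]
    (P : RegularExpression (StackAct K)) (k₀ : K) (p : Polynomial ℕ) (L : Set (List InstSym))
    (hL : ∀ x, x ∈ L → Can StackAct.Step P (Function.update (fun _ => []) k₀ x.reverse)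
      fun m _ => m ≤ p.eval x.length)
    (hL' : ∀ x, Can StackAct.Step P (Function.update (fun _ => []) k₀ x.reverse)
      (fun _ _ => True) → x ∈ L) :
    L ∈ classNP InstSym := by
  obtain ⟨Q, _, M, hM⟩ := P.isRegular_matches'
  let V : List InstSym × List (StackAct K) → Bool := fun z =>
    decide (z.2 ∈ P.matches' ∧ ∃ c, RunPath StackAct.Step z.2
      (Function.update (fun _ => []) k₀ z.1.reverse) c)
  refine ⟨StackAct K, inferInstance, p, V, ?_, ?_⟩
  -- Two steps for each symbol of `x` and `y`, one to notice the end of the input, and at most `|x|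
  -- + |y| + 1` for clearing, as no stack is higher than the number of symbols read.
  · refine ⟨⟨⟨StackMachine.verifier M k₀, Equiv.refl _, Equiv.refl _⟩,
      3 * Polynomial.X + 2, fun z => ?_⟩⟩
    obtain ⟨x, y⟩ := z
    apply Classical.choice
    obtain ⟨v₁, hv₁, h1⟩ := StackMachine.reach_load (M := M) (k₀ := k₀) x (y.map .inr)
      (some M.start, none, false) (fun _ => [])
    obtain ⟨v₂, c₂, hc₂, h2, hv₂⟩ := StackMachine.reach_exec (M := M) (k₀ := k₀) y v₁
      (Function.update (fun _ => []) k₀ (x.reverse ++ [])) (H := x.length) (by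
        intro k
        by_cases hk : k = k₀
        · subst hk
          simp
        · simp [Function.update_of_ne hk])
    have h3 : StackMachine.Reach M k₀ 1 (StackMachine.cfg M k₀ (some .main) v₂ [] [] c₂)
        (StackMachine.cfg M k₀ (some .clear) (v₂.1, none, v₂.2.2) [] [] c₂) := by
      apply StackMachine.Reach.single
      simp [StackMachine.prog, StackMachine.cfg, StackMachine.update_input, StackMachine.contents]
      rfl
    have h4 := StackMachine.reach_clear (M := M) (k₀ := k₀) _ (v₂.1, none, v₂.2.2) c₂ hc₂
    have h5 := ((h1.trans h2).trans h3).trans h4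
    have hV : decide (∃ q ∈ M.accept, v₂.1 = some q) = V (x, y) := by
      refine decide_eq_decide.2 (hv₂.trans ?_)
      rw [hv₁, ← hM, List.append_nil]
      constructor
      · rintro ⟨q, hq, h, h'⟩
        obtain rfl := Option.some_injective _ hq
        exact ⟨h, h'⟩
      · rintro ⟨h, h'⟩
        exact ⟨_, rfl, h, h'⟩
    simp only [hV] at h5
    have h6 := h5.mono (n := (3 * Polynomial.X + 2 : Polynomial ℕ).eval
      (x.map Sum.inl ++ y.map Sum.inr : List (InstSym ⊕ StackAct K)).length) (by
        simp
        omega)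
    rw [← StackMachine.initList_eq, ← StackMachine.haltList_eq] at h6
    have key : ∀ (l l' : List (InstSym ⊕ StackAct K)) (o o' : List Bool) (n : ℕ), l' = l → o' = o →
        StackMachine.Reach M k₀ n (initList (StackMachine.verifier M k₀) l)
          (haltList (StackMachine.verifier M k₀) o) →
        StackMachine.Reach M k₀ n (initList (StackMachine.verifier M k₀) l')
          (haltList (StackMachine.verifier M k₀) o') := by
      rintro l _ o _ n rfl rfl h
      exact h
    exact key _ _ _ _ _ (List.map_id _) (List.map_id _) h6
  · intro x
    simp only [V, decide_eq_true_eq]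
    constructor
    · intro hx
      obtain ⟨y, hy, c, hc, h⟩ := hL x hx
      exact ⟨y, h, hy, c, hc⟩
    · rintro ⟨y, -, hy, c, hc⟩
      exact hL' x ⟨y, hy, c, hc, trivial⟩

/-! ### Binary words -/

/-- The symbol for a binary digit. -/
def bitSym (b : Bool) : InstSym := if b then .one else .zero

/-- The number described by a word, least significant digit first. -/
def wordVal : List InstSym → ℕ
  | [] => 0
  | a :: l => (if a = .one then 1 else 0) + 2 * wordVal l

/-- The word consists of binary digits. -/
def IsBits (l : List InstSym) : Prop := ∀ a ∈ l, a ∈ [InstSym.zero, InstSym.one]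

theorem encodeNatSym_zero : encodeNatSym 0 = [] := by simp [encodeNatSym]

/-- The excluded case `m = 0`, `b = false` would produce a superfluous zero. -/
theorem encodeNatSym_bit (m : ℕ) (b : Bool) (h : m ≠ 0 ∨ b = true) :
    encodeNatSym (2 * m + b.toNat) = bitSym b :: encodeNatSym m := by
  have h1 := Nat.bits_append_bit m b (by rintro rfl; simpa using h)
  rw [Nat.bit_val] at h1
  rw [encodeNatSym, h1]
  cases b <;> simp [bitSym, encodeNatSym]

theorem isBits_encodeNatSym (m : ℕ) : IsBits (encodeNatSym m) := by
  intro a ha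
  simp only [encodeNatSym, List.mem_map] at ha
  obtain ⟨b, -, rfl⟩ := ha
  cases b <;> simp

theorem length_encodeNatSym_le {m B : ℕ} (h : m < 2 ^ B) : (encodeNatSym m).length ≤ B := by
  rw [encodeNatSym, List.length_map, Nat.size_eq_bits_len]
  exact Nat.size_le.2 h

theorem lt_two_pow_length_encodeNatSym (m : ℕ) : m < 2 ^ (encodeNatSym m).length := by
  rw [encodeNatSym, List.length_map, Nat.size_eq_bits_len]
  exact Nat.lt_size_self m

theorem wordVal_encodeNatSym (m : ℕ) : wordVal (encodeNatSym m) = m := by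
  induction m using Nat.strong_induction_on with
  | _ m ih =>
    rcases Nat.eq_zero_or_pos m with rfl | hm
    · simp [encodeNatSym_zero, wordVal]
    · obtain ⟨k, b, rfl⟩ : ∃ (k : ℕ) (b : Bool), m = 2 * k + b.toNat := by
        rcases Nat.even_or_odd' m with ⟨k, rfl | rfl⟩
        exacts [⟨k, false, rfl⟩, ⟨k, true, rfl⟩]
      have hk : k < 2 * k + b.toNat := by
        cases b <;> simp at hm ⊢ <;> omega
      rw [encodeNatSym_bit k b (by cases b <;> simp at hm ⊢; omega), wordVal, ih k hk]
      cases b <;> (simp [bitSym]; try omega)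

theorem encodeNatSym_injective : Function.Injective encodeNatSym :=
  Function.LeftInverse.injective wordVal_encodeNatSym

theorem encodeNatSym_eq_nil {m : ℕ} : encodeNatSym m = [] ↔ m = 0 := by
  rw [← encodeNatSym_zero]
  exact encodeNatSym_injective.eq_iff

theorem encodeNatSym_eq_cons {m : ℕ} {a : InstSym} {l : List InstSym} :
    encodeNatSym m = a :: l ↔
      ∃ k b, m = 2 * k + Bool.toNat b ∧ (k ≠ 0 ∨ b = true) ∧ a = bitSym b ∧ l = encodeNatSym k := by
  constructor
  · intro h
    obtain ⟨k, b, rfl⟩ : ∃ (k : ℕ) (b : Bool), m = 2 * k + b.toNat := by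
      rcases Nat.even_or_odd' m with ⟨k, rfl | rfl⟩
      exacts [⟨k, false, rfl⟩, ⟨k, true, rfl⟩]
    have hk : k ≠ 0 ∨ b = true := by
      by_contra hk
      push Not at hk
      obtain ⟨rfl, hb⟩ := hk
      simp at hb
      subst hb
      simp [encodeNatSym_zero] at h
    rw [encodeNatSym_bit k b hk, List.cons.injEq] at h
    exact ⟨k, b, rfl, hk, h.1.symm, h.2.symm⟩
  · rintro ⟨k, b, rfl, hk, rfl, rfl⟩
    exact encodeNatSym_bit k b hk

/-- Together with `encodeNatSym_eq_append_one` this characterises the numerals of positive numbers: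
arbitrary digits below a leading `one`. So a number can be guessed digit by digit. -/
theorem exists_encodeNatSym_eq {l : List InstSym} (hl : IsBits l) :
    ∃ m, 0 < m ∧ encodeNatSym m = l ++ [.one] := by
  induction l with
  | nil => exact ⟨1, one_pos, by simpa [bitSym, encodeNatSym_zero] using encodeNatSym_bit 0 true⟩
  | cons a l ih =>
    obtain ⟨m, hm, h⟩ := ih fun b hb => hl b (by simp [hb])
    obtain ⟨b, rfl⟩ : ∃ b, a = bitSym b := by
      have := hl a (by simp)
      simp only [List.mem_cons, List.not_mem_nil, or_false] at this
      rcases this with rfl | rfl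
      exacts [⟨false, rfl⟩, ⟨true, rfl⟩]
    refine ⟨2 * m + b.toNat, by omega, ?_⟩
    rw [encodeNatSym_bit m b (Or.inl hm.ne'), h, List.cons_append]

theorem encodeNatSym_eq_append_one {m : ℕ} (hm : m ≠ 0) :
    ∃ l, IsBits l ∧ encodeNatSym m = l ++ [.one] := by
  induction m using Nat.strong_induction_on with
  | _ m ih =>
    cases hc : encodeNatSym m with
    | nil => exact absurd (encodeNatSym_eq_nil.1 hc) hm
    | cons a l =>
      obtain ⟨k, b, rfl, hk, rfl, rfl⟩ := encodeNatSym_eq_cons.1 hc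
      by_cases h0 : k = 0
      · subst h0
        obtain rfl : b = true := by simpa using hk
        exact ⟨[], by simp [IsBits], by simp [bitSym, encodeNatSym_zero]⟩
      · obtain ⟨l, hl, h⟩ := ih k (by omega) h0
        refine ⟨bitSym b :: l, ?_, by rw [h, List.cons_append]⟩
        intro c hc
        rcases List.mem_cons.1 hc with rfl | hc
        · cases b <;> simp [bitSym]
        · exact hl c hc

/-! ### Elementary stack programs -/

namespace StackProgram

open RegularExpression StackAct Function

variable {K : Type} [DecidableEq K]

/-- The union of a family of programs indexed by a list. -/
def oneOf {A ι : Type} (f : ι → RegularExpression A) (l : List ι) : RegularExpression A :=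
  l.foldr (fun a P => f a + P) 0

theorem must_oneOf {A ι S : Type} {step : A → S → S → Prop} {f : ι → RegularExpression A}
    {l : List ι} {s : S} {Q : S → Prop} :
    Must step (oneOf f l) s Q ↔ ∀ a ∈ l, Must step (f a) s Q := by
  induction l with
  | nil => simpa [oneOf] using must_zero.2 trivial
  | cons a l ih =>
    rw [show oneOf f (a :: l) = f a + oneOf f l from rfl, must_add, ih]
    simp

theorem can_oneOf {A ι S : Type} {step : A → S → S → Prop} {f : ι → RegularExpression A}
    {l : List ι} {s : S} {Q : ℕ → S → Prop} {a : ι} (ha : a ∈ l) (h : Can step (f a) s Q) :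
    Can step (oneOf f l) s Q := by
  induction l with
  | nil => simp at ha
  | cons b l ih =>
    rw [show oneOf f (b :: l) = f b + oneOf f l from rfl, can_add]
    rcases List.mem_cons.1 ha with rfl | ha
    exacts [Or.inl h, Or.inr (ih ha)]

variable {c : K → List InstSym} {k s : K} {a : InstSym} {Q : (K → List InstSym) → Prop}
  {Q' : ℕ → (K → List InstSym) → Prop}

theorem must_push : Must Step (char (push k a)) c Q ↔ Q (update c k (a :: c k)) := by
  simp [must_char, Step]

theorem must_pop : Must Step (char (pop k a)) c Q ↔ ∀ l, c k = a :: l → Q (update c k l) := by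
  simp only [must_char, Step]
  constructor
  · exact fun h l hl => h _ ⟨l, hl, rfl⟩
  · rintro h _ ⟨l, hl, rfl⟩
    exact h l hl

theorem must_empty : Must Step (char (empty k)) c Q ↔ (c k = [] → Q c) := by
  simp only [must_char, Step]
  constructor
  · exact fun h hk => h _ ⟨hk, rfl⟩
  · rintro h _ ⟨hk, rfl⟩
    exact h hk

theorem can_push : Can Step (char (push k a)) c Q' ↔ Q' 1 (update c k (a :: c k)) := by
  simp [can_char, Step]

theorem can_pop : Can Step (char (pop k a)) c Q' ↔ ∃ l, c k = a :: l ∧ Q' 1 (update c k l) := by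
  simp only [can_char, Step]
  constructor
  · rintro ⟨_, ⟨l, hl, rfl⟩, h⟩
    exact ⟨l, hl, h⟩
  · rintro ⟨l, hl, h⟩
    exact ⟨_, ⟨l, hl, rfl⟩, h⟩

theorem can_empty : Can Step (char (empty k)) c Q' ↔ c k = [] ∧ Q' 1 c := by
  simp only [can_char, Step]
  constructor
  · rintro ⟨_, ⟨hk, rfl⟩, h⟩
    exact ⟨hk, h⟩
  · rintro ⟨hk, h⟩
    exact ⟨_, ⟨hk, rfl⟩, h⟩

/-- Move some symbols of the set `A` from the stack `s` to the stack `k`. -/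
def move (A : List InstSym) (s k : K) : RegularExpression (StackAct K) :=
  star (oneOf (fun a => char (pop s a) * char (push k a)) A)

/-- The loop may stop at any time, hence the arbitrary prefix `u`. The action that follows a move,
such as a test for emptiness, singles out the intended prefix. -/
theorem must_move {A : List InstSym} (hsk : s ≠ k)
    (h : ∀ u v, c s = u ++ v → (∀ a ∈ u, a ∈ A) →
      Q (update (update c s v) k (u.reverse ++ c k))) : Must Step (move A s k) c Q := by
  refine Must.mono (Q := fun c' => ∃ u v, c s = u ++ v ∧ (∀ a ∈ u, a ∈ A) ∧
      c' = update (update c s v) k (u.reverse ++ c k)) (must_star ?_ ?_) ?_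
  · rintro _ ⟨u, v, h1, h2, rfl⟩
    rw [must_oneOf]
    intro a ha
    rw [must_mul, must_pop]
    intro l hl
    rw [must_push]
    rw [update_of_ne hsk, update_self] at hl
    subst hl
    refine ⟨u ++ [a], l, by simpa using h1, ?_, ?_⟩
    · intro b hb
      rcases List.mem_append.1 hb with hb | hb
      · exact h2 b hb
      · rw [List.mem_singleton.1 hb]
        exact ha
    · funext j
      simp only [update_apply]
      split_ifs <;> simp_all
  · exact ⟨[], c s, rfl, by simp, by simp⟩
  · rintro _ ⟨u, v, h1, h2, rfl⟩
    exact h u v h1 h2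

theorem can_move {A : List InstSym} (hsk : s ≠ k) {u v : List InstSym} (hu : c s = u ++ v)
    (hA : ∀ a ∈ u, a ∈ A) (h : Q' (2 * u.length) (update (update c s v) k (u.reverse ++ c k))) :
    Can Step (move A s k) c Q' := by
  induction u generalizing c Q' with
  | nil =>
    refine can_star_zero ?_
    rw [List.nil_append] at hu
    subst hu
    simpa using h
  | cons a u ih =>
    refine can_star_succ (can_oneOf (hA a (by simp)) ?_)
    rw [can_mul, can_pop]
    refine ⟨u ++ v, hu, can_push.2 ?_⟩
    refine ih (c := update (update c s (u ++ v)) k (a :: update c s (u ++ v) k)) ?_ ?_ ?_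
    · rw [update_of_ne hsk, update_self]
    · exact fun b hb => hA b (by simp [hb])
    · convert h using 1
      · simp
        omega
      · funext j
        simp only [update_apply]
        split_ifs <;> simp_all

/-- Move all symbols from the stack `s` to the stack `k`; they have to belong to the set `A`. -/
def moveAll (A : List InstSym) (s k : K) : RegularExpression (StackAct K) :=
  move A s k * char (empty s)

theorem must_moveAll {A : List InstSym} (hsk : s ≠ k)
    (h : (∀ a ∈ c s, a ∈ A) → Q (update (update c s []) k ((c s).reverse ++ c k))) :
    Must Step (moveAll A s k) c Q := by
  refine must_mul.2 (must_move hsk fun u v hu hA => must_empty.2 fun hv => ?_)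
  rw [update_of_ne hsk, update_self] at hv
  subst hv
  rw [List.append_nil] at hu
  subst hu
  exact h hA

theorem can_moveAll {A : List InstSym} (hsk : s ≠ k) (hA : ∀ a ∈ c s, a ∈ A)
    (h : Q' (2 * (c s).length + 1) (update (update c s []) k ((c s).reverse ++ c k))) :
    Can Step (moveAll A s k) c Q' := by
  refine can_mul.2 (can_move hsk (c s).append_nil.symm hA (can_empty.2 ⟨?_, h⟩))
  rw [update_of_ne hsk, update_self]

/-- Remove some binary digits from a stack and test that it is empty. -/
def dropBits (k : K) : RegularExpression (StackAct K) :=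
  star (oneOf (fun a => char (pop k a)) [.zero, .one]) * char (empty k)

theorem must_dropBits (h : Q (update c k [])) : Must Step (dropBits k) c Q := by
  refine must_mul.2 (Must.mono (must_star (I := fun c' => ∃ v, c' = update c k v) ?_
    ⟨c k, by simp⟩) ?_)
  · rintro _ ⟨v, rfl⟩
    rw [must_oneOf]
    exact fun a _ => must_pop.2 fun l _ => ⟨l, by simp⟩
  · rintro _ ⟨v, rfl⟩
    refine must_empty.2 fun hv => ?_
    rw [update_self] at hv
    rwa [hv]

theorem can_dropBits (hA : IsBits (c k)) (h : Q' ((c k).length + 1) (update c k [])) :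
    Can Step (dropBits k) c Q' := by
  refine can_mul.2 ?_
  suffices H : ∀ (u : List InstSym) c (Q' : ℕ → (K → List InstSym) → Prop), c k = u → IsBits u →
      Q' u.length (update c k []) →
      Can Step (star (oneOf (fun a => char (pop k a)) [InstSym.zero, .one])) c Q' from
    H _ c _ rfl hA (can_empty.2 ⟨by simp, h⟩)
  intro u
  induction u with
  | nil =>
    intro c Q' hc _ h
    refine can_star_zero ?_
    rwa [← hc, update_eq_self, hc] at h
  | cons a u ih =>
    intro c Q' hc hu h
    refine can_star_succ (can_oneOf (hu a (by simp)) (can_pop.2 ⟨u, hc, ?_⟩))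
    refine ih _ _ (by simp) (fun b hb => hu b (by simp [hb])) ?_
    simpa [Nat.add_comm] using h

/-- Push some binary digits. -/
def pushBits (k : K) : RegularExpression (StackAct K) :=
  star (oneOf (fun a => char (push k a)) [.zero, .one])

theorem must_pushBits (h : ∀ u, IsBits u → Q (update c k (u ++ c k))) :
    Must Step (pushBits k) c Q := by
  refine Must.mono (must_star (I := fun c' => ∃ u, IsBits u ∧ c' = update c k (u ++ c k)) ?_
    ⟨[], by simp [IsBits], by simp⟩) ?_
  · rintro _ ⟨u, hu, rfl⟩
    rw [must_oneOf]
    refine fun a ha => must_push.2 ⟨a :: u, ?_, by simp⟩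
    intro b hb
    rcases List.mem_cons.1 hb with rfl | hb
    exacts [ha, hu b hb]
  · rintro _ ⟨u, hu, rfl⟩
    exact h u hu

theorem can_pushBits {u : List InstSym} (hu : IsBits u)
    (h : Q' u.length (update c k (u.reverse ++ c k))) : Can Step (pushBits k) c Q' := by
  induction u generalizing c Q' with
  | nil => exact can_star_zero (by simpa using h)
  | cons a u ih =>
    refine can_star_succ (can_oneOf (hu a (by simp)) (can_push.2 ?_))
    refine ih (fun b hb => hu b (by simp [hb])) ?_
    simpa [Nat.add_comm] using h

/-- Replace the number on a stack by an arbitrary number. -/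
def guessNat (k : K) : RegularExpression (StackAct K) :=
  dropBits k * (1 + char (push k .one) * pushBits k)

/-- The symbol `one` is pushed first and so becomes the leading digit, at the bottom; all results
are numerals without superfluous zeros. -/
theorem must_guessNat (h : ∀ m, Q (update c k (encodeNatSym m))) : Must Step (guessNat k) c Q := by
  refine must_mul.2 (must_dropBits (must_add.2 ⟨must_one.2 ?_, must_mul.2 (must_push.2 ?_)⟩))
  · simpa [encodeNatSym_zero] using h 0
  · refine must_pushBits fun u hu => ?_
    obtain ⟨m, -, hm⟩ := exists_encodeNatSym_eq hu
    simpa [hm] using h m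

theorem can_guessNat (hk : IsBits (c k)) (m : ℕ)
    (h : ∀ n ≤ (c k).length + (encodeNatSym m).length + 1, Q' n (update c k (encodeNatSym m))) :
    Can Step (guessNat k) c Q' := by
  refine can_mul.2 (can_dropBits hk (can_add.2 ?_))
  by_cases hm : m = 0
  · subst hm
    refine Or.inl (can_one.2 ?_)
    have := h ((c k).length + 1 + 0) (by omega)
    rwa [encodeNatSym_zero] at this
  · obtain ⟨l, hl, hlm⟩ := encodeNatSym_eq_append_one hm
    refine Or.inr (can_mul.2 (can_push.2 (can_pushBits (u := l.reverse) ?_ ?_)))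
    · exact fun a ha => hl a (List.mem_reverse.1 ha)
    · have := h ((c k).length + 1 + (1 + l.length)) (by simp [hlm]; omega)
      simpa [hlm] using this

/-- Compare the number on the stack `k` with a prefix of the stack `i`, which is removed. -/
def matchPrefix (k i s : K) : RegularExpression (StackAct K) :=
  star (oneOf (fun a => char (pop k a) * (char (pop i a) * char (push s a))) [.zero, .one]) *
    (char (empty k) * moveAll [.zero, .one] s k)

/-- The stack `s` keeps the matched digits until they are moved back to `k`. Nothing ensures that
the numeral in `i` ends with the match; in the programs a separator is read next, which enforces
this. -/
theorem must_matchPrefix {i : K} (hki : k ≠ i) (hks : k ≠ s) (his : i ≠ s) (hs : c s = [])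
    (h : ∀ v, c i = c k ++ v → Q (update c i v)) : Must Step (matchPrefix k i s) c Q := by
  refine must_mul.2 (Must.mono (must_star (I := fun c' => ∃ u v w, c k = u ++ v ∧ c i = u ++ w ∧
    c' = update (update (update c k v) i w) s u.reverse) ?_
    ⟨[], c k, c i, rfl, rfl, by rw [List.reverse_nil, ← hs]; simp⟩) ?_)
  · rintro _ ⟨u, v, w, h1, h2, rfl⟩
    rw [must_oneOf]
    intro a _
    refine must_mul.2 (must_pop.2 fun v' hv => must_mul.2 (must_pop.2 fun w' hw => must_push.2 ?_))
    simp only [update_apply, hki, hks, his, hki.symm, if_true, if_false] at hv hw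
    subst hv hw
    refine ⟨u ++ [a], v', w', by simpa using h1, by simpa using h2, ?_⟩
    funext j
    simp only [update_apply]
    split_ifs <;> simp_all
  · rintro _ ⟨u, v, w, h1, h2, rfl⟩
    refine must_mul.2 (must_empty.2 fun hv => must_moveAll hks.symm fun _ => ?_)
    simp only [update_apply, hki, hks, if_true, if_false] at hv
    subst hv
    rw [List.append_nil] at h1
    rw [← h1] at h2
    convert h w h2 using 1
    funext j
    simp only [update_apply]
    split_ifs <;> simp_all

theorem can_matchPrefix {i : K} (hki : k ≠ i) (hks : k ≠ s) (his : i ≠ s) (hs : c s = [])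
    (hk : IsBits (c k)) {v : List InstSym} (hv : c i = c k ++ v)
    (h : Q' (5 * (c k).length + 2) (update c i v)) : Can Step (matchPrefix k i s) c Q' := by
  refine can_mul.2 ?_
  -- Three actions per digit in the loop and two for moving it back, plus two tests for emptiness.
  suffices H : ∀ (u : List InstSym) c (Q' : ℕ → (K → List InstSym) → Prop), c k = u → c i = u ++ v →
      IsBits u → Q' (3 * u.length)
        (update (update (update c k []) i v) s (u.reverse ++ c s)) →
      Can Step (star (oneOf (fun a => char (pop k a) * (char (pop i a) * char (push s a)))
        [InstSym.zero, .one])) c Q' by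
    refine H _ c _ rfl hv hk (can_mul.2 (can_empty.2 ⟨?_, can_moveAll hks.symm ?_ ?_⟩))
    · simp only [update_apply, hki, hks, if_true, if_false]
    · intro a ha
      refine hk a ?_
      simpa [hs] using ha
    · convert h using 1
      · simp [hs]
        omega
      · funext j
        simp only [update_apply]
        split_ifs <;> simp_all
  intro u
  induction u with
  | nil =>
    intro c Q' h1 h2 _ h
    refine can_star_zero ?_
    have h' : Q' 0 _ := h
    convert h' using 1
    funext j
    simp only [update_apply]
    split_ifs <;> simp_all
  | cons a u ih =>
    intro c Q' h1 h2 hu h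
    refine can_star_succ (can_oneOf (hu a (by simp)) (can_mul.2 (can_pop.2 ⟨u, h1, can_mul.2
      (can_pop.2 ⟨u ++ v, ?_, can_push.2 ?_⟩)⟩)))
    · simpa [update_of_ne hki.symm] using h2
    · refine ih _ _ ?_ ?_ (fun b hb => hu b (by simp [hb])) ?_
      · simp only [update_apply, hki, hks, if_true, if_false]
      · simp only [update_apply, his, if_true, if_false]
      · convert h using 1
        · simp
          omega
        · funext j
          simp only [update_apply]
          split_ifs <;> simp_all

end StackProgram

/-! ### Binary addition on stacks -/

namespace StackProgram

open RegularExpression StackAct Function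

/-- The stacks of a program with number registers `R` and stacks of numbers `Λ`; apart from these
there are the stack for the input, three auxiliary stacks, and one for the carry. -/
inductive Cell (R Λ : Type)
  | reg (r : R)
  | lst (l : Λ)
  | inp
  | aux₁
  | aux₂
  | aux₃
  | carry
  deriving DecidableEq, Fintype

variable {K : Type} [DecidableEq K]

/-- Move the lowest digit, which has to be `b`, from the stack `k` to the stack `s`. -/
def moveDigit (k s : K) (b : Bool) : RegularExpression (StackAct K) :=
  char (pop k (bitSym b)) * char (push s (bitSym b)) + (if b then 0 else char (empty k))

/-- An exhausted word counts as continued by zeros. So `e` is either one digit or empty, and both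
cases share the equation between the values. -/
theorem must_moveDigit {k s : K} (hks : k ≠ s) {b : Bool} {c : K → List InstSym}
    {Q : (K → List InstSym) → Prop}
    (h : ∀ e l, c k = e ++ l → IsBits e → wordVal (c k) = b.toNat + 2 * wordVal l →
      Q (update (update c k l) s (e.reverse ++ c s))) : Must Step (moveDigit k s b) c Q := by
  refine must_add.2 ⟨must_mul.2 (must_pop.2 fun l hl => must_push.2 ?_), ?_⟩
  · have := h [bitSym b] l hl (by cases b <;> simp [bitSym, IsBits])
      (by rw [hl]; cases b <;> simp [wordVal, bitSym])
    simpa [update_of_ne hks.symm] using this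
  · cases b with
    | true => exact must_zero.2 trivial
    | false =>
      refine must_empty.2 fun hk => ?_
      have := h [] (c k) rfl (by simp [IsBits]) (by simp [hk, wordVal])
      simpa using this

/-- The lowest digit of a word. -/
def lowDigit : List InstSym → Bool
  | .one :: _ => true
  | _ => false

theorem wordVal_eq (l : List InstSym) :
    wordVal l = (lowDigit l).toNat + 2 * wordVal l.tail := by
  cases l with
  | nil => rfl
  | cons a l => cases a <;> rfl

theorem can_moveDigit {k s : K} (hks : k ≠ s) {c : K → List InstSym}
    {Q : ℕ → (K → List InstSym) → Prop} {v : List InstSym} (hv : c k = v) (hb : IsBits v)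
    (h : ∀ m ≤ 2, Q m (update (update c k v.tail) s (v.take 1 ++ c s))) :
    Can Step (moveDigit k s (lowDigit v)) c Q := by
  refine can_add.2 ?_
  cases v with
  | nil =>
    refine Or.inr (can_empty.2 ⟨hv, ?_⟩)
    have := h 1 (by norm_num)
    rwa [List.tail_nil, List.take_nil, List.nil_append, ← hv, update_eq_self,
      update_eq_self] at this
  | cons a l =>
    have ha : a = bitSym (lowDigit (a :: l)) := by
      have := hb a (by simp)
      simp only [List.mem_cons, List.not_mem_nil, or_false] at this
      rcases this with rfl | rfl <;> rfl
    refine Or.inl (can_mul.2 (can_pop.2 ⟨l, by rw [← ha, hv], can_push.2 ?_⟩))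
    rw [← ha]
    simpa [update_of_ne hks.symm] using h 2 le_rfl

section Sum

variable {R Λ : Type} [DecidableEq R]

/-- One step of the addition of two numbers, which have the lowest digits `a` and `b`, with the
carry `p`. -/
def sumDigit (x y z : R) (t : Bool × Bool × Bool) :
    RegularExpression (StackAct (Cell R Λ)) :=
  moveDigit (.reg x) .aux₁ t.1 * (moveDigit (.reg y) .aux₂ t.2.1 *
    (moveDigit (.reg z) .aux₃ (t.1 ^^ t.2.1 ^^ t.2.2) *
    ((if t.2.2 then char (pop .carry .one) else char (empty .carry)) *
      (if Bool.atLeastTwo t.1 t.2.1 t.2.2 then char (push .carry .one) else 1))))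

/-- Test whether the sum of the numbers in the registers `x` and `y` is the number in `z`. -/
noncomputable def sumTest (x y z : R) : RegularExpression (StackAct (Cell R Λ)) :=
  star (oneOf (sumDigit x y z) Finset.univ.toList) *
    (char (empty (.reg x)) * (char (empty (.reg y)) * (char (empty (.reg z)) *
      (char (empty .carry) * (moveAll [.zero, .one] .aux₁ (.reg x) *
      (moveAll [.zero, .one] .aux₂ (.reg y) * moveAll [.zero, .one] .aux₃ (.reg z)))))))

/-- The contents of the stacks during an addition. -/
def sumCfg (x y z : R) (c : Cell R Λ → List InstSym) (v₁ u₁ v₂ u₂ v₃ u₃ w : List InstSym) :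
    Cell R Λ → List InstSym
  | .reg r => if r = x then v₁ else if r = y then v₂ else if r = z then v₃ else c (.reg r)
  | .aux₁ => u₁
  | .aux₂ => u₂
  | .aux₃ => u₃
  | .carry => w
  | k => c k

variable {x y z : R} (c : Cell R Λ → List InstSym)
  (v₁ u₁ v₂ u₂ v₃ u₃ w l : List InstSym)

theorem sumCfg_x : sumCfg x y z c v₁ u₁ v₂ u₂ v₃ u₃ w (.reg x) = v₁ := by simp [sumCfg]

theorem sumCfg_y (hxy : x ≠ y) : sumCfg x y z c v₁ u₁ v₂ u₂ v₃ u₃ w (.reg y) = v₂ := by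
  simp [sumCfg, hxy.symm]

theorem sumCfg_z (hxz : x ≠ z) (hyz : y ≠ z) : sumCfg x y z c v₁ u₁ v₂ u₂ v₃ u₃ w (.reg z) = v₃ := by
  simp [sumCfg, hxz.symm, hyz.symm]

theorem sumCfg_self (h1 : c .aux₁ = []) (h2 : c .aux₂ = []) (h3 : c .aux₃ = [])
    (h4 : c .carry = []) :
    sumCfg x y z c (c (.reg x)) [] (c (.reg y)) [] (c (.reg z)) [] [] = c := by
  funext k
  cases k <;> simp [sumCfg, *]
  split_ifs <;> simp_all

variable [DecidableEq Λ]

theorem update_sumCfg_x : update (sumCfg x y z c v₁ u₁ v₂ u₂ v₃ u₃ w) (.reg x) l =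
    sumCfg x y z c l u₁ v₂ u₂ v₃ u₃ w := by
  funext k
  cases k <;> simp [update_apply, sumCfg]
  split_ifs <;> rfl

theorem update_sumCfg_y (hxy : x ≠ y) : update (sumCfg x y z c v₁ u₁ v₂ u₂ v₃ u₃ w) (.reg y) l =
    sumCfg x y z c v₁ u₁ l u₂ v₃ u₃ w := by
  funext k
  cases k <;> simp [update_apply, sumCfg]
  split_ifs <;> simp_all

theorem update_sumCfg_z (hxz : x ≠ z) (hyz : y ≠ z) : update (sumCfg x y z c v₁ u₁ v₂ u₂ v₃ u₃ w) (.reg z) l =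
    sumCfg x y z c v₁ u₁ v₂ u₂ l u₃ w := by
  funext k
  cases k <;> simp [update_apply, sumCfg]
  split_ifs <;> simp_all

theorem update_sumCfg_aux₁ : update (sumCfg x y z c v₁ u₁ v₂ u₂ v₃ u₃ w) .aux₁ l =
    sumCfg x y z c v₁ l v₂ u₂ v₃ u₃ w := by
  funext k
  cases k <;> simp [sumCfg]

theorem update_sumCfg_aux₂ : update (sumCfg x y z c v₁ u₁ v₂ u₂ v₃ u₃ w) .aux₂ l =
    sumCfg x y z c v₁ u₁ v₂ l v₃ u₃ w := by
  funext k
  cases k <;> simp [sumCfg]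

theorem update_sumCfg_aux₃ : update (sumCfg x y z c v₁ u₁ v₂ u₂ v₃ u₃ w) .aux₃ l =
    sumCfg x y z c v₁ u₁ v₂ u₂ v₃ l w := by
  funext k
  cases k <;> simp [sumCfg]

theorem update_sumCfg_carry : update (sumCfg x y z c v₁ u₁ v₂ u₂ v₃ u₃ w) .carry l =
    sumCfg x y z c v₁ u₁ v₂ u₂ v₃ u₃ l := by
  funext k
  cases k <;> simp [sumCfg]

/-- The word for a carry. -/
def carryWord (p : Bool) : List InstSym := if p then [.one] else []

variable {c}

/-- Only one implication between the equations is carried through the loop: if the remaining digits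
add up with the new carry, then the digits before the step did with the old one. At the end no
digits and no carry are left, so the equation holds trivially and can be traced back. -/
theorem must_sumDigit (hxy : x ≠ y) (hxz : x ≠ z) (hyz : y ≠ z) (t : Bool × Bool × Bool) {p : Bool}
    {Q : (Cell R Λ → List InstSym) → Prop}
    (h : ∀ e₁ w₁ e₂ w₂ e₃ w₃ q, v₁ = e₁ ++ w₁ → v₂ = e₂ ++ w₂ → v₃ = e₃ ++ w₃ →
      IsBits e₁ → IsBits e₂ → IsBits e₃ →
      (wordVal w₁ + wordVal w₂ + Bool.toNat q = wordVal w₃ →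
        wordVal v₁ + wordVal v₂ + p.toNat = wordVal v₃) →
      Q (sumCfg x y z c w₁ (e₁.reverse ++ u₁) w₂ (e₂.reverse ++ u₂) w₃ (e₃.reverse ++ u₃)
        (carryWord q))) :
    Must Step (sumDigit x y z t) (sumCfg x y z c v₁ u₁ v₂ u₂ v₃ u₃ (carryWord p)) Q := by
  obtain ⟨a, b, p'⟩ := t
  refine must_mul.2 (must_moveDigit (by simp) fun e₁ w₁ h1 hb1 hv1 => ?_)
  rw [sumCfg_x] at h1 hv1
  rw [update_sumCfg_x, update_sumCfg_aux₁]
  refine must_mul.2 (must_moveDigit (by simp) fun e₂ w₂ h2 hb2 hv2 => ?_)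
  rw [sumCfg_y _ _ _ _ _ _ _ _ hxy] at h2 hv2
  rw [update_sumCfg_y _ _ _ _ _ _ _ _ _ hxy, update_sumCfg_aux₂]
  refine must_mul.2 (must_moveDigit (by simp) fun e₃ w₃ h3 hb3 hv3 => ?_)
  rw [sumCfg_z _ _ _ _ _ _ _ _ hxz hyz] at h3 hv3
  rw [update_sumCfg_z _ _ _ _ _ _ _ _ _ hxz hyz, update_sumCfg_aux₃]
  have key : p = p' → Q (sumCfg x y z c w₁ (e₁.reverse ++ u₁) w₂ (e₂.reverse ++ u₂) w₃
      (e₃.reverse ++ u₃) (carryWord (Bool.atLeastTwo a b p'))) := by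
    rintro rfl
    refine h _ _ _ _ _ _ _ h1 h2 h3 hb1 hb2 hb3 fun h => ?_
    rw [hv1, hv2, hv3]
    revert h
    cases a <;> cases b <;> cases p <;> simp <;> omega
  have hx : ∀ w, sumCfg x y z c w₁ (e₁.reverse ++ u₁) w₂ (e₂.reverse ++ u₂) w₃
      (e₃.reverse ++ u₃) w .carry = w := fun _ => rfl
  have hx₁ : ∀ w, sumCfg x y z c v₁ u₁ v₂ u₂ v₃ u₃ w .aux₁ = u₁ := fun _ => rfl
  have hx₂ : ∀ w l l', sumCfg x y z c l l' v₂ u₂ v₃ u₃ w .aux₂ = u₂ := fun _ _ _ => rfl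
  have hx₃ : ∀ w l l' j j', sumCfg x y z c l l' j j' v₃ u₃ w .aux₃ = u₃ := fun _ _ _ _ _ => rfl
  rw [hx₁, hx₂, hx₃]
  refine must_mul.2 ?_
  cases p' with
  | true =>
    refine must_pop.2 fun l hl => ?_
    obtain ⟨rfl, rfl⟩ : p = true ∧ l = [] := by
      change carryWord p = _ at hl
      cases p <;> simp_all [carryWord]
    rw [update_sumCfg_carry]
    split_ifs with hq
    · refine must_push.2 ?_
      rw [update_sumCfg_carry]
      simpa [hq, carryWord, hx] using key rfl
    · refine must_one.2 ?_
      simpa [hq, carryWord] using key rfl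
  | false =>
    refine must_empty.2 fun hl => ?_
    obtain rfl : p = false := by
      change carryWord p = _ at hl
      cases p <;> simp_all [carryWord]
    split_ifs with hq
    · refine must_push.2 ?_
      rw [update_sumCfg_carry]
      simpa [hq, carryWord, hx] using key rfl
    · refine must_one.2 ?_
      simpa [hq, carryWord] using key rfl

theorem can_sumDigit (hxy : x ≠ y) (hxz : x ≠ z) (hyz : y ≠ z) {p : Bool} {Q : ℕ → (Cell R Λ → List InstSym) → Prop}
    (hb1 : IsBits v₁) (hb2 : IsBits v₂) (hb3 : IsBits v₃)
    (hv : lowDigit v₃ = (lowDigit v₁ ^^ lowDigit v₂ ^^ p))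
    (h : ∀ m ≤ 8, Q m (sumCfg x y z c v₁.tail (v₁.take 1 ++ u₁) v₂.tail (v₂.take 1 ++ u₂)
      v₃.tail (v₃.take 1 ++ u₃) (carryWord (Bool.atLeastTwo (lowDigit v₁) (lowDigit v₂) p)))) :
    Can Step (sumDigit x y z (lowDigit v₁, lowDigit v₂, p))
      (sumCfg x y z c v₁ u₁ v₂ u₂ v₃ u₃ (carryWord p)) Q := by
  rw [sumDigit]
  dsimp only
  rw [← hv, can_mul]
  refine can_moveDigit (by simp) (sumCfg_x _ _ _ _ _ _ _ _) hb1 fun m₁ hm₁ => ?_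
  simp only [update_sumCfg_x, update_sumCfg_aux₁]
  rw [can_mul]
  refine can_moveDigit (by simp) (sumCfg_y _ _ _ _ _ _ _ _ hxy) hb2 fun m₂ hm₂ => ?_
  simp only [update_sumCfg_y _ _ _ _ _ _ _ _ _ hxy, update_sumCfg_aux₂]
  rw [can_mul]
  refine can_moveDigit (by simp) (sumCfg_z _ _ _ _ _ _ _ _ hxz hyz) hb3 fun m₃ hm₃ => ?_
  simp only [update_sumCfg_z _ _ _ _ _ _ _ _ _ hxz hyz, update_sumCfg_aux₃]
  refine can_mul.2 ?_
  have key : ∀ m ≤ 2, Q (m₁ + (m₂ + (m₃ + m))) (sumCfg x y z c v₁.tail (v₁.take 1 ++ u₁) v₂.tail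
      (v₂.take 1 ++ u₂) v₃.tail (v₃.take 1 ++ u₃)
      (carryWord (Bool.atLeastTwo (lowDigit v₁) (lowDigit v₂) p))) :=
    fun m hm => h _ (by omega)
  have hx : ∀ w, sumCfg x y z c v₁.tail (v₁.take 1 ++ u₁) v₂.tail
      (v₂.take 1 ++ u₂) v₃.tail (v₃.take 1 ++ u₃) w .carry = w := fun _ => rfl
  have hcarry : Can Step (if p then char (pop .carry .one) else char (empty .carry))
      (sumCfg x y z c v₁.tail (v₁.take 1 ++ u₁) v₂.tail
      (v₂.take 1 ++ u₂) v₃.tail (v₃.take 1 ++ u₃) (carryWord p)) fun m c' => m = 1 ∧ c' =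
      sumCfg x y z c v₁.tail (v₁.take 1 ++ u₁) v₂.tail
      (v₂.take 1 ++ u₂) v₃.tail (v₃.take 1 ++ u₃) [] := by
    cases p with
    | true => exact can_pop.2 ⟨[], rfl, rfl, by rw [update_sumCfg_carry]⟩
    | false => exact can_empty.2 ⟨rfl, rfl, rfl⟩
  refine hcarry.mono ?_
  rintro _ _ ⟨rfl, rfl⟩
  split_ifs with hq
  · refine can_push.2 ?_
    rw [update_sumCfg_carry]
    simpa [hq, carryWord, hx] using key 2 le_rfl
  · refine can_one.2 ?_
    simpa [hq, carryWord] using key 1 (by norm_num)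

end Sum

end StackProgram

/-! ### Correctness and cost of the addition test -/

namespace StackProgram

open RegularExpression StackAct Function

section SumTest

variable {R Λ : Type} [DecidableEq R] [DecidableEq Λ] {x y z : R}
  {c : Cell R Λ → List InstSym}

theorem sumCfg_restore (h1 : c .aux₁ = []) (h2 : c .aux₂ = []) (h3 : c .aux₃ = [])
    (h4 : c .carry = []) {u₁ u₂ u₃ v₁ v₂ v₃ : List InstSym} (hv₁ : c (.reg x) = v₁)
    (hv₂ : c (.reg y) = v₂) (hv₃ : c (.reg z) = v₃) (hu₁ : u₁ = v₁.reverse)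
    (hu₂ : u₂ = v₂.reverse) (hu₃ : u₃ = v₃.reverse) :
    sumCfg x y z c (u₁.reverse ++ []) [] (u₂.reverse ++ []) [] (u₃.reverse ++ []) [] [] = c := by
  subst hu₁ hu₂ hu₃ hv₁ hv₂ hv₃
  simpa using sumCfg_self (x := x) (y := y) (z := z) c h1 h2 h3 h4

theorem must_sumTest (hxy : x ≠ y) (hxz : x ≠ z) (hyz : y ≠ z) (h1 : c .aux₁ = [])
    (h2 : c .aux₂ = []) (h3 : c .aux₃ = []) (h4 : c .carry = [])
    {Q : (Cell R Λ → List InstSym) → Prop}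
    (h : wordVal (c (.reg x)) + wordVal (c (.reg y)) = wordVal (c (.reg z)) → Q c) :
    Must Step (sumTest x y z) c Q := by
  refine must_mul.2 (Must.mono (must_star (I := fun c' => ∃ u₁ v₁ u₂ v₂ u₃ v₃ p,
    c (.reg x) = u₁ ++ v₁ ∧ c (.reg y) = u₂ ++ v₂ ∧ c (.reg z) = u₃ ++ v₃ ∧
    (wordVal v₁ + wordVal v₂ + Bool.toNat p = wordVal v₃ →
      wordVal (c (.reg x)) + wordVal (c (.reg y)) = wordVal (c (.reg z))) ∧
    c' = sumCfg x y z c v₁ u₁.reverse v₂ u₂.reverse v₃ u₃.reverse (carryWord p)) ?_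
    ⟨[], _, [], _, [], _, false, rfl, rfl, rfl, by simp, ?_⟩) ?_)
  · rintro _ ⟨u₁, v₁, u₂, v₂, u₃, v₃, p, hx, hy, hz, hp, rfl⟩
    rw [must_oneOf]
    rintro t -
    refine must_sumDigit _ _ _ _ _ _ hxy hxz hyz t ?_
    rintro e₁ w₁ e₂ w₂ e₃ w₃ q rfl rfl rfl - - - hq
    exact ⟨u₁ ++ e₁, w₁, u₂ ++ e₂, w₂, u₃ ++ e₃, w₃, q, by simpa using hx, by simpa using hy,
      by simpa using hz, fun h => hp (hq h), by simp⟩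
  · exact (sumCfg_self c h1 h2 h3 h4).symm
  · rintro _ ⟨u₁, v₁, u₂, v₂, u₃, v₃, p, hx, hy, hz, hp, rfl⟩
    refine must_mul.2 (must_empty.2 fun hv₁ => must_mul.2 (must_empty.2 fun hv₂ =>
      must_mul.2 (must_empty.2 fun hv₃ => must_mul.2 (must_empty.2 fun hv₄ => ?_))))
    rw [sumCfg_x] at hv₁
    rw [sumCfg_y _ _ _ _ _ _ _ _ hxy] at hv₂
    rw [sumCfg_z _ _ _ _ _ _ _ _ hxz hyz] at hv₃
    have hp0 : carryWord p = [] := hv₄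
    have hpf : p = false := by cases p <;> simp_all [carryWord]
    subst hv₁ hv₂ hv₃ hpf
    rw [List.append_nil] at hx hy hz
    refine must_mul.2 (must_moveAll (by simp) fun _ => ?_)
    rw [sumCfg_x, update_sumCfg_aux₁, update_sumCfg_x]
    refine must_mul.2 (must_moveAll (by simp) fun _ => ?_)
    rw [sumCfg_y _ _ _ _ _ _ _ _ hxy, update_sumCfg_aux₂, update_sumCfg_y _ _ _ _ _ _ _ _ _ hxy]
    refine must_moveAll (by simp) fun _ => ?_
    rw [sumCfg_z _ _ _ _ _ _ _ _ hxz hyz, update_sumCfg_aux₃,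
      update_sumCfg_z _ _ _ _ _ _ _ _ _ hxz hyz]
    have := sumCfg_restore h1 h2 h3 h4 hx hy hz rfl rfl rfl
    exact this.symm ▸ h (hp rfl)

/-- As long as digits remain, every round uses up at least one of them and takes at most eight
actions. The equation modulo two fixes the lowest digit of the sum, and dividing by two gives the
equation for the tails with the new carry. -/
theorem can_sumDigits (hxy : x ≠ y) (hxz : x ≠ z) (hyz : y ≠ z) (n : ℕ)
    {v₁ v₂ v₃ : List InstSym} (hn : v₁.length + v₂.length + v₃.length ≤ n)
    (hb1 : IsBits v₁) (hb2 : IsBits v₂) (hb3 : IsBits v₃) (u₁ u₂ u₃ : List InstSym) (p : Bool)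
    (hv : wordVal v₁ + wordVal v₂ + p.toNat = wordVal v₃) :
    Can Step (star (oneOf (sumDigit x y z) Finset.univ.toList))
      (sumCfg x y z c v₁ u₁ v₂ u₂ v₃ u₃ (carryWord p))
      fun m c' => m ≤ 8 * n ∧ c' = sumCfg x y z c [] (v₁.reverse ++ u₁) [] (v₂.reverse ++ u₂) []
        (v₃.reverse ++ u₃) [] := by
  induction n generalizing v₁ v₂ v₃ u₁ u₂ u₃ p with
  | zero =>
    obtain rfl : v₁ = [] := List.length_eq_zero_iff.1 (by omega)
    obtain rfl : v₂ = [] := List.length_eq_zero_iff.1 (by omega)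
    obtain rfl : v₃ = [] := List.length_eq_zero_iff.1 (by omega)
    obtain rfl : p = false := by cases p <;> simp_all [wordVal]
    exact can_star_zero ⟨by simp, rfl⟩
  | succ n ih =>
    by_cases h0 : v₁.length + v₂.length + v₃.length = 0
    · exact (ih (by omega) hb1 hb2 hb3 u₁ u₂ u₃ p hv).mono fun m c' h => ⟨by omega, h.2⟩
    have e1 := wordVal_eq v₁
    have e2 := wordVal_eq v₂
    have e3 := wordVal_eq v₃
    have hlow : lowDigit v₃ = (lowDigit v₁ ^^ lowDigit v₂ ^^ p) := by
      rw [e1, e2, e3] at hv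
      revert hv
      cases lowDigit v₁ <;> cases lowDigit v₂ <;> cases lowDigit v₃ <;> cases p <;> simp <;> omega
    refine can_star_succ (can_oneOf (a := (lowDigit v₁, lowDigit v₂, p)) (by simp) ?_)
    refine can_sumDigit _ _ _ _ _ _ hxy hxz hyz hb1 hb2 hb3 hlow fun m hm => ?_
    refine (ih ?_ (fun a ha => hb1 a (List.mem_of_mem_tail ha))
      (fun a ha => hb2 a (List.mem_of_mem_tail ha)) (fun a ha => hb3 a (List.mem_of_mem_tail ha))
      _ _ _ _ ?_).mono ?_
    · simp only [List.length_tail]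
      omega
    · rw [e1, e2, e3, hlow] at hv
      revert hv
      cases lowDigit v₁ <;> cases lowDigit v₂ <;> cases p <;> simp <;> omega
    · rintro k c' ⟨hk, rfl⟩
      have ht : ∀ v u : List InstSym, v.tail.reverse ++ (v.take 1 ++ u) = v.reverse ++ u := by
        intro v u
        cases v <;> simp
      rw [ht, ht, ht]
      exact ⟨by omega, rfl⟩

/-- Per digit, eight actions for adding and two for moving it back; the remaining seven are the
tests for emptiness. -/
theorem can_sumTest (hxy : x ≠ y) (hxz : x ≠ z) (hyz : y ≠ z) (h1 : c .aux₁ = [])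
    (h2 : c .aux₂ = []) (h3 : c .aux₃ = []) (h4 : c .carry = []) (hb1 : IsBits (c (.reg x)))
    (hb2 : IsBits (c (.reg y))) (hb3 : IsBits (c (.reg z)))
    (hv : wordVal (c (.reg x)) + wordVal (c (.reg y)) = wordVal (c (.reg z)))
    {Q : ℕ → (Cell R Λ → List InstSym) → Prop}
    (h : ∀ m ≤ 10 * ((c (.reg x)).length + (c (.reg y)).length + (c (.reg z)).length) + 7, Q m c) :
    Can Step (sumTest x y z) c Q := by
  have hd := can_sumDigits (c := c) hxy hxz hyz _ le_rfl hb1 hb2 hb3 [] [] [] false (by simpa using hv)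
  rw [show carryWord false = [] from rfl, sumCfg_self c h1 h2 h3 h4] at hd
  refine can_mul.2 (hd.mono ?_)
  rintro m _ ⟨hm, rfl⟩
  simp only [List.append_nil]
  refine can_mul.2 (can_empty.2 ⟨sumCfg_x _ _ _ _ _ _ _ _, can_mul.2 (can_empty.2
    ⟨sumCfg_y _ _ _ _ _ _ _ _ hxy, can_mul.2 (can_empty.2 ⟨sumCfg_z _ _ _ _ _ _ _ _ hxz hyz,
    can_mul.2 (can_empty.2 ⟨rfl, ?_⟩)⟩)⟩)⟩)
  have hrev : ∀ {l : List InstSym}, IsBits l → ∀ a ∈ l.reverse, a ∈ [InstSym.zero, .one] :=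
    fun hl a ha => hl a (List.mem_reverse.1 ha)
  refine can_mul.2 (can_moveAll (by simp) (hrev hb1) ?_)
  rw [sumCfg_x, update_sumCfg_aux₁, update_sumCfg_x]
  refine can_mul.2 (can_moveAll (by simp) (hrev hb2) ?_)
  rw [sumCfg_y _ _ _ _ _ _ _ _ hxy, update_sumCfg_aux₂, update_sumCfg_y _ _ _ _ _ _ _ _ _ hxy]
  refine can_moveAll (by simp) (hrev hb3) ?_
  rw [sumCfg_z _ _ _ _ _ _ _ _ hxz hyz, update_sumCfg_aux₃,
    update_sumCfg_z _ _ _ _ _ _ _ _ _ hxz hyz]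
  have hres := sumCfg_restore h1 h2 h3 h4 (x := x) (y := y) (z := z) rfl rfl rfl rfl rfl rfl
  refine Eq.mpr (congrArg (Q _) hres) (h _ ?_)
  simp only [sumCfg, List.length_reverse]
  omega

end SumTest

end StackProgram

/-! ### Programs on numbers -/

/-- A state of a program on numbers, with the number registers `R` and the stacks of numbers `Λ`:
the contents of the registers and stacks, and the rest of the input. -/
structure NumState (R Λ : Type) where
  reg : R → ℕ
  lst : Λ → List ℕ
  inp : List InstSym

/-- The instructions of a program on numbers. -/
inductive NumInstr (R Λ : Type)
  | guess (r : R)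
  | isZero (r : R)
  | isPos (r : R)
  | isSum (x y z : R)
  | popBit (r : R) (b : Bool)
  | double (r : R)
  | push (l : Λ) (r : R)
  | pop (l : Λ) (r : R)
  | isNil (l : Λ)
  | readNat (r : R)
  | readSym (a : InstSym)
  | isEnd

namespace NumState

variable {R Λ : Type} [DecidableEq R] [DecidableEq Λ]

/-- Change the contents of a register. -/
def setReg (s : NumState R Λ) (r : R) (m : ℕ) : NumState R Λ :=
  { s with reg := Function.update s.reg r m }

/-- Change the contents of a stack. -/
def setLst (s : NumState R Λ) (l : Λ) (m : List ℕ) : NumState R Λ :=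
  { s with lst := Function.update s.lst l m }

/-- Change the rest of the input. -/
def setInp (s : NumState R Λ) (i : List InstSym) : NumState R Λ := { s with inp := i }

/-- All registers contain numbers with at most `B` digits. -/
def Bdd (B : ℕ) (s : NumState R Λ) : Prop := ∀ r, s.reg r < 2 ^ B

end NumState

open NumState in
/-- The effect of an instruction. -/
def NumInstr.Step {R Λ : Type} [DecidableEq R] [DecidableEq Λ] :
    NumInstr R Λ → NumState R Λ → NumState R Λ → Prop
  | guess r, s, s' => ∃ m, s' = s.setReg r m
  | isZero r, s, s' => s.reg r = 0 ∧ s' = s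
  | isPos r, s, s' => 0 < s.reg r ∧ s' = s
  | isSum x y z, s, s' => (x ≠ y ∧ x ≠ z ∧ y ≠ z) ∧ s.reg x + s.reg y = s.reg z ∧ s' = s
  | popBit r b, s, s' => ∃ m, s.reg r = 2 * m + b.toNat ∧ (m ≠ 0 ∨ b = true) ∧ s' = s.setReg r m
  | double r, s, s' => s' = s.setReg r (2 * s.reg r)
  | push l r, s, s' => s' = (s.setLst l (s.reg r :: s.lst l)).setReg r 0
  | pop l r, s, s' => s.reg r = 0 ∧ ∃ m t, s.lst l = m :: t ∧ s' = (s.setLst l t).setReg r m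
  | isNil l, s, s' => s.lst l = [] ∧ s' = s
  | readNat r, s, s' => ∃ i, s.inp = encodeNatSym (s.reg r) ++ i ∧ s' = s.setInp i
  | readSym a, s, s' => ∃ i, s.inp = a :: i ∧ s' = s.setInp i
  | isEnd, s, s' => s.inp = [] ∧ s' = s

/-- The effect of an instruction, provided that all numbers stay bounded. -/
def NumInstr.BddStep {R Λ : Type} [DecidableEq R] [DecidableEq Λ] (B : ℕ) (i : NumInstr R Λ)
    (s s' : NumState R Λ) : Prop := i.Step s s' ∧ s'.Bdd B

/-! ### Instructions on numbers as stack programs -/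

namespace StackProgram

open RegularExpression StackAct Function

variable {R Λ : Type} [DecidableEq R] [DecidableEq Λ]

/-- The word for a list of numbers. -/
def listWord (l : List ℕ) : List InstSym :=
  l.flatMap fun m => (encodeNatSym m).reverse ++ [.comma]

/-- The contents of the stacks that describe a state of a program on numbers. -/
def stackCfg (s : NumState R Λ) : Cell R Λ → List InstSym
  | .reg r => encodeNatSym (s.reg r)
  | .lst l => listWord (s.lst l)
  | .inp => s.inp
  | _ => []

theorem update_stackCfg_reg (s : NumState R Λ) (r : R) (m : ℕ) :
    update (stackCfg s) (.reg r) (encodeNatSym m) = stackCfg (s.setReg r m) := by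
  funext k
  cases k <;> simp [stackCfg, NumState.setReg, update_apply]
  split_ifs <;> rfl

theorem update_stackCfg_lst (s : NumState R Λ) (l : Λ) (m : List ℕ) :
    update (stackCfg s) (.lst l) (listWord m) = stackCfg (s.setLst l m) := by
  funext k
  cases k <;> simp [stackCfg, NumState.setLst, update_apply]
  split_ifs <;> rfl

theorem update_stackCfg_inp (s : NumState R Λ) (i : List InstSym) :
    update (stackCfg s) .inp i = stackCfg (s.setInp i) := by
  funext k
  cases k <;> simp [stackCfg, NumState.setInp]

/-- The stack program for an instruction. -/
noncomputable def instrProgram : NumInstr R Λ → RegularExpression (StackAct (Cell R Λ))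
  | .guess r => guessNat (.reg r)
  | .isZero r => char (empty (.reg r))
  | .isPos r => oneOf (fun a => char (pop (.reg r) a) * char (push (.reg r) a)) [.zero, .one]
  | .isSum x y z => if x ≠ y ∧ x ≠ z ∧ y ≠ z then sumTest x y z else 0
  | .popBit r b => char (pop (.reg r) (bitSym b))
  | .double r => char (empty (.reg r)) + oneOf (fun a => char (pop (.reg r) a) *
      (char (push (.reg r) a) * char (push (.reg r) .zero))) [.zero, .one]
  | .push l r => char (push (.lst l) .comma) * moveAll [.zero, .one] (.reg r) (.lst l)
  | .pop l r => char (empty (.reg r)) * (move [.zero, .one] (.lst l) (.reg r) *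
      char (pop (.lst l) .comma))
  | .isNil l => char (empty (.lst l))
  | .readNat r => matchPrefix (.reg r) .inp .aux₁
  | .readSym a => char (pop .inp a)
  | .isEnd => char (empty .inp)

theorem listWord_eq_nil {l : List ℕ} : listWord l = [] ↔ l = [] := by
  cases l <;> simp [listWord]

/-- The first comma shows where a number on a stack ends, so that popping a number is deterministic.
-/
theorem isBits_append_comma_inj {u u' v v' : List InstSym} (hu : IsBits u) (hu' : IsBits u')
    (h : u ++ .comma :: v = u' ++ .comma :: v') : u = u' ∧ v = v' := by
  induction u generalizing u' with
  | nil =>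
    cases u' with
    | nil => exact ⟨rfl, by simpa using h⟩
    | cons a u' =>
      have := hu' a (by simp)
      simp only [List.nil_append, List.cons_append, List.cons.injEq] at h
      rw [← h.1] at this
      simp at this
  | cons a u ih =>
    cases u' with
    | nil =>
      have := hu a (by simp)
      simp only [List.nil_append, List.cons_append, List.cons.injEq] at h
      rw [h.1] at this
      simp at this
    | cons b u' =>
      simp only [List.cons_append, List.cons.injEq] at h
      obtain ⟨h1, h2⟩ := ih (fun a ha => hu a (by simp [ha])) (fun a ha => hu' a (by simp [ha])) h.2
      exact ⟨by rw [h.1, h1], h2⟩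

theorem isBits_reverse {l : List InstSym} (hl : IsBits l) : IsBits l.reverse :=
  fun a ha => hl a (List.mem_reverse.1 ha)

theorem must_instrProgram (i : NumInstr R Λ) (s : NumState R Λ) :
    Must Step (instrProgram i) (stackCfg s) fun c => ∃ s', i.Step s s' ∧ c = stackCfg s' := by
  cases i with
  | guess r =>
    refine must_guessNat fun m => ⟨_, ⟨m, rfl⟩, ?_⟩
    rw [update_stackCfg_reg]
  | isZero r => exact must_empty.2 fun h => ⟨s, ⟨encodeNatSym_eq_nil.1 h, rfl⟩, rfl⟩
  | isPos r =>
    refine must_oneOf.2 fun a _ => must_mul.2 (must_pop.2 fun l hl => must_push.2 ⟨s, ⟨?_, rfl⟩, ?_⟩)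
    · rw [Nat.pos_iff_ne_zero, Ne, ← encodeNatSym_eq_nil]
      change encodeNatSym (s.reg r) = _ at hl
      simp [hl]
    · rw [update_self, update_idem, ← hl, update_eq_self]
  | isSum x y z =>
    rw [instrProgram]
    split_ifs with h
    · refine must_sumTest h.1 h.2.1 h.2.2 rfl rfl rfl rfl fun hs => ⟨s, ⟨h, ?_, rfl⟩, rfl⟩
      simpa [stackCfg, wordVal_encodeNatSym] using hs
    · exact must_zero.2 trivial
  | popBit r b =>
    refine must_pop.2 fun l hl => ?_
    obtain ⟨m, b', h1, h2, h3, rfl⟩ := encodeNatSym_eq_cons.1 hl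
    obtain rfl : b = b' := by cases b <;> cases b' <;> simp_all [bitSym]
    exact ⟨_, ⟨m, h1, h2, rfl⟩, update_stackCfg_reg _ _ _⟩
  | double r =>
    refine must_add.2 ⟨must_empty.2 fun h => ⟨_, rfl, ?_⟩, must_oneOf.2 fun a _ =>
      must_mul.2 (must_pop.2 fun l hl => must_mul.2 (must_push.2 (must_push.2 ⟨_, rfl, ?_⟩)))⟩
    · have h0 : s.reg r = 0 := encodeNatSym_eq_nil.1 h
      rw [← update_stackCfg_reg, h0, mul_zero, ← h0]
      exact (update_eq_self _ _).symm
    · rw [update_self, update_idem, update_idem, update_self, ← hl, ← update_stackCfg_reg]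
      congr 1
      have := encodeNatSym_bit (s.reg r) false (Or.inl ?_)
      · exact this.symm
      · rw [Ne, ← encodeNatSym_eq_nil]
        change encodeNatSym (s.reg r) = _ at hl
        simp [hl]
  | push l r =>
    refine must_mul.2 (must_push.2 (must_moveAll (by simp) fun _ => ⟨_, rfl, ?_⟩))
    rw [← update_stackCfg_reg, ← update_stackCfg_lst, encodeNatSym_zero]
    funext k
    simp only [update_apply]
    split_ifs <;> simp_all [stackCfg, listWord]
  | pop l r =>
    -- The move may stop too early, but then a digit is on top and the comma cannot be popped. The
    -- register has to be empty beforehand, since the digits are put on top of its contents.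
    refine must_mul.2 (must_empty.2 fun h0 => must_mul.2 (must_move (by simp) fun u v huv hu =>
      must_pop.2 fun v' hv' => ?_))
    have h0' : s.reg r = 0 := encodeNatSym_eq_nil.1 h0
    rw [update_of_ne (by simp), update_self] at hv'
    subst hv'
    change listWord (s.lst l) = _ at huv
    cases hl : s.lst l with
    | nil => simp [hl, listWord] at huv
    | cons m t =>
      rw [hl, listWord, List.flatMap_cons, ← listWord, List.append_assoc, List.singleton_append] at huv
      obtain ⟨h1, h2⟩ := isBits_append_comma_inj (isBits_reverse (isBits_encodeNatSym m)) hu huv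
      refine ⟨_, ⟨h0', m, t, hl, rfl⟩, ?_⟩
      rw [← update_stackCfg_reg, ← update_stackCfg_lst]
      funext k
      simp only [update_apply, h0]
      subst h1 h2
      split_ifs <;> simp_all
  | isNil l => exact must_empty.2 fun h => ⟨s, ⟨listWord_eq_nil.1 h, rfl⟩, rfl⟩
  | readNat r =>
    refine must_matchPrefix (by simp) (by simp) (by simp) rfl fun v hv => ?_
    exact ⟨_, ⟨v, hv, rfl⟩, update_stackCfg_inp _ _⟩
  | readSym a => exact must_pop.2 fun v hv => ⟨_, ⟨v, hv, rfl⟩, update_stackCfg_inp _ _⟩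
  | isEnd => exact must_empty.2 fun h => ⟨s, ⟨h, rfl⟩, rfl⟩

/-- The dearest instruction is `isSum` with `30 * B + 7` actions. The bound on `s'` is needed for
numbers that are guessed or popped. -/
theorem can_instrProgram {i : NumInstr R Λ} {s s' : NumState R Λ} {B : ℕ} (hB : s.Bdd B)
    (hB' : s'.Bdd B) (h : i.Step s s') :
    Can Step (instrProgram i) (stackCfg s) fun m c => m ≤ 37 * (B + 1) ∧ c = stackCfg s' := by
  have hlen : ∀ r, (stackCfg s (.reg r)).length ≤ B := fun r => length_encodeNatSym_le (hB r)
  cases i with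
  | guess r =>
    obtain ⟨m, rfl⟩ := h
    refine can_guessNat (isBits_encodeNatSym _) m fun n hn => ⟨?_, update_stackCfg_reg _ _ _⟩
    have h1 := hlen r
    have h2 : (encodeNatSym m).length ≤ B := by
      have := hB' r
      simp only [NumState.setReg, update_self] at this
      exact length_encodeNatSym_le this
    omega
  | isZero r =>
    obtain ⟨h, rfl⟩ := h
    exact can_empty.2 ⟨encodeNatSym_eq_nil.2 h, by omega, rfl⟩
  | isPos r =>
    obtain ⟨h, rfl⟩ := h
    cases hc : encodeNatSym (s'.reg r) with
    | nil => exact absurd (encodeNatSym_eq_nil.1 hc) h.ne'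
    | cons a l =>
      refine can_oneOf (isBits_encodeNatSym (s'.reg r) a (by simp [hc])) (can_mul.2 (can_pop.2
        ⟨l, hc, can_push.2 ⟨by omega, ?_⟩⟩))
      rw [update_self, update_idem, ← hc]
      exact update_eq_self (Cell.reg r) (stackCfg s')
  | isSum x y z =>
    obtain ⟨h, hs, rfl⟩ := h
    rw [instrProgram, if_pos h]
    refine can_sumTest h.1 h.2.1 h.2.2 rfl rfl rfl rfl (isBits_encodeNatSym _)
      (isBits_encodeNatSym _) (isBits_encodeNatSym _) ?_ fun m hm => ⟨?_, rfl⟩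
    · simpa [stackCfg, wordVal_encodeNatSym] using hs
    · have h1 := hlen x
      have h2 := hlen y
      have h3 := hlen z
      omega
  | popBit r b =>
    obtain ⟨m, h1, h2, rfl⟩ := h
    refine can_pop.2 ⟨encodeNatSym m, ?_, by omega, update_stackCfg_reg _ _ _⟩
    exact encodeNatSym_eq_cons.2 ⟨m, b, h1, h2, rfl, rfl⟩
  | double r =>
    obtain rfl := h
    refine can_add.2 ?_
    cases hc : encodeNatSym (s.reg r) with
    | nil =>
      have h0 : s.reg r = 0 := encodeNatSym_eq_nil.1 hc
      refine Or.inl (can_empty.2 ⟨hc, by omega, ?_⟩)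
      rw [← update_stackCfg_reg, h0, mul_zero, ← h0]
      exact (update_eq_self _ _).symm
    | cons a l =>
      refine Or.inr (can_oneOf (isBits_encodeNatSym (s.reg r) a (by simp [hc])) (can_mul.2
        (can_pop.2 ⟨l, hc, can_mul.2 (can_push.2 (can_push.2 ⟨by omega, ?_⟩))⟩)))
      rw [update_self, update_idem, update_idem, update_self, ← hc, ← update_stackCfg_reg]
      congr 1
      have := encodeNatSym_bit (s.reg r) false (Or.inl ?_)
      · exact this.symm
      · rw [Ne, ← encodeNatSym_eq_nil, hc]
        simp
  | push l r =>
    obtain rfl := h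
    refine can_mul.2 (can_push.2 (can_moveAll (by simp) (isBits_encodeNatSym _) ⟨?_, ?_⟩))
    · have := hlen r
      rw [update_of_ne (by simp)]
      omega
    · rw [← update_stackCfg_reg, ← update_stackCfg_lst, encodeNatSym_zero]
      funext k
      simp only [update_apply]
      split_ifs <;> simp_all [stackCfg, listWord]
  | pop l r =>
    obtain ⟨h0, m, t, hl, rfl⟩ := h
    have hc0 : stackCfg s (.reg r) = [] := encodeNatSym_eq_nil.2 h0
    refine can_mul.2 (can_empty.2 ⟨hc0, can_mul.2 (can_move (u := (encodeNatSym m).reverse)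
      (v := .comma :: listWord t) (by simp) ?_ (isBits_reverse (isBits_encodeNatSym m))
      (can_pop.2 ⟨listWord t, ?_, ?_, ?_⟩))⟩)
    · simp [stackCfg, hl, listWord]
    · rw [update_of_ne (by simp), update_self]
    · have h2 : (encodeNatSym m).length ≤ B := by
        have := hB' r
        simp only [NumState.setReg, update_self] at this
        exact length_encodeNatSym_le this
      simp
      omega
    · rw [← update_stackCfg_reg, ← update_stackCfg_lst]
      funext k
      simp only [update_apply, hc0]
      split_ifs <;> simp_all
  | isNil l =>
    obtain ⟨h, rfl⟩ := h
    exact can_empty.2 ⟨listWord_eq_nil.2 h, by omega, rfl⟩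
  | readNat r =>
    obtain ⟨v, hv, rfl⟩ := h
    refine can_matchPrefix (by simp) (by simp) (by simp) rfl (isBits_encodeNatSym _) hv
      ⟨?_, update_stackCfg_inp _ _⟩
    have := hlen r
    omega
  | readSym a =>
    obtain ⟨v, hv, rfl⟩ := h
    exact can_pop.2 ⟨v, hv, by omega, update_stackCfg_inp _ _⟩
  | isEnd =>
    obtain ⟨h, rfl⟩ := h
    exact can_empty.2 ⟨h, by omega, rfl⟩

end StackProgram

/-! ### Translation of whole programs -/

namespace StackProgram

open RegularExpression StackAct Function

variable {R Λ : Type} [DecidableEq R] [DecidableEq Λ]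

/-- The stack program for a program on numbers. -/
noncomputable def compile :
    RegularExpression (NumInstr R Λ) → RegularExpression (StackAct (Cell R Λ))
  | .zero => .zero
  | .epsilon => .epsilon
  | .char i => instrProgram i
  | .plus P Q => .plus (compile P) (compile Q)
  | .comp P Q => .comp (compile P) (compile Q)
  | .star P => .star (compile P)

theorem append_mem_star {A : Type*} {P : RegularExpression A} {u v : List A}
    (hu : u ∈ P.star.matches') (hv : v ∈ P.matches') : u ++ v ∈ P.star.matches' := by
  obtain ⟨L, rfl, hL⟩ := Language.mem_kstar.1 hu
  refine Language.mem_kstar.2 ⟨L ++ [v], by simp, fun z hz => ?_⟩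
  rcases List.mem_append.1 hz with hz | hz
  · exact hL z hz
  · rwa [List.mem_singleton.1 hz]

theorem must_compile {P : RegularExpression (NumInstr R Λ)} {s : NumState R Λ}
    {Q : NumState R Λ → Prop} (h : Must NumInstr.Step P s Q) :
    Must Step (compile P) (stackCfg s) fun c => ∃ s', Q s' ∧ c = stackCfg s' := by
  induction P generalizing s Q with
  | zero => exact must_zero.2 trivial
  | epsilon => exact must_one.2 ⟨s, must_one.1 h, rfl⟩
  | char i =>
    refine (must_instrProgram i s).mono ?_
    rintro _ ⟨s', hs', rfl⟩
    exact ⟨s', must_char.1 h s' hs', rfl⟩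
  | plus P P' ih ih' =>
    obtain ⟨h, h'⟩ := must_add.1 h
    exact must_add.2 ⟨ih h, ih' h'⟩
  | comp P P' ih ih' =>
    refine must_mul.2 ((ih (must_mul.1 h)).mono ?_)
    rintro _ ⟨t, ht, rfl⟩
    exact ih' ht
  | star P ih =>
    -- The invariant is that the stacks describe a state reachable by some run of the starred
    -- program; no further loop invariant has to be known.
    refine Must.mono (must_star (I := fun c => ∃ s', (∃ w ∈ P.star.matches',
      RunPath NumInstr.Step w s s') ∧ c = stackCfg s') ?_
      ⟨s, ⟨[], Language.nil_mem_kstar _, rfl⟩, rfl⟩) ?_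
    · rintro _ ⟨t, ⟨w, hw, ht⟩, rfl⟩
      exact ih fun u hu t' ht' => ⟨w ++ u, append_mem_star hw hu, path_append.2 ⟨t, ht, ht'⟩⟩
    · rintro _ ⟨t, ⟨w, hw, ht⟩, rfl⟩
      exact ⟨t, h w hw t ht, rfl⟩

theorem bdd_of_runPath {B : ℕ} {w : List (NumInstr R Λ)} {s s' : NumState R Λ} (hs : s.Bdd B)
    (h : RunPath (NumInstr.BddStep B) w s s') : s'.Bdd B := by
  induction w generalizing s with
  | nil =>
    obtain rfl : s = s' := h
    exact hs
  | cons i w ih =>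
    obtain ⟨t, h1, h2⟩ := h
    exact ih h1.2 h2

/-- The run is given explicitly, so that every intermediate state is bounded and the cost is a
constant multiple of `B + 1` for each instruction. -/
theorem can_compile {B : ℕ} {P : RegularExpression (NumInstr R Λ)} {w : List (NumInstr R Λ)}
    (hw : w ∈ P.matches') {s s' : NumState R Λ} (hs : s.Bdd B)
    (h : RunPath (NumInstr.BddStep B) w s s') :
    Can Step (compile P) (stackCfg s) fun m c => m ≤ 37 * (B + 1) * w.length ∧ c = stackCfg s' := by
  induction P generalizing w s s' with
  | zero => exact hw.elim
  | epsilon =>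
    obtain rfl : w = [] := hw
    obtain rfl : s = s' := h
    exact can_one.2 ⟨by simp, rfl⟩
  | char i =>
    obtain rfl : w = [i] := hw
    obtain ⟨t, h1, rfl⟩ := h
    rw [List.length_singleton, mul_one]
    exact can_instrProgram hs h1.2 h1.1
  | plus P P' ih ih' =>
    refine can_add.2 ?_
    rcases hw with hw | hw
    exacts [Or.inl (ih hw hs h), Or.inr (ih' hw hs h)]
  | comp P P' ih ih' =>
    obtain ⟨u, hu, v, hv, rfl⟩ := Language.mem_mul.1 hw
    obtain ⟨t, h1, h2⟩ := path_append.1 h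
    refine can_mul.2 ((ih hu hs h1).mono ?_)
    rintro m _ ⟨hm, rfl⟩
    refine (ih' hv (bdd_of_runPath hs h1) h2).mono ?_
    rintro n _ ⟨hn, rfl⟩
    refine ⟨?_, rfl⟩
    rw [List.length_append, mul_add]
    exact add_le_add hm hn
  | star P ih =>
    obtain ⟨L, rfl, hL⟩ := Language.mem_kstar.1 hw
    clear hw
    induction L generalizing s with
    | nil =>
      obtain rfl : s = s' := h
      exact can_star_zero ⟨by simp, rfl⟩
    | cons u L ihL =>
      rw [List.flatten_cons, path_append] at h
      obtain ⟨t, h1, h2⟩ := h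
      refine can_star_succ ((ih (hL u (by simp)) hs h1).mono ?_)
      rintro m _ ⟨hm, rfl⟩
      refine (ihL (bdd_of_runPath hs h1) (fun z hz => hL z (by simp [hz])) h2).mono ?_
      rintro n _ ⟨hn, rfl⟩
      refine ⟨?_, rfl⟩
      rw [List.flatten_cons, List.length_append, mul_add]
      exact add_le_add hm hn

end StackProgram

/-- The initial state of a program on numbers. -/
def NumState.init {R Λ : Type} (x : List InstSym) : NumState R Λ := ⟨fun _ => 0, fun _ => [], x⟩

open StackProgram in
/-- A language is in `NP` if it consists of the words on which a program on numbers has an accepting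
run of polynomial length in which all numbers have polynomially many digits. -/
theorem mem_classNP_of_numProgram {R Λ : Type} [DecidableEq R] [DecidableEq Λ] [Fintype R]
    [Fintype Λ] (P : RegularExpression (NumInstr R Λ)) (L : Set (List InstSym))
    (p q : Polynomial ℕ)
    (hL : ∀ x ∈ L, Can (NumInstr.BddStep (p.eval x.length)) P (.init x) fun m _ =>
      m ≤ q.eval x.length)
    (hL' : ∀ x, x ∉ L → Must NumInstr.Step P (.init x) fun _ => False) : L ∈ classNP InstSym := by
  let A : List InstSym := [.zero, .one, .minus, .comma, .semicolon]
  have hA : ∀ a, a ∈ A := by rintro (_ | _ | _ | _ | _) <;> simp [A]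
  -- Loading has left the input reversed on `aux₁`. Moving it to `inp` restores the order, and the
  -- remaining empty stacks describe zero registers and empty lists.
  have hinit : ∀ x : List InstSym,
      Function.update (Function.update (Function.update (fun _ => []) Cell.aux₁ x.reverse)
        Cell.aux₁ []) Cell.inp x = stackCfg (R := R) (Λ := Λ) (.init x) := by
    intro x
    funext k
    cases k <;> simp [stackCfg, NumState.init, encodeNatSym_zero, listWord, Function.update_apply]
  refine mem_classNP_of_stackProgram (moveAll A .aux₁ .inp * compile P) .aux₁
    (2 * Polynomial.X + 1 + 37 * (p + 1) * q) L ?_ ?_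
  · intro x hx
    refine can_mul.2 (can_moveAll (by simp) (fun a _ => hA a) ?_)
    obtain ⟨w, hw, s', hs', hq⟩ := hL x hx
    have h := can_compile hw (fun _ => by simp [NumState.init]) hs'
    have e := hinit x
    simp only [Function.update_self, List.reverse_reverse, ne_eq, reduceCtorEq, not_false_eq_true,
      Function.update_of_ne, List.append_nil] at e ⊢
    rw [e]
    refine h.mono ?_
    rintro m _ ⟨hm, -⟩
    have h1 : 37 * (p.eval x.length + 1) * w.length ≤
        37 * (p.eval x.length + 1) * q.eval x.length := Nat.mul_le_mul_left _ hq
    simp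
    omega
  · intro x
    contrapose!
    intro hx hcan
    have h := must_compile (hL' x hx)
    have h2 : Must StackAct.Step (moveAll A .aux₁ .inp * compile P)
        (Function.update (fun _ => []) Cell.aux₁ x.reverse) fun _ => False := by
      refine must_mul.2 (must_moveAll (by simp) fun _ => ?_)
      have e := hinit x
      simp only [Function.update_self, List.reverse_reverse, ne_eq, reduceCtorEq, not_false_eq_true,
        Function.update_of_ne, List.append_nil] at e ⊢
      rw [e]
      exact h.mono fun _ ⟨_, h, _⟩ => h
    exact not_must_false_iff.2 hcan h2

/-! ### Arithmetic with programs on numbers -/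

namespace NumState

variable {R Λ : Type} [DecidableEq R] [DecidableEq Λ] (s : NumState R Λ)

theorem reg_setReg (r q : R) (m : ℕ) : (s.setReg r m).reg q = if q = r then m else s.reg q := by
  simp [setReg, Function.update_apply]

theorem setReg_setReg (r : R) (m m' : ℕ) : (s.setReg r m).setReg r m' = s.setReg r m' := by
  simp [setReg]

theorem setReg_comm {r r' : R} (h : r ≠ r') (m m' : ℕ) :
    (s.setReg r m).setReg r' m' = (s.setReg r' m').setReg r m := by
  simp [setReg, Function.update_comm h]

variable {s}

theorem setReg_of_eq {r : R} {m : ℕ} (h : s.reg r = m) : s.setReg r m = s := by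
  subst h
  simp [setReg]

theorem Bdd.setReg {B : ℕ} (hs : s.Bdd B) {r : R} {m : ℕ} (hm : m < 2 ^ B) :
    (s.setReg r m).Bdd B := by
  intro q
  rw [reg_setReg]
  split_ifs
  exacts [hm, hs q]

end NumState

/-! ### Rules for instructions, and programs for arithmetic -/

namespace NumProgram

open RegularExpression NumInstr NumState

section Instructions

variable {R Λ : Type} [DecidableEq R] [DecidableEq Λ] {s : NumState R Λ} {r x y z : R} {l : Λ}
  {Q : NumState R Λ → Prop} {Q' : ℕ → NumState R Λ → Prop} {B : ℕ}

theorem must_guess : Must Step (char (guess r)) s Q ↔ ∀ m, Q (s.setReg r m) := by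
  simp [must_char, Step]

theorem must_isZero : Must Step (char (isZero r)) s Q ↔ (s.reg r = 0 → Q s) := by
  simp +contextual [must_char, Step]

theorem must_isPos : Must Step (char (isPos r)) s Q ↔ (0 < s.reg r → Q s) := by
  simp +contextual [must_char, Step]

theorem must_isSum (h : s.reg x + s.reg y = s.reg z → Q s) :
    Must Step (char (isSum x y z)) s Q := by
  rw [must_char]
  rintro _ ⟨-, hs, rfl⟩
  exact h hs

theorem must_popBit {b : Bool}
    (h : ∀ m, s.reg r = 2 * m + b.toNat → Q (s.setReg r m)) :
    Must Step (char (popBit r b)) s Q := by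
  rw [must_char]
  rintro _ ⟨m, hm, -, rfl⟩
  exact h m hm

theorem must_double : Must Step (char (double r)) s Q ↔ Q (s.setReg r (2 * s.reg r)) := by
  simp [must_char, Step]

theorem must_pushNat : Must Step (char (push l r)) s Q ↔
    Q ((s.setLst l (s.reg r :: s.lst l)).setReg r 0) := by
  simp [must_char, Step]

theorem must_popNat (h : ∀ m t, s.lst l = m :: t → s.reg r = 0 → Q ((s.setLst l t).setReg r m)) :
    Must Step (char (pop l r)) s Q := by
  rw [must_char]
  rintro _ ⟨h0, m, t, hl, rfl⟩
  exact h m t hl h0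

theorem must_isNil : Must Step (char (isNil l)) s Q ↔ (s.lst l = [] → Q s) := by
  simp +contextual [must_char, Step]

theorem must_readNat (h : ∀ i, s.inp = encodeNatSym (s.reg r) ++ i → Q (s.setInp i)) :
    Must Step (char (readNat r)) s Q := by
  rw [must_char]
  rintro _ ⟨i, hi, rfl⟩
  exact h i hi

theorem must_readSym {a : InstSym} (h : ∀ i, s.inp = a :: i → Q (s.setInp i)) :
    Must Step (char (readSym a)) s Q := by
  rw [must_char]
  rintro _ ⟨i, hi, rfl⟩
  exact h i hi

theorem must_isEnd : Must Step (char (isEnd : NumInstr R Λ)) s Q ↔ (s.inp = [] → Q s) := by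
  simp +contextual [must_char, Step]

theorem can_instr (i : NumInstr R Λ) {s' : NumState R Λ} (h : i.Step s s') (hB : s'.Bdd B)
    (hQ : Q' 1 s') : Can (BddStep B) (char i) s Q' := can_char.2 ⟨s', ⟨h, hB⟩, hQ⟩

theorem can_guess (hs : s.Bdd B) {m : ℕ} (hm : m < 2 ^ B)
    (h : (s.setReg r m).Bdd B → Q' 1 (s.setReg r m)) :
    Can (BddStep B) (char (guess r)) s Q' :=
  can_instr _ ⟨m, rfl⟩ (hs.setReg hm) (h (hs.setReg hm))

theorem can_isZero (hs : s.Bdd B) (h0 : s.reg r = 0) (h : Q' 1 s) :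
    Can (BddStep B) (char (isZero r)) s Q' := can_instr _ ⟨h0, rfl⟩ hs h

theorem can_isPos (hs : s.Bdd B) (h0 : 0 < s.reg r) (h : Q' 1 s) :
    Can (BddStep B) (char (isPos r)) s Q' := can_instr _ ⟨h0, rfl⟩ hs h

theorem can_isSum (hs : s.Bdd B) (hxy : x ≠ y) (hxz : x ≠ z) (hyz : y ≠ z)
    (h0 : s.reg x + s.reg y = s.reg z) (h : Q' 1 s) :
    Can (BddStep B) (char (isSum x y z)) s Q' := can_instr _ ⟨⟨hxy, hxz, hyz⟩, h0, rfl⟩ hs h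

theorem can_popNat (hs : s.Bdd B) {m : ℕ} {t : List ℕ} (hm : m < 2 ^ B) (h0 : s.reg r = 0)
    (hl : s.lst l = m :: t)
    (h : ((s.setLst l t).setReg r m).Bdd B → Q' 1 ((s.setLst l t).setReg r m)) :
    Can (BddStep B) (char (pop l r)) s Q' :=
  have hb : ((s.setLst l t).setReg r m).Bdd B := Bdd.setReg (s := s.setLst l t) hs hm
  can_instr _ ⟨h0, m, t, hl, rfl⟩ hb (h hb)

theorem can_pushNat (hs : s.Bdd B)
    (h : ((s.setLst l (s.reg r :: s.lst l)).setReg r 0).Bdd B →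
      Q' 1 ((s.setLst l (s.reg r :: s.lst l)).setReg r 0)) :
    Can (BddStep B) (char (push l r)) s Q' :=
  have hb : ((s.setLst l (s.reg r :: s.lst l)).setReg r 0).Bdd B :=
    Bdd.setReg (s := s.setLst l _) hs (by positivity)
  can_instr _ rfl hb (h hb)

theorem can_isNil (hs : s.Bdd B) (h0 : s.lst l = []) (h : Q' 1 s) :
    Can (BddStep B) (char (isNil l)) s Q' := can_instr _ ⟨h0, rfl⟩ hs h

theorem can_readNat (hs : s.Bdd B) {i : List InstSym}
    (h0 : s.inp = encodeNatSym (s.reg r) ++ i) (h : (s.setInp i).Bdd B → Q' 1 (s.setInp i)) :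
    Can (BddStep B) (char (readNat r)) s Q' := can_instr _ ⟨i, h0, rfl⟩ hs (h hs)

theorem can_readSym (hs : s.Bdd B) {a : InstSym} {i : List InstSym}
    (h0 : s.inp = a :: i) (h : (s.setInp i).Bdd B → Q' 1 (s.setInp i)) :
    Can (BddStep B) (char (readSym a)) s Q' := can_instr _ ⟨i, h0, rfl⟩ hs (h hs)

theorem can_isEnd (hs : s.Bdd B) (h0 : s.inp = []) (h : Q' 1 s) :
    Can (BddStep B) (char (isEnd : NumInstr R Λ)) s Q' := can_instr _ ⟨h0, rfl⟩ hs h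

/-- Clear a register. -/
def setZero (r : R) : RegularExpression (NumInstr R Λ) := char (guess r) * char (isZero r)

theorem must_setZero (h : Q (s.setReg r 0)) : Must Step (setZero r) s Q := by
  refine must_mul.2 (must_guess.2 fun m => must_isZero.2 fun hm => ?_)
  rw [reg_setReg, if_pos rfl] at hm
  rwa [hm]

theorem can_setZero (hs : s.Bdd B) (h : (s.setReg r 0).Bdd B → Q' 2 (s.setReg r 0)) :
    Can (BddStep B) (setZero r) s Q' :=
  can_mul.2 (can_guess hs (m := 0) (by positivity) fun hb =>
    can_isZero hb (by rw [reg_setReg, if_pos rfl]) (h hb))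

end Instructions

/-- The registers of the verifiers: the data of the current vertex, those of another vertex, the
multiplicity of an edge, two products and five auxiliary registers. -/
inductive Reg
  | f | t | p | n | c
  | f' | t' | p' | n' | c'
  | b | m₁ | m₂
  | a | z | u | v | w
  deriving DecidableEq

instance : Fintype Reg where
  elems := {.f, .t, .p, .n, .c, .f', .t', .p', .n', .c', .b, .m₁, .m₂, .a, .z, .u, .v, .w}
  complete x := by cases x <;> decide

/-- The two stacks of numbers of the verifiers. -/
inductive Lst
  | left | right
  deriving DecidableEq

instance : Fintype Lst where
  elems := {.left, .right}
  complete x := by cases x <;> decide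

abbrev State := NumState Reg Lst

abbrev Program := RegularExpression (NumInstr Reg Lst)

variable {s : State} {x y r : Reg} {Q : State → Prop} {Q' : ℕ → State → Prop} {B : ℕ}

/-- Copy the number in the register `x` to the register `y`. -/
def copy (x y : Reg) : Program := char (guess y) * char (isSum x .z y)

/-- The register `z` is kept at zero, which turns the test of a sum into a test of equality. -/
theorem must_copy (hxy : x ≠ y) (hy : y ≠ .z) (hz : s.reg .z = 0)
    (h : Q (s.setReg y (s.reg x))) : Must Step (copy x y) s Q := by
  refine must_mul.2 (must_guess.2 fun m => must_isSum fun hm => ?_)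
  rw [reg_setReg, reg_setReg, reg_setReg, if_neg hxy, if_neg hy.symm, if_pos rfl, hz,
    add_zero] at hm
  rwa [← hm]

theorem can_copy (hs : s.Bdd B) (hxy : x ≠ y) (hx : x ≠ .z) (hy : y ≠ .z) (hz : s.reg .z = 0)
    (h : (s.setReg y (s.reg x)).Bdd B → Q' 2 (s.setReg y (s.reg x))) :
    Can (BddStep B) (copy x y) s Q' := by
  refine can_mul.2 (can_guess hs (hs x) fun hb => can_isSum hb hx hxy hy.symm ?_ (h hb))
  rw [reg_setReg, reg_setReg, reg_setReg, if_neg hxy, if_neg hy.symm, if_pos rfl, hz, add_zero]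

/-- Add the number in the register `y` to the number in the register `x`. -/
def add (x y : Reg) : Program :=
  char (guess .a) * (char (isSum x y .a) * (copy .a x * setZero .a))

theorem must_add_nat (hx : x ≠ .a) (hxz : x ≠ .z) (hy : y ≠ .a) (ha : s.reg .a = 0)
    (hz : s.reg .z = 0) (h : Q (s.setReg x (s.reg x + s.reg y))) : Must Step (add x y) s Q := by
  refine must_mul.2 (must_guess.2 fun m => must_mul.2 (must_isSum fun hm => must_mul.2
    (must_copy hx.symm hxz ?_ (must_setZero ?_))))
  · simp [reg_setReg, hz]
  · simp only [reg_setReg, if_neg hx, if_neg hy, if_true] at hm ⊢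
    rwa [setReg_comm _ hx, setReg_setReg, ← hm, setReg_of_eq ha]

theorem can_add_nat (hs : s.Bdd B) (hxy : x ≠ y) (hx : x ≠ .a) (hxz : x ≠ .z) (hy : y ≠ .a)
    (ha : s.reg .a = 0) (hz : s.reg .z = 0) (hlt : s.reg x + s.reg y < 2 ^ B)
    (h : (s.setReg x (s.reg x + s.reg y)).Bdd B → Q' 6 (s.setReg x (s.reg x + s.reg y))) :
    Can (BddStep B) (add x y) s Q' := by
  refine can_mul.2 (can_guess hs hlt fun hb => can_mul.2 (can_isSum hb hxy hx hy ?_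
    (can_mul.2 (can_copy hb hx.symm (by simp) hxz ?_ fun hb' => can_setZero hb' fun hb'' => ?_))))
  · simp [reg_setReg, hx, hy]
  · simp [reg_setReg, hz]
  · have e : ((s.setReg .a (s.reg x + s.reg y)).setReg x
        ((s.setReg .a (s.reg x + s.reg y)).reg .a)).setReg .a 0 =
        s.setReg x (s.reg x + s.reg y) := by
      rw [reg_setReg, if_pos rfl, setReg_comm _ hx, setReg_setReg, setReg_of_eq ha]
    rw [e] at hb'' ⊢
    exact h hb''

/-- Test whether the number in the register `x` is at most the number in the register `y`. -/
def le (x y : Reg) : Program := char (guess .a) * (char (isSum x .a y) * setZero .a)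

theorem must_le (hx : x ≠ .a) (hy : y ≠ .a) (ha : s.reg .a = 0) (h : s.reg x ≤ s.reg y → Q s) :
    Must Step (le x y) s Q := by
  refine must_mul.2 (must_guess.2 fun m => must_mul.2 (must_isSum fun hm => must_setZero ?_))
  simp only [reg_setReg, if_neg hx, if_neg hy, if_true] at hm
  rw [setReg_setReg, setReg_of_eq ha]
  exact h (by omega)

theorem can_le (hs : s.Bdd B) (hxy : x ≠ y) (hx : x ≠ .a) (hy : y ≠ .a) (ha : s.reg .a = 0)
    (hle : s.reg x ≤ s.reg y) (h : Q' 4 s) : Can (BddStep B) (le x y) s Q' := by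
  refine can_mul.2 (can_guess hs (m := s.reg y - s.reg x) ((Nat.sub_le _ _).trans_lt (hs y))
    fun hb => can_mul.2 (can_isSum hb hx hxy hy.symm ?_ (can_setZero hb fun _ => ?_)))
  · simp [reg_setReg, hx, hy]
    omega
  · rwa [setReg_setReg, setReg_of_eq ha]

/-- Test whether the number in the register `x` is less than the number in the register `y`. -/
def lt (x y : Reg) : Program :=
  char (guess .a) * (char (isPos .a) * (char (isSum x .a y) * setZero .a))

theorem must_lt (hx : x ≠ .a) (hy : y ≠ .a) (ha : s.reg .a = 0) (h : s.reg x < s.reg y → Q s) :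
    Must Step (lt x y) s Q := by
  refine must_mul.2 (must_guess.2 fun m => must_mul.2 (must_isPos.2 fun hp => must_mul.2
    (must_isSum fun hm => must_setZero ?_)))
  simp only [reg_setReg, if_neg hx, if_neg hy, if_true] at hm hp
  rw [setReg_setReg, setReg_of_eq ha]
  exact h (by omega)

theorem can_lt (hs : s.Bdd B) (hxy : x ≠ y) (hx : x ≠ .a) (hy : y ≠ .a) (ha : s.reg .a = 0)
    (hlt : s.reg x < s.reg y) (h : Q' 5 s) : Can (BddStep B) (lt x y) s Q' := by
  refine can_mul.2 (can_guess hs (m := s.reg y - s.reg x) ((Nat.sub_le _ _).trans_lt (hs y))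
    fun hb => can_mul.2 (can_isPos hb ?_ (can_mul.2 (can_isSum hb hx hxy hy.symm ?_
    (can_setZero hb fun _ => ?_)))))
  · simp [reg_setReg]
    omega
  · simp [reg_setReg, hx, hy]
    omega
  · rwa [setReg_setReg, setReg_of_eq ha]

/-- Test whether the numbers in the registers `x` and `y` are equal. -/
def eq (x y : Reg) : Program := char (isSum x .z y)

theorem must_eq (hz : s.reg .z = 0) (h : s.reg x = s.reg y → Q s) : Must Step (eq x y) s Q := by
  refine must_isSum fun hm => h ?_
  rwa [hz] at hm

theorem can_eq (hs : s.Bdd B) (hxy : x ≠ y) (hx : x ≠ .z) (hy : y ≠ .z) (hz : s.reg .z = 0)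
    (he : s.reg x = s.reg y) (h : Q' 1 s) : Can (BddStep B) (eq x y) s Q' :=
  can_isSum hs hx hxy hy.symm (by rw [hz, he, add_zero]) h

/-- Add the product of the numbers in the registers `u` and `v` to the number in `w`. -/
def mulLoop : Program :=
  RegularExpression.star (char (popBit .u true) * (add .w .v * char (double .v)) +
    char (popBit .u false) * char (double .v)) * char (isZero .u)

/-- Change the contents of the registers `u`, `v` and `w`. -/
def setUVW (s : State) (k l m : ℕ) : State := ((s.setReg .u k).setReg .v l).setReg .w m

theorem setUVW_setReg_u (s : State) (k l m k' : ℕ) :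
    (setUVW s k l m).setReg .u k' = setUVW s k' l m := by
  rw [setUVW, setReg_comm _ (by simp), setReg_comm (s.setReg .u k) (by simp), setReg_setReg,
    setUVW]

theorem setUVW_setReg_v (s : State) (k l m l' : ℕ) :
    (setUVW s k l m).setReg .v l' = setUVW s k l' m := by
  rw [setUVW, setReg_comm _ (by simp), setReg_setReg, setUVW]

theorem setUVW_setReg_w (s : State) (k l m m' : ℕ) :
    (setUVW s k l m).setReg .w m' = setUVW s k l m' := by
  rw [setUVW, setReg_setReg, setUVW]

theorem reg_setUVW (s : State) (k l m : ℕ) (q : Reg) : (setUVW s k l m).reg q =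
    if q = .w then m else if q = .v then l else if q = .u then k else s.reg q := by
  simp [setUVW, reg_setReg]

/-- Binary multiplication: the value of `w + u * v` is invariant, and it is `w` once `u` is zero.
What is then in `v` does not matter. -/
theorem must_mulLoop {k l m : ℕ} (ha : s.reg .a = 0) (hz : s.reg .z = 0)
    (h : ∀ l', Q (setUVW s 0 l' (m + k * l))) : Must Step mulLoop (setUVW s k l m) Q := by
  refine must_mul.2 (Must.mono (must_star (I := fun s' => ∃ k' l' m',
    m' + k' * l' = m + k * l ∧ s' = setUVW s k' l' m') ?_ ⟨k, l, m, rfl, rfl⟩) ?_)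
  · rintro _ ⟨k', l', m', he, rfl⟩
    refine must_add.2 ⟨must_mul.2 (must_popBit fun k₂ hk => ?_),
      must_mul.2 (must_popBit fun k₂ hk => must_double.2 ?_)⟩
    · rw [setUVW_setReg_u]
      refine must_mul.2 (must_add_nat (by simp) (by simp) (by simp) ?_ ?_ (must_double.2 ?_))
      · simpa [reg_setUVW] using ha
      · simpa [reg_setUVW] using hz
      · rw [setUVW_setReg_w, setUVW_setReg_v]
        refine ⟨_, _, _, ?_, rfl⟩
        simp only [reg_setUVW] at hk ⊢
        simp at hk ⊢
        rw [← he, hk]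
        ring
    · rw [setUVW_setReg_u, setUVW_setReg_v]
      refine ⟨_, _, _, ?_, rfl⟩
      simp only [reg_setUVW] at hk ⊢
      simp at hk ⊢
      rw [← he, hk]
      ring
  · rintro _ ⟨k', l', m', he, rfl⟩
    refine must_isZero.2 fun hk => ?_
    simp only [reg_setUVW] at hk
    simp at hk
    subst hk
    rw [zero_mul, add_zero] at he
    subst he
    exact h _

/-- The number `v` is doubled once more after the last digit of `u`, so it may reach `2 * k * l`;
this is the reason for the factor two in `hlt`. A round takes at most eight instructions, and `i`
bounds the number of digits of `k`. -/
theorem can_mulLoop {k l m : ℕ} (i : ℕ) (hk : k < 2 ^ i) (hb : (setUVW s k l m).Bdd B)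
    (ha : s.reg .a = 0) (hz : s.reg .z = 0) (hlt : 0 < k → m + 2 * k * l < 2 ^ B)
    (h : ∀ l' j, j ≤ 8 * i + 1 → (setUVW s 0 l' (m + k * l)).Bdd B →
      Q' j (setUVW s 0 l' (m + k * l))) : Can (BddStep B) mulLoop (setUVW s k l m) Q' := by
  suffices Can (BddStep B) (RegularExpression.star (char (popBit .u true) *
      (add .w .v * char (double .v)) + char (popBit .u false) * char (double .v))) (setUVW s k l m)
      fun j t => j ≤ 8 * i ∧ ∃ l', t = setUVW s 0 l' (m + k * l) ∧ t.Bdd B by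
    refine can_mul.2 (this.mono ?_)
    rintro j _ ⟨hj, l', rfl, hbj⟩
    exact can_isZero hbj (by simp [reg_setUVW]) (h l' _ (by omega) hbj)
  clear h
  induction i generalizing k l m with
  | zero =>
    obtain rfl : k = 0 := by simpa using hk
    exact can_star_zero ⟨by simp, l, by simp, hb⟩
  | succ i ih =>
    by_cases hk0 : k = 0
    · subst hk0
      exact can_star_zero ⟨by simp, l, by simp, hb⟩
    specialize hlt (Nat.pos_of_ne_zero hk0)
    rcases Nat.even_or_odd' k with ⟨k', rfl | rfl⟩
    · have hl2 : 2 * l < 2 ^ B := by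
        have : 1 * (2 * l) ≤ k' * (2 * (2 * l)) := Nat.mul_le_mul (by omega) (by omega)
        linarith
      have hb1 : (setUVW s k' l m).Bdd B := by
        have := hb.setReg (r := .u) (m := k')
          (by have := hb .u; simp [reg_setUVW] at this; omega)
        rwa [setUVW_setReg_u] at this
      have hb2 : (setUVW s k' (2 * l) m).Bdd B := by
        have := hb1.setReg (r := .v) hl2
        rwa [setUVW_setReg_v] at this
      refine can_star_succ (can_add.2 (Or.inr (can_mul.2 (can_instr _ (s' := setUVW s k' l m) ?_ hb1
        (can_instr _ (s' := setUVW s k' (2 * l) m) ?_ hb2 ?_)))))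
      · exact ⟨k', by simp [reg_setUVW], by omega, by rw [setUVW_setReg_u]⟩
      · change _ = _
        rw [setUVW_setReg_v]
        simp [reg_setUVW]
      · refine (ih (by omega) hb2 fun _ => by linarith).mono ?_
        rintro j _ ⟨hj, l', rfl, hbj⟩
        exact ⟨by omega, l', by congr 1; ring, hbj⟩
    · have hm2 : m + l < 2 ^ B := by nlinarith
      have hl2 : 2 * l < 2 ^ B := by nlinarith
      have hb1 : (setUVW s k' l m).Bdd B := by
        have := hb.setReg (r := .u) (m := k')
          (by have := hb .u; simp [reg_setUVW] at this; omega)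
        rwa [setUVW_setReg_u] at this
      refine can_star_succ (can_add.2 (Or.inl (can_mul.2 (can_instr _ (s' := setUVW s k' l m) ?_ hb1
        (can_mul.2 (can_add_nat hb1 (by simp) (by simp) (by simp) (by simp) ?_ ?_ ?_
          fun hb2 => ?_))))))
      · exact ⟨k', by simp [reg_setUVW], by simp, by rw [setUVW_setReg_u]⟩
      · simpa [reg_setUVW] using ha
      · simpa [reg_setUVW] using hz
      · simpa [reg_setUVW] using hm2
      · have e1 : (setUVW s k' l m).reg .w = m := by simp [reg_setUVW]
        have e2 : (setUVW s k' l m).reg .v = l := by simp [reg_setUVW]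
        rw [e1, e2, setUVW_setReg_w] at hb2 ⊢
        have hb3 : (setUVW s k' (2 * l) (m + l)).Bdd B := by
          have := hb2.setReg (r := .v) hl2
          rwa [setUVW_setReg_v] at this
        refine can_instr _ (s' := setUVW s k' (2 * l) (m + l)) ?_ hb3 ?_
        · change _ = _
          rw [setUVW_setReg_v]
          simp [reg_setUVW]
        · refine (ih (by omega) hb3 fun _ => by nlinarith).mono ?_
          rintro j _ ⟨hj, l', rfl, hbj⟩
          exact ⟨by omega, l', by congr 1; ring, hbj⟩

/-- Write the product of the numbers in the registers `x` and `y` to the register `r`. -/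
def mul (x y r : Reg) : Program :=
  copy x .u * (copy y .v * (mulLoop * (copy .w r * (setZero .v * setZero .w))))

/-- The auxiliary registers contain zero. -/
def Clean (s : State) : Prop :=
  s.reg .a = 0 ∧ s.reg .z = 0 ∧ s.reg .u = 0 ∧ s.reg .v = 0 ∧ s.reg .w = 0

theorem setUVW_self (hs : Clean s) : setUVW s 0 0 0 = s := by
  rw [setUVW, setReg_of_eq hs.2.2.1, setReg_of_eq hs.2.2.2.1, setReg_of_eq hs.2.2.2.2]

theorem Clean.setReg (hs : Clean s)
    (hr : r ≠ .a ∧ r ≠ .z ∧ r ≠ .u ∧ r ≠ .v ∧ r ≠ .w) (m : ℕ) : Clean (s.setReg r m) := by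
  simpa [Clean, reg_setReg, hr.1.symm, hr.2.1.symm, hr.2.2.1.symm, hr.2.2.2.1.symm,
    hr.2.2.2.2.symm] using hs

theorem setUVW_setReg (hr : r ≠ .u ∧ r ≠ .v ∧ r ≠ .w) (k l m i : ℕ) :
    (setUVW s k l m).setReg r i = setUVW (s.setReg r i) k l m := by
  rw [setUVW, setReg_comm _ hr.2.2.symm, setReg_comm _ hr.2.1.symm, setReg_comm _ hr.1.symm, setUVW]

theorem must_mul_nat (hs : Clean s) (hx : x ≠ .u) (hy : y ≠ .u ∧ y ≠ .v)
    (hr : r ≠ .a ∧ r ≠ .z ∧ r ≠ .u ∧ r ≠ .v ∧ r ≠ .w)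
    (h : Q (s.setReg r (s.reg x * s.reg y))) : Must Step (mul x y r) s Q := by
  obtain ⟨ha, hz, hu, hv, hw⟩ := id hs
  refine must_mul.2 (must_copy hx (by simp) hz (must_mul.2 (must_copy hy.2 (by simp) ?_ ?_)))
  · simp [reg_setReg, hz]
  have e : ((s.setReg .u (s.reg x)).setReg .v ((s.setReg .u (s.reg x)).reg y)) =
      setUVW s (s.reg x) (s.reg y) 0 := by
    rw [reg_setReg, if_neg hy.1]
    exact (setReg_of_eq (s := (s.setReg .u (s.reg x)).setReg .v (s.reg y)) (r := Reg.w)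
      (by simpa [reg_setReg] using hw)).symm
  rw [e]
  refine must_mul.2 (must_mulLoop ha hz fun l' => must_mul.2 (must_copy hr.2.2.2.2.symm hr.2.1 ?_
    (must_mul.2 (must_setZero (must_setZero ?_)))))
  · simp [reg_setUVW, hz]
  · rw [setUVW_setReg hr.2.2, setUVW_setReg_v, setUVW_setReg_w]
    simp only [reg_setUVW, if_true, zero_add]
    rwa [setUVW_self (hs.setReg hr _)]

theorem can_mul_nat (hb : s.Bdd B) (hs : Clean s) (hx : x ≠ .u ∧ x ≠ .z)
    (hy : y ≠ .u ∧ y ≠ .v ∧ y ≠ .z) (hr : r ≠ .a ∧ r ≠ .z ∧ r ≠ .u ∧ r ≠ .v ∧ r ≠ .w)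
    (hlt : 2 * s.reg x * s.reg y < 2 ^ B)
    (h : ∀ j ≤ 8 * B + 11, (s.setReg r (s.reg x * s.reg y)).Bdd B →
      Q' j (s.setReg r (s.reg x * s.reg y))) :
    Can (BddStep B) (mul x y r) s Q' := by
  obtain ⟨ha, hz, hu, hv, hw⟩ := id hs
  refine can_mul.2 (can_copy hb hx.1 hx.2 (by simp) hz fun hb1 => can_mul.2 (can_copy hb1 hy.2.1
    hy.2.2 (by simp) ?_ fun hb2 => ?_))
  · simp [reg_setReg, hz]
  have e : ((s.setReg .u (s.reg x)).setReg .v ((s.setReg .u (s.reg x)).reg y)) =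
      setUVW s (s.reg x) (s.reg y) 0 := by
    rw [reg_setReg, if_neg hy.1]
    exact (setReg_of_eq (s := (s.setReg .u (s.reg x)).setReg .v (s.reg y)) (r := Reg.w)
      (by simpa [reg_setReg] using hw)).symm
  rw [e] at hb2 ⊢
  -- The factor `x` is below `2 ^ B`, so at most `B` rounds are needed; copying and clearing add ten
  -- instructions to the loop.
  refine can_mul.2 (can_mulLoop B (hb x) hb2 ha hz (fun _ => by simpa using hlt)
    fun l' j hj hb3 => can_mul.2 (can_copy hb3 hr.2.2.2.2.symm (by simp) hr.2.1 ?_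
    fun hb4 => can_mul.2 (can_setZero hb4 fun hb5 => can_setZero hb5 fun hb6 => ?_)))
  · simp [reg_setUVW, hz]
  · rw [setUVW_setReg hr.2.2, setUVW_setReg_v, setUVW_setReg_w] at hb6 ⊢
    simp only [reg_setUVW, if_true, zero_add] at hb6 ⊢
    have e : setUVW (s.setReg r (s.reg x * s.reg y)) 0 0 0 = s.setReg r (s.reg x * s.reg y) := by
      exact setUVW_self (hs.setReg hr _)
    rw [e] at hb6 ⊢
    exact h _ (by omega) hb6

end NumProgram

/-! ### Reading an instance and accumulating sums over the edges -/

namespace NumProgram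

open RegularExpression NumInstr NumState

/-- What is known about a vertex: two numbers `f` and `t` that are part of the certificate, and
three sums over the edges incident with it. -/
structure Item where
  f : ℕ
  t : ℕ
  p : ℕ
  n : ℕ
  c : ℕ

/-- The item with zero entries. -/
def Item.nil : Item := ⟨0, 0, 0, 0, 0⟩

/-- The list in which an item is stored on a stack. -/
def Item.toList (e : Item) : List ℕ := [e.f, e.t, e.p, e.n, e.c]

/-- The change of the sums at the vertex `x` caused by `k` edges between `x` and `e`. -/
def Item.join (x e : Item) (k : ℕ) : Item :=
  ⟨x.f, x.t, x.p + k * e.f, x.n + k * x.f, x.c + if e.t < x.t then k else 0⟩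

/-- The state in which the registers contain the items `x` and `y` and the numbers `b`, `m₁` and
`m₂`, and the stacks contain the lists `l` and `r`. -/
def st (x y : Item) (b m₁ m₂ : ℕ) (l r : List ℕ) (i : List InstSym) : State where
  reg
    | .f => x.f | .t => x.t | .p => x.p | .n => x.n | .c => x.c
    | .f' => y.f | .t' => y.t | .p' => y.p | .n' => y.n | .c' => y.c
    | .b => b | .m₁ => m₁ | .m₂ => m₂
    | .a => 0 | .z => 0 | .u => 0 | .v => 0 | .w => 0
  lst
    | .left => l
    | .right => r
  inp := i

section State

variable (x y : Item) (b m₁ m₂ k : ℕ) (l r l' : List ℕ) (i i' : List InstSym)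

theorem reg_st :
    (st x y b m₁ m₂ l r i).reg .f = x.f ∧ (st x y b m₁ m₂ l r i).reg .t = x.t ∧
    (st x y b m₁ m₂ l r i).reg .p = x.p ∧ (st x y b m₁ m₂ l r i).reg .n = x.n ∧
    (st x y b m₁ m₂ l r i).reg .c = x.c ∧ (st x y b m₁ m₂ l r i).reg .f' = y.f ∧
    (st x y b m₁ m₂ l r i).reg .t' = y.t ∧ (st x y b m₁ m₂ l r i).reg .p' = y.p ∧
    (st x y b m₁ m₂ l r i).reg .n' = y.n ∧ (st x y b m₁ m₂ l r i).reg .c' = y.c ∧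
    (st x y b m₁ m₂ l r i).reg .b = b ∧ (st x y b m₁ m₂ l r i).reg .m₁ = m₁ ∧
    (st x y b m₁ m₂ l r i).reg .m₂ = m₂ ∧ (st x y b m₁ m₂ l r i).reg .a = 0 ∧
    (st x y b m₁ m₂ l r i).reg .z = 0 :=
  ⟨rfl, rfl, rfl, rfl, rfl, rfl, rfl, rfl, rfl, rfl, rfl, rfl, rfl, rfl, rfl⟩

theorem lst_st : (st x y b m₁ m₂ l r i).lst .left = l ∧ (st x y b m₁ m₂ l r i).lst .right = r :=
  ⟨rfl, rfl⟩

theorem inp_st : (st x y b m₁ m₂ l r i).inp = i := rfl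

theorem clean_st : Clean (st x y b m₁ m₂ l r i) := ⟨rfl, rfl, rfl, rfl, rfl⟩

theorem setReg_st :
    (st x y b m₁ m₂ l r i).setReg .f k = st ⟨k, x.t, x.p, x.n, x.c⟩ y b m₁ m₂ l r i ∧
    (st x y b m₁ m₂ l r i).setReg .t k = st ⟨x.f, k, x.p, x.n, x.c⟩ y b m₁ m₂ l r i ∧
    (st x y b m₁ m₂ l r i).setReg .p k = st ⟨x.f, x.t, k, x.n, x.c⟩ y b m₁ m₂ l r i ∧
    (st x y b m₁ m₂ l r i).setReg .n k = st ⟨x.f, x.t, x.p, k, x.c⟩ y b m₁ m₂ l r i ∧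
    (st x y b m₁ m₂ l r i).setReg .c k = st ⟨x.f, x.t, x.p, x.n, k⟩ y b m₁ m₂ l r i ∧
    (st x y b m₁ m₂ l r i).setReg .f' k = st x ⟨k, y.t, y.p, y.n, y.c⟩ b m₁ m₂ l r i ∧
    (st x y b m₁ m₂ l r i).setReg .t' k = st x ⟨y.f, k, y.p, y.n, y.c⟩ b m₁ m₂ l r i ∧
    (st x y b m₁ m₂ l r i).setReg .p' k = st x ⟨y.f, y.t, k, y.n, y.c⟩ b m₁ m₂ l r i ∧
    (st x y b m₁ m₂ l r i).setReg .n' k = st x ⟨y.f, y.t, y.p, k, y.c⟩ b m₁ m₂ l r i ∧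
    (st x y b m₁ m₂ l r i).setReg .c' k = st x ⟨y.f, y.t, y.p, y.n, k⟩ b m₁ m₂ l r i ∧
    (st x y b m₁ m₂ l r i).setReg .b k = st x y k m₁ m₂ l r i ∧
    (st x y b m₁ m₂ l r i).setReg .m₁ k = st x y b k m₂ l r i ∧
    (st x y b m₁ m₂ l r i).setReg .m₂ k = st x y b m₁ k l r i := by
  refine ⟨?_, ?_, ?_, ?_, ?_, ?_, ?_, ?_, ?_, ?_, ?_, ?_, ?_⟩ <;>
  · rw [setReg, st, st, mk.injEq]
    refine ⟨?_, rfl, rfl⟩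
    funext q
    cases q <;> rfl

theorem setLst_st :
    (st x y b m₁ m₂ l r i).setLst .left l' = st x y b m₁ m₂ l' r i ∧
    (st x y b m₁ m₂ l r i).setLst .right l' = st x y b m₁ m₂ l l' i := by
  refine ⟨?_, ?_⟩ <;>
  · rw [setLst, st, st, mk.injEq]
    refine ⟨rfl, ?_, rfl⟩
    funext q
    cases q <;> rfl

theorem setInp_st : (st x y b m₁ m₂ l r i).setInp i' = st x y b m₁ m₂ l r i' := rfl

end State

variable {s : State} {x y : Item} {b m₁ m₂ k : ℕ} {l r : List ℕ} {i : List InstSym}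
  {Q : State → Prop} {Q' : ℕ → State → Prop} {B : ℕ}

/-- Pop the second item from a stack. -/
def popItem (l : Lst) : Program :=
  char (pop l .f') * (char (pop l .t') * (char (pop l .p') * (char (pop l .n') * char (pop l .c'))))

/-- Push the second item to a stack. -/
def pushItem (l : Lst) : Program :=
  char (push l .c') * (char (push l .n') * (char (push l .p') *
    (char (push l .t') * char (push l .f'))))

theorem must_popItem_left {es : List Item}
    (h : ∀ e es', es = e :: es' → Q (st x e b m₁ m₂ (es'.flatMap Item.toList) r i)) :
    Must Step (popItem .left) (st x .nil b m₁ m₂ (es.flatMap Item.toList) r i) Q := by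
  refine must_mul.2 (must_popNat fun f l₁ h1 _ => must_mul.2 (must_popNat fun t l₂ h2 _ =>
    must_mul.2 (must_popNat fun p l₃ h3 _ => must_mul.2 (must_popNat fun n l₄ h4 _ =>
    must_popNat fun c l₅ h5 _ => ?_))))
  simp only [setReg_st, setLst_st, lst_st] at *
  subst h2 h3 h4 h5
  rcases es with - | ⟨e, es⟩
  · cases h1
  · simp only [List.flatMap_cons, Item.toList, List.cons_append, List.cons.injEq,
      List.nil_append] at h1
    obtain ⟨rfl, rfl, rfl, rfl, rfl, rfl⟩ := h1
    exact h e es rfl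

theorem must_popItem_right {es : List Item}
    (h : ∀ e es', es = e :: es' → Q (st x e b m₁ m₂ l (es'.flatMap Item.toList) i)) :
    Must Step (popItem .right) (st x .nil b m₁ m₂ l (es.flatMap Item.toList) i) Q := by
  refine must_mul.2 (must_popNat fun f l₁ h1 _ => must_mul.2 (must_popNat fun t l₂ h2 _ =>
    must_mul.2 (must_popNat fun p l₃ h3 _ => must_mul.2 (must_popNat fun n l₄ h4 _ =>
    must_popNat fun c l₅ h5 _ => ?_))))
  simp only [setReg_st, setLst_st, lst_st] at *
  subst h2 h3 h4 h5
  rcases es with - | ⟨e, es⟩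
  · cases h1
  · simp only [List.flatMap_cons, Item.toList, List.cons_append, List.cons.injEq,
      List.nil_append] at h1
    obtain ⟨rfl, rfl, rfl, rfl, rfl, rfl⟩ := h1
    exact h e es rfl

/-- The entries of an item have at most `B` digits. -/
def Item.Bdd (B : ℕ) (e : Item) : Prop :=
  e.f < 2 ^ B ∧ e.t < 2 ^ B ∧ e.p < 2 ^ B ∧ e.n < 2 ^ B ∧ e.c < 2 ^ B

theorem bdd_st (hx : x.Bdd B) (hy : y.Bdd B) (hb : b < 2 ^ B) (h₁ : m₁ < 2 ^ B) (h₂ : m₂ < 2 ^ B) :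
    (st x y b m₁ m₂ l r i).Bdd B := by
  obtain ⟨h1, h2, h3, h4, h5⟩ := hx
  obtain ⟨h1', h2', h3', h4', h5'⟩ := hy
  have h0 : 0 < 2 ^ B := by positivity
  intro q
  cases q <;> assumption

theorem can_popItem_left {e : Item} (he : e.Bdd B) (hs : (st x .nil b m₁ m₂ l r i).Bdd B)
    (h : (st x e b m₁ m₂ l r i).Bdd B → Q' 5 (st x e b m₁ m₂ l r i)) :
    Can (BddStep B) (popItem .left) (st x .nil b m₁ m₂ (e.toList ++ l) r i) Q' := by
  refine can_mul.2 (can_popNat (l := Lst.left) (t := [e.t, e.p, e.n, e.c] ++ l) ?_ he.1 rfl rfl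
    fun hb => ?_)
  · exact hs
  simp only [setReg_st, setLst_st] at hb ⊢
  refine can_mul.2 (can_popNat (l := Lst.left) (t := [e.p, e.n, e.c] ++ l) hb he.2.1 rfl rfl
    fun hb => ?_)
  simp only [setReg_st, setLst_st] at hb ⊢
  refine can_mul.2 (can_popNat (l := Lst.left) (t := [e.n, e.c] ++ l) hb he.2.2.1 rfl rfl
    fun hb => ?_)
  simp only [setReg_st, setLst_st] at hb ⊢
  refine can_mul.2 (can_popNat (l := Lst.left) (t := [e.c] ++ l) hb he.2.2.2.1 rfl rfl
    fun hb => ?_)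
  simp only [setReg_st, setLst_st] at hb ⊢
  refine can_popNat (l := Lst.left) (t := l) hb he.2.2.2.2 rfl rfl fun hb => ?_
  simp only [setReg_st, setLst_st] at hb ⊢
  exact h hb

theorem can_popItem_right {e : Item} (he : e.Bdd B) (hs : (st x .nil b m₁ m₂ l r i).Bdd B)
    (h : (st x e b m₁ m₂ l r i).Bdd B → Q' 5 (st x e b m₁ m₂ l r i)) :
    Can (BddStep B) (popItem .right) (st x .nil b m₁ m₂ l (e.toList ++ r) i) Q' := by
  refine can_mul.2 (can_popNat (l := Lst.right) (t := [e.t, e.p, e.n, e.c] ++ r) ?_ he.1 rfl rfl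
    fun hb => ?_)
  · exact hs
  simp only [setReg_st, setLst_st] at hb ⊢
  refine can_mul.2 (can_popNat (l := Lst.right) (t := [e.p, e.n, e.c] ++ r) hb he.2.1 rfl rfl
    fun hb => ?_)
  simp only [setReg_st, setLst_st] at hb ⊢
  refine can_mul.2 (can_popNat (l := Lst.right) (t := [e.n, e.c] ++ r) hb he.2.2.1 rfl rfl
    fun hb => ?_)
  simp only [setReg_st, setLst_st] at hb ⊢
  refine can_mul.2 (can_popNat (l := Lst.right) (t := [e.c] ++ r) hb he.2.2.2.1 rfl rfl
    fun hb => ?_)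
  simp only [setReg_st, setLst_st] at hb ⊢
  refine can_popNat (l := Lst.right) (t := r) hb he.2.2.2.2 rfl rfl fun hb => ?_
  simp only [setReg_st, setLst_st] at hb ⊢
  exact h hb

theorem must_pushItem_left (h : Q (st x .nil b m₁ m₂ (y.toList ++ l) r i)) :
    Must Step (pushItem .left) (st x y b m₁ m₂ l r i) Q := by
  simp only [pushItem, must_mul, must_pushNat, setReg_st, setLst_st, lst_st, reg_st]
  exact h

theorem must_pushItem_right (h : Q (st x .nil b m₁ m₂ l (y.toList ++ r) i)) :
    Must Step (pushItem .right) (st x y b m₁ m₂ l r i) Q := by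
  simp only [pushItem, must_mul, must_pushNat, setReg_st, setLst_st, lst_st, reg_st]
  exact h

theorem can_pushItem_left (hs : (st x y b m₁ m₂ l r i).Bdd B)
    (h : (st x .nil b m₁ m₂ (y.toList ++ l) r i).Bdd B →
      Q' 5 (st x .nil b m₁ m₂ (y.toList ++ l) r i)) :
    Can (BddStep B) (pushItem .left) (st x y b m₁ m₂ l r i) Q' := by
  refine can_mul.2 (can_pushNat hs fun hs => ?_)
  simp only [setReg_st, setLst_st, lst_st, reg_st] at hs ⊢
  refine can_mul.2 (can_pushNat hs fun hs => ?_)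
  simp only [setReg_st, setLst_st, lst_st, reg_st] at hs ⊢
  refine can_mul.2 (can_pushNat hs fun hs => ?_)
  simp only [setReg_st, setLst_st, lst_st, reg_st] at hs ⊢
  refine can_mul.2 (can_pushNat hs fun hs => ?_)
  simp only [setReg_st, setLst_st, lst_st, reg_st] at hs ⊢
  refine can_pushNat hs fun hs => ?_
  simp only [setReg_st, setLst_st, lst_st, reg_st] at hs ⊢
  exact h hs

theorem can_pushItem_right (hs : (st x y b m₁ m₂ l r i).Bdd B)
    (h : (st x .nil b m₁ m₂ l (y.toList ++ r) i).Bdd B →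
      Q' 5 (st x .nil b m₁ m₂ l (y.toList ++ r) i)) :
    Can (BddStep B) (pushItem .right) (st x y b m₁ m₂ l r i) Q' := by
  refine can_mul.2 (can_pushNat hs fun hs => ?_)
  simp only [setReg_st, setLst_st, lst_st, reg_st] at hs ⊢
  refine can_mul.2 (can_pushNat hs fun hs => ?_)
  simp only [setReg_st, setLst_st, lst_st, reg_st] at hs ⊢
  refine can_mul.2 (can_pushNat hs fun hs => ?_)
  simp only [setReg_st, setLst_st, lst_st, reg_st] at hs ⊢
  refine can_mul.2 (can_pushNat hs fun hs => ?_)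
  simp only [setReg_st, setLst_st, lst_st, reg_st] at hs ⊢
  refine can_pushNat hs fun hs => ?_
  simp only [setReg_st, setLst_st, lst_st, reg_st] at hs ⊢
  exact h hs

/-- Add the number in the register `b` to the third sum of the item with the larger `t`. -/
def compare : Program :=
  (lt .t' .t * add .c .b + lt .t .t' * add .c' .b) + eq .t .t'

theorem must_compare (h : Q (st ⟨x.f, x.t, x.p, x.n, x.c + if y.t < x.t then b else 0⟩
      ⟨y.f, y.t, y.p, y.n, y.c + if x.t < y.t then b else 0⟩ b m₁ m₂ l r i)) :
    Must Step compare (st x y b m₁ m₂ l r i) Q := by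
  refine must_add.2 ⟨must_add.2 ⟨must_mul.2 (must_lt (by simp) (by simp) rfl fun hlt =>
    must_add_nat (by simp) (by simp) (by simp) rfl rfl ?_), must_mul.2 (must_lt (by simp) (by simp)
    rfl fun hlt => must_add_nat (by simp) (by simp) (by simp) rfl rfl ?_)⟩, must_eq rfl fun he => ?_⟩
  · simp only [reg_st, setReg_st] at hlt ⊢
    simpa [hlt, hlt.not_gt] using h
  · simp only [reg_st, setReg_st] at hlt ⊢
    simpa [hlt, hlt.not_gt] using h
  · simp only [reg_st] at he
    simp only [he.not_lt, he.not_gt, if_false, add_zero] at h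
    exact h

theorem can_compare (hs : (st x y b m₁ m₂ l r i).Bdd B) (hx : x.c + b < 2 ^ B)
    (hy : y.c + b < 2 ^ B)
    (h : ∀ j ≤ 11, (st ⟨x.f, x.t, x.p, x.n, x.c + if y.t < x.t then b else 0⟩
      ⟨y.f, y.t, y.p, y.n, y.c + if x.t < y.t then b else 0⟩ b m₁ m₂ l r i).Bdd B →
      Q' j (st ⟨x.f, x.t, x.p, x.n, x.c + if y.t < x.t then b else 0⟩
      ⟨y.f, y.t, y.p, y.n, y.c + if x.t < y.t then b else 0⟩ b m₁ m₂ l r i)) :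
    Can (BddStep B) compare (st x y b m₁ m₂ l r i) Q' := by
  rcases lt_trichotomy x.t y.t with hlt | he | hlt
  · refine can_add.2 (Or.inl (can_add.2 (Or.inr (can_mul.2 (can_lt hs (by simp) (by simp) (by simp)
      rfl hlt (can_add_nat hs (by simp) (by simp) (by simp) (by simp) rfl rfl hy fun hs => ?_))))))
    simp only [reg_st, setReg_st] at hs ⊢
    simp only [hlt, hlt.not_gt, if_true, if_false] at h
    exact h 11 le_rfl hs
  · refine can_add.2 (Or.inr (can_eq hs (by simp) (by simp) (by simp) rfl he ?_))
    simp only [he.not_lt, he.not_gt, if_false, add_zero] at h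
    exact h 1 (by simp) hs
  · refine can_add.2 (Or.inl (can_add.2 (Or.inl (can_mul.2 (can_lt hs (by simp) (by simp) (by simp)
      rfl hlt (can_add_nat hs (by simp) (by simp) (by simp) (by simp) rfl rfl hx fun hs => ?_))))))
    simp only [reg_st, setReg_st] at hs ⊢
    simp only [hlt, hlt.not_gt, if_true, if_false] at h
    exact h 11 le_rfl hs

/-- Update the sums in both items for edges whose number is in the register `b`. -/
def joinItems : Program :=
  mul .b .f .m₁ * (mul .b .f' .m₂ * (add .p' .m₁ * (add .n .m₁ * (add .n' .m₂ * (add .p .m₂ *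
    (compare * (setZero .b * (setZero .m₁ * setZero .m₂))))))))

/-- An edge sends chips both ways. Gains are summed in `p` and losses in `n`, so that negative
numbers never occur; `c` counts the edges to vertices of smaller label. -/
theorem must_joinItems (h : Q (st (x.join y b) (y.join x b) 0 0 0 l r i)) :
    Must Step joinItems (st x y b 0 0 l r i) Q := by
  refine must_mul.2 (must_mul_nat (clean_st ..) (by simp) (by simp) (by simp) ?_)
  simp only [reg_st, setReg_st]
  refine must_mul.2 (must_mul_nat (clean_st ..) (by simp) (by simp) (by simp) ?_)
  simp only [reg_st, setReg_st]
  refine must_mul.2 (must_add_nat (by simp) (by simp) (by simp) rfl rfl ?_)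
  simp only [reg_st, setReg_st]
  refine must_mul.2 (must_add_nat (by simp) (by simp) (by simp) rfl rfl ?_)
  simp only [reg_st, setReg_st]
  refine must_mul.2 (must_add_nat (by simp) (by simp) (by simp) rfl rfl ?_)
  simp only [reg_st, setReg_st]
  refine must_mul.2 (must_add_nat (by simp) (by simp) (by simp) rfl rfl ?_)
  simp only [reg_st, setReg_st]
  refine must_mul.2 (must_compare ?_)
  refine must_mul.2 (must_setZero (must_mul.2 (must_setZero (must_setZero ?_))))
  simp only [setReg_st]
  exact h

/-- The cost consists of two products with `8 * B + 11` instructions each, four additions with six,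
a comparison with at most eleven, and six instructions for clearing. -/
theorem can_joinItems (hs : (st x y b 0 0 l r i).Bdd B) (h1 : 2 * b * x.f < 2 ^ B)
    (h2 : 2 * b * y.f < 2 ^ B) (h3 : y.p + b * x.f < 2 ^ B) (h4 : x.n + b * x.f < 2 ^ B)
    (h5 : y.n + b * y.f < 2 ^ B) (h6 : x.p + b * y.f < 2 ^ B) (h7 : x.c + b < 2 ^ B)
    (h8 : y.c + b < 2 ^ B)
    (h : ∀ j ≤ 16 * B + 63, (st (x.join y b) (y.join x b) 0 0 0 l r i).Bdd B →
      Q' j (st (x.join y b) (y.join x b) 0 0 0 l r i)) :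
    Can (BddStep B) joinItems (st x y b 0 0 l r i) Q' := by
  refine can_mul.2 (can_mul_nat hs (clean_st ..) (by simp) (by simp) (by simp) h1 fun j₁ hj₁ hs => ?_)
  simp only [reg_st, setReg_st] at hs ⊢
  refine can_mul.2 (can_mul_nat hs (clean_st ..) (by simp) (by simp) (by simp) h2 fun j₂ hj₂ hs => ?_)
  simp only [reg_st, setReg_st] at hs ⊢
  refine can_mul.2 (can_add_nat hs (by simp) (by simp) (by simp) (by simp) rfl rfl h3 fun hs => ?_)
  simp only [reg_st, setReg_st] at hs ⊢
  refine can_mul.2 (can_add_nat hs (by simp) (by simp) (by simp) (by simp) rfl rfl h4 fun hs => ?_)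
  simp only [reg_st, setReg_st] at hs ⊢
  refine can_mul.2 (can_add_nat hs (by simp) (by simp) (by simp) (by simp) rfl rfl h5 fun hs => ?_)
  simp only [reg_st, setReg_st] at hs ⊢
  refine can_mul.2 (can_add_nat hs (by simp) (by simp) (by simp) (by simp) rfl rfl h6 fun hs => ?_)
  simp only [reg_st, setReg_st] at hs ⊢
  refine can_mul.2 (can_compare hs h7 h8 fun j₃ hj₃ hs => ?_)
  refine can_mul.2 (can_setZero hs fun hs => can_mul.2 (can_setZero hs fun hs =>
    can_setZero hs fun hs => ?_))
  simp only [setReg_st] at hs ⊢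
  exact h _ (by omega) hs

/-- Read the number of the edges between the current vertex and the next one of the other vertices,
and update the items of both. -/
def entry : Program :=
  char (readSym .comma) * (char (guess .b) * (char (readNat .b) * (popItem .left *
    (joinItems * pushItem .right))))

/-- The items of the earlier vertices lie on the left stack in the order of the vertices, which is
also the order of the entries in a row; an item goes to the right stack once its entry has been
used. -/
theorem must_entry {es : List Item}
    (h : ∀ k i' e es', i = .comma :: (encodeNatSym k ++ i') → es = e :: es' →
      Q (st (x.join e k) .nil 0 0 0 (es'.flatMap Item.toList) ((e.join x k).toList ++ r) i')) :
    Must Step entry (st x .nil 0 0 0 (es.flatMap Item.toList) r i) Q := by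
  refine must_mul.2 (must_readSym fun i₁ h1 => must_mul.2 (must_guess.2 fun k => must_mul.2
    (must_readNat fun i₂ h2 => must_mul.2 ?_)))
  simp only [reg_st, setReg_st, inp_st, setInp_st] at h1 h2 ⊢
  exact must_popItem_left fun e es' he => must_mul.2 (must_joinItems (must_pushItem_right
    (h k i₂ e es' (by rw [h1, h2]) he)))

theorem can_entry {e : Item} (hs : (st x .nil 0 0 0 l r i).Bdd B) (he : e.Bdd B) (hk : k < 2 ^ B)
    (h1 : 2 * k * x.f < 2 ^ B)
    (h2 : 2 * k * e.f < 2 ^ B) (h3 : e.p + k * x.f < 2 ^ B) (h4 : x.n + k * x.f < 2 ^ B)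
    (h5 : e.n + k * e.f < 2 ^ B) (h6 : x.p + k * e.f < 2 ^ B) (h7 : x.c + k < 2 ^ B)
    (h8 : e.c + k < 2 ^ B)
    (h : ∀ j ≤ 16 * B + 76, (st (x.join e k) .nil 0 0 0 l ((e.join x k).toList ++ r) i).Bdd B →
      Q' j (st (x.join e k) .nil 0 0 0 l ((e.join x k).toList ++ r) i)) :
    Can (BddStep B) entry (st x .nil 0 0 0 (e.toList ++ l) r (.comma :: (encodeNatSym k ++ i)))
      Q' := by
  replace hs : (st x .nil 0 0 0 (e.toList ++ l) r (.comma :: (encodeNatSym k ++ i))).Bdd B := hs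
  refine can_mul.2 (can_readSym (i := encodeNatSym k ++ i) hs rfl fun hs => can_mul.2 (can_guess hs
    hk fun hs => can_mul.2 (can_readNat (i := i) hs rfl fun hs => can_mul.2 ?_)))
  simp only [reg_st, setReg_st, inp_st, setInp_st] at hs ⊢
  refine can_popItem_left he hs fun hs => can_mul.2 (can_joinItems hs h1 h2 h3 h4 h5 h6 h7 h8
    fun j hj hs => can_pushItem_right hs fun hs => h _ (by omega) hs)

end NumProgram

/-! ### Reading rows and whole instances -/

namespace NumProgram

open RegularExpression NumInstr NumState

/-- The word for a row of an instance: an integer and a list of multiplicities. -/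
def rowWord (d : ℤ) (ws : List ℕ) : List InstSym :=
  encodeIntSym d ++ ws.flatMap (fun k => .comma :: encodeNatSym k) ++ [.semicolon]

/-- A row of an instance together with the part of the certificate that belongs to it. -/
structure Row where
  d : ℤ
  ws : List ℕ
  f : ℕ
  t : ℕ

/-- The word for a row. -/
def Row.word (R : Row) : List InstSym := rowWord R.d R.ws

/-- The item of a row before the edges are read. -/
def Row.init (R : Row) : Item := ⟨R.f, R.t, R.d.toNat, (-R.d).toNat, 0⟩

/-- Join an item to all items of a list. -/
def Item.joinAll (x : Item) (es : List Item) (ws : List ℕ) : Item :=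
  (List.zip es ws).foldl (fun x q => x.join q.1 q.2) x

/-- Join all items of a list to an item. -/
def Item.joinTo (x : Item) (es : List Item) (ws : List ℕ) : List Item :=
  List.zipWith (fun e k => e.join x k) es ws

/-- The items after another row. -/
def addRow (es : List Item) (R : Row) : List Item :=
  R.init.joinTo es R.ws ++ [R.init.joinAll es R.ws]

variable {x y : Item} {b m₁ m₂ k : ℕ} {l r : List ℕ} {i : List InstSym}
  {Q : State → Prop} {Q' : ℕ → State → Prop} {B : ℕ}

/-- The state between two rows. -/
def idle (es : List Item) (i : List InstSym) : State :=
  st .nil .nil 0 0 0 (es.flatMap Item.toList) [] i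

/-- Read an integer. -/
def readInt : Program :=
  char (readSym .minus) * (char (guess .n) * (char (isPos .n) * char (readNat .n))) +
    char (guess .p) * char (readNat .p)

/-- The sums `n` and `p` of the current vertex start with the negative and the positive part of its
chips. The test for positivity rules out a signed zero. -/
theorem must_readInt (h : ∀ d i', i = encodeIntSym d ++ i' →
      Q (st ⟨0, 0, d.toNat, (-d).toNat, 0⟩ y b m₁ m₂ l r i')) :
    Must Step readInt (st .nil y b m₁ m₂ l r i) Q := by
  refine must_add.2 ⟨must_mul.2 (must_readSym fun i₁ h1 => must_mul.2 (must_guess.2 fun k =>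
    must_mul.2 (must_isPos.2 fun hk => must_readNat fun i₂ h2 => ?_))),
    must_mul.2 (must_guess.2 fun k => must_readNat fun i₂ h2 => ?_)⟩
  · simp only [reg_st, setReg_st, inp_st, setInp_st] at hk h1 h2 ⊢
    have := h (-k) i₂ (by
      rw [encodeIntSym, if_pos (by omega), h1, h2]
      simp)
    simpa [Item.nil] using this
  · simp only [reg_st, setReg_st, inp_st, setInp_st] at h2 ⊢
    have := h k i₂ (by
      rw [encodeIntSym, if_neg (by omega), h2]
      simp)
    simpa [Item.nil] using this

theorem can_readInt {d : ℤ} (hs : (st .nil y b m₁ m₂ l r i).Bdd B) (hd : d.natAbs < 2 ^ B)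
    (h : ∀ j ≤ 4, (st ⟨0, 0, d.toNat, (-d).toNat, 0⟩ y b m₁ m₂ l r i).Bdd B →
      Q' j (st ⟨0, 0, d.toNat, (-d).toNat, 0⟩ y b m₁ m₂ l r i)) :
    Can (BddStep B) readInt (st .nil y b m₁ m₂ l r (encodeIntSym d ++ i)) Q' := by
  replace hs : (st .nil y b m₁ m₂ l r (encodeIntSym d ++ i)).Bdd B := hs
  rcases lt_or_ge d 0 with hd0 | hd0
  · obtain ⟨k, rfl⟩ : ∃ k : ℕ, d = -k := ⟨d.natAbs, by omega⟩
    refine can_add.2 (Or.inl (can_mul.2 (can_readSym (i := encodeNatSym k ++ i) hs ?_ fun hs =>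
      can_mul.2 (can_guess hs (m := k) (by simpa using hd) fun hs => can_mul.2 (can_isPos hs ?_
      (can_readNat (i := i) hs ?_ fun hs => ?_))))))
    · rw [inp_st, encodeIntSym, if_pos hd0]
      simp
    · simp only [reg_st, setReg_st, setInp_st]
      omega
    · simp only [reg_st, setReg_st, setInp_st, inp_st]
    · simp only [setReg_st, setInp_st] at hs ⊢
      simp only [neg_neg, Int.toNat_natCast, Int.toNat_neg_natCast] at h
      exact h _ (by omega) hs
  · obtain ⟨k, rfl⟩ : ∃ k : ℕ, d = k := ⟨d.natAbs, by omega⟩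
    refine can_add.2 (Or.inr (can_mul.2 (can_guess hs (m := k) (by simpa using hd) fun hs =>
      can_readNat (i := i) hs ?_ fun hs => ?_)))
    · simp [reg_st, setReg_st, inp_st, encodeIntSym, hd0.not_gt]
    · simp only [setReg_st, setInp_st] at hs ⊢
      simp only [Int.toNat_natCast, Int.toNat_neg_natCast] at h
      exact h _ (by omega) hs

theorem must_star_entry {es : List Item}
    (h : ∀ ws es₁ es₂ i', i = ws.flatMap (fun k => .comma :: encodeNatSym k) ++ i' →
      es = es₁ ++ es₂ → ws.length = es₁.length →
      Q (st (x.joinAll es₁ ws) .nil 0 0 0 (es₂.flatMap Item.toList)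
        ((x.joinTo es₁ ws).reverse.flatMap Item.toList) i')) :
    Must Step (RegularExpression.star entry) (st x .nil 0 0 0 (es.flatMap Item.toList) [] i) Q := by
  refine (must_star (I := fun s => ∃ ws es₁ es₂ i', i = ws.flatMap (fun k => .comma ::
    encodeNatSym k) ++ i' ∧ es = es₁ ++ es₂ ∧ ws.length = es₁.length ∧
    s = st (x.joinAll es₁ ws) .nil 0 0 0 (es₂.flatMap Item.toList)
      ((x.joinTo es₁ ws).reverse.flatMap Item.toList) i') ?_ ⟨[], [], es, i, rfl, rfl, rfl, rfl⟩).mono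
    ?_
  · rintro _ ⟨ws, es₁, es₂, i', hi, he, hl, rfl⟩
    refine must_entry fun k i'' e es' hi' he' => ⟨ws ++ [k], es₁ ++ [e], es', i'', ?_, ?_, ?_, ?_⟩
    · rw [hi, hi']
      simp
    · rw [he, he']
      simp
    · simp [hl]
    -- Joining changes only the sums and never `f` or `t`. The earlier vertices therefore see the
    -- current one as it was at the beginning of its row.
    · have h1 : ∀ (x' : Item), (x'.joinAll es₁ ws).f = x'.f ∧ (x'.joinAll es₁ ws).t = x'.t := by
        intro x'
        unfold Item.joinAll
        induction List.zip es₁ ws generalizing x' with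
        | nil => exact ⟨rfl, rfl⟩
        | cons q qs ih => exact ih (x'.join q.1 q.2)
      have h2 : e.join (x.joinAll es₁ ws) k = e.join x k := by
        rw [Item.join, (h1 x).1, (h1 x).2, Item.join]
      rw [h2]
      congr 1
      · simp [Item.joinAll, List.zip_append hl.symm]
      · simp [Item.joinTo, List.zipWith_append hl.symm]
  · rintro _ ⟨ws, es₁, es₂, i', hi, he, hl, rfl⟩
    exact h ws es₁ es₂ i' hi he hl

/-- Push the first item to the right stack. -/
def pushCurrent : Program :=
  char (push .right .c) * (char (push .right .n) * (char (push .right .p) *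
    (char (push .right .t) * char (push .right .f))))

theorem must_pushCurrent (h : Q (st .nil y b m₁ m₂ l (x.toList ++ r) i)) :
    Must Step pushCurrent (st x y b m₁ m₂ l r i) Q := by
  simp only [pushCurrent, must_mul, must_pushNat, setReg_st, setLst_st, lst_st, reg_st]
  exact h

theorem can_pushCurrent (hs : (st x y b m₁ m₂ l r i).Bdd B)
    (h : (st .nil y b m₁ m₂ l (x.toList ++ r) i).Bdd B →
      Q' 5 (st .nil y b m₁ m₂ l (x.toList ++ r) i)) :
    Can (BddStep B) pushCurrent (st x y b m₁ m₂ l r i) Q' := by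
  refine can_mul.2 (can_pushNat hs fun hs => ?_)
  simp only [setReg_st, setLst_st, lst_st, reg_st] at hs ⊢
  refine can_mul.2 (can_pushNat hs fun hs => ?_)
  simp only [setReg_st, setLst_st, lst_st, reg_st] at hs ⊢
  refine can_mul.2 (can_pushNat hs fun hs => ?_)
  simp only [setReg_st, setLst_st, lst_st, reg_st] at hs ⊢
  refine can_mul.2 (can_pushNat hs fun hs => ?_)
  simp only [setReg_st, setLst_st, lst_st, reg_st] at hs ⊢
  refine can_pushNat hs fun hs => ?_
  simp only [setReg_st, setLst_st, lst_st, reg_st] at hs ⊢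
  exact h hs

theorem flatMap_toList_eq_nil {es : List Item} (h : es.flatMap Item.toList = []) : es = [] := by
  rcases es with - | ⟨e, es⟩
  · rfl
  · simp [Item.toList] at h

/-- Move all items from the right stack to the left one. -/
def moveItems : Program :=
  RegularExpression.star (popItem .right * pushItem .left) * char (isNil .right)

/-- During a row the items have been stacked in reverse; moving them back restores the order for the
next row. -/
theorem must_moveItems {es : List Item} (h : Q (st x .nil 0 0 0 (es.reverse.flatMap Item.toList) [] i)) :
    Must Step moveItems (st x .nil 0 0 0 [] (es.flatMap Item.toList) i) Q := by
  refine must_mul.2 ((must_star (I := fun s => ∃ es₁ es₂, es = es₁ ++ es₂ ∧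
    s = st x .nil 0 0 0 (es₁.reverse.flatMap Item.toList) (es₂.flatMap Item.toList) i) ?_
    ⟨[], es, rfl, rfl⟩).mono ?_)
  · rintro _ ⟨es₁, es₂, he, rfl⟩
    refine must_mul.2 (must_popItem_right fun e es' he' => must_pushItem_left
      ⟨es₁ ++ [e], es', ?_, ?_⟩)
    · simp [he, he']
    · simp
  · rintro _ ⟨es₁, es₂, he, rfl⟩
    refine must_isNil.2 fun hn => ?_
    obtain rfl := flatMap_toList_eq_nil hn
    simpa [he] using h

theorem can_moveItems {es : List Item} (hs : (st x .nil 0 0 0 [] [] i).Bdd B)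
    (hes : ∀ e ∈ es, e.Bdd B)
    (h : Q' (10 * es.length + 1) (st x .nil 0 0 0 (es.reverse.flatMap Item.toList) [] i)) :
    Can (BddStep B) moveItems (st x .nil 0 0 0 [] (es.flatMap Item.toList) i) Q' := by
  suffices H : ∀ l, Can (BddStep B) (RegularExpression.star (popItem .right * pushItem .left))
      (st x .nil 0 0 0 l (es.flatMap Item.toList) i) fun m s => m = 10 * es.length ∧
      s = st x .nil 0 0 0 (es.reverse.flatMap Item.toList ++ l) [] i by
    refine can_mul.2 ((H []).mono ?_)
    rintro m _ ⟨rfl, rfl⟩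
    exact can_isNil hs rfl (by simpa using h)
  clear h
  induction es with
  | nil => exact fun l => can_star_zero ⟨rfl, rfl⟩
  | cons e es ih =>
    intro l
    refine can_star_succ (can_mul.2 (can_popItem_right (hes e (by simp)) hs fun hs =>
      can_pushItem_left hs fun _ => ((ih (fun e' he' => hes e' (by simp [he'])) _).mono ?_)))
    rintro m _ ⟨rfl, rfl⟩
    exact ⟨by simp; ring, by simp⟩

/-- Read a row. -/
def row : Program :=
  readInt * (char (guess .f) * (char (guess .t) * (RegularExpression.star entry *
    (char (readSym .semicolon) * (char (isNil .left) * (pushCurrent * moveItems))))))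

/-- The left stack must be empty at the semicolon, which forces one entry for each earlier vertex.
-/
theorem must_row {es : List Item}
    (h : ∀ R i', i = Row.word R ++ i' → R.ws.length = es.length → Q (idle (addRow es R) i')) :
    Must Step row (idle es i) Q := by
  refine must_mul.2 (must_readInt fun d i₁ h1 => must_mul.2 (must_guess.2 fun f => must_mul.2
    (must_guess.2 fun t => must_mul.2 ?_)))
  simp only [setReg_st]
  refine must_star_entry fun ws es₁ es₂ i₂ h2 he hl => must_mul.2 (must_readSym fun i₃ h3 =>
    must_mul.2 (must_isNil.2 fun h4 => must_mul.2 ?_))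
  simp only [inp_st, lst_st, setInp_st] at h3 h4 ⊢
  obtain rfl := flatMap_toList_eq_nil h4
  rw [List.append_nil] at he
  subst he
  refine must_pushCurrent ?_
  have := must_moveItems (Q := Q) (x := .nil) (i := i₃)
    (es := (⟨f, t, d.toNat, (-d).toNat, 0⟩ : Item).joinAll es ws ::
      ((⟨f, t, d.toNat, (-d).toNat, 0⟩ : Item).joinTo es ws).reverse) (by
    have := h ⟨d, ws, f, t⟩ i₃ (by simp [Row.word, rowWord, h1, h2, h3]) hl
    simpa [idle, addRow, Row.init] using this)
  exact this

/-- The program that reads an instance. -/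
def readInstance : Program := RegularExpression.star row * char isEnd

theorem init_eq_idle : (NumState.init i : State) = idle [] i := by
  rw [NumState.init, idle, st, mk.injEq]
  refine ⟨?_, ?_, rfl⟩ <;>
  · funext q
    cases q <;> rfl

theorem must_star_row
    (h : ∀ (rows : List Row) (i' : List InstSym), i = rows.flatMap Row.word ++ i' →
      rows.map (fun R => R.ws.length) = List.range rows.length →
      (rows.foldl addRow []).length = rows.length → Q (idle (rows.foldl addRow []) i')) :
    Must Step (RegularExpression.star row) (idle [] i) Q := by
  refine (must_star (I := fun s => ∃ rows : List Row, ∃ i', i = rows.flatMap Row.word ++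
    i' ∧ rows.map (fun R => R.ws.length) = List.range rows.length ∧
    (rows.foldl addRow []).length = rows.length ∧
    s = idle (rows.foldl addRow []) i') ?_ ⟨[], i, rfl, rfl, rfl, rfl⟩).mono ?_
  · rintro _ ⟨rows, i', hi, hw, hl, rfl⟩
    refine must_row fun R i'' hi' hR => ⟨rows ++ [R], i'', ?_, ?_, ?_, ?_⟩
    · simp [hi, hi']
    · simp [hw, hR, hl, List.range_succ]
    · simp [addRow, Item.joinTo, hR, hl]
    · simp
  · rintro _ ⟨rows, i', hi, hw, hl, rfl⟩
    exact h rows i' hi hw hl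

theorem must_readInstance_rows
    (h : ∀ rows : List Row, i = rows.flatMap Row.word →
      rows.map (fun R => R.ws.length) = List.range rows.length → Q (idle (rows.foldl addRow []) [])) :
    Must Step readInstance (.init i) Q := by
  rw [init_eq_idle]
  refine must_mul.2 (must_star_row fun rows i' hi hw hl => must_isEnd.2 fun hn => ?_)
  obtain rfl : i' = [] := hn
  exact h rows (by simpa using hi) hw

/-- Bounds for the entries of an item after `k` edges. -/
def Item.Le (M k : ℕ) (e : Item) : Prop :=
  e.f ≤ M ∧ e.t ≤ M ∧ e.p ≤ M + k * (M * M) ∧ e.n ≤ M + k * (M * M) ∧ e.c ≤ M + k * (M * M)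

theorem Item.Le.mono {M k k' : ℕ} {e : Item} (h : e.Le M k) (hk : k ≤ k') : e.Le M k' := by
  have := Nat.mul_le_mul_right (M * M) hk
  exact ⟨h.1, h.2.1, by linarith [h.2.2.1], by linarith [h.2.2.2.1], by linarith [h.2.2.2.2]⟩

theorem Item.Le.join {M k w : ℕ} {x e : Item} (hx : x.Le M k) (he : e.f ≤ M) (hw : w ≤ M) :
    (x.join e w).Le M (k + 1) := by
  have h1 : w * e.f ≤ M * M := Nat.mul_le_mul hw he
  have h2 : w * x.f ≤ M * M := Nat.mul_le_mul hw hx.1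
  have h3 : (if e.t < x.t then w else 0) ≤ M * M :=
    (ite_le_sup _ _ _).trans ((sup_le hw (Nat.zero_le _)).trans (Nat.le_mul_self M))
  rw [Item.Le, add_one_mul]
  refine ⟨hx.1, hx.2.1, ?_, ?_, ?_⟩ <;> simp only [Item.join]
  · linarith [hx.2.2.1]
  · linarith [hx.2.2.2.1]
  · linarith [hx.2.2.2.2]

theorem Item.Le.bdd {M k K : ℕ} {e : Item} (h : e.Le M k) (hk : k ≤ K)
    (hB : M + (K + 2) * (M * M) < 2 ^ B) : e.Bdd B := by
  have h1 := (h.mono hk)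
  have h0 := Nat.zero_le (M * M)
  rw [add_mul] at hB
  refine ⟨?_, ?_, ?_, ?_, ?_⟩
  · linarith [h1.1, Nat.zero_le (K * (M * M))]
  · linarith [h1.2.1, Nat.zero_le (K * (M * M))]
  · linarith [h1.2.2.1]
  · linarith [h1.2.2.2.1]
  · linarith [h1.2.2.2.2]

theorem Item.nil_bdd : Item.nil.Bdd B := by
  have h : 0 < 2 ^ B := by positivity
  exact ⟨h, h, h, h, h⟩

theorem bdd_st_zero (hx : x.Bdd B) : (st x .nil 0 0 0 l r i).Bdd B :=
  bdd_st hx Item.nil_bdd (by positivity) (by positivity) (by positivity)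

/-- `Item.Le M K` accounts for `K * (M * M)`. The two further multiples of `M * M` leave room for
the sums being updated and for the doubling in the multiplication. -/
theorem can_star_entry {M K k : ℕ} (hB : M + (K + 2) * (M * M) < 2 ^ B) (ws : List ℕ)
    (es : List Item) (hl : ws.length = es.length) (hx : x.Le M k) (hk : k + ws.length ≤ K)
    (hes : ∀ e ∈ es, e.Le M K) (hws : ∀ w ∈ ws, w ≤ M) :
    Can (BddStep B) (RegularExpression.star entry) (st x .nil 0 0 0 (es.flatMap Item.toList ++ l) r
      (ws.flatMap (fun k => .comma :: encodeNatSym k) ++ i)) fun m s =>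
      m ≤ (16 * B + 76) * ws.length ∧ s = st (x.joinAll es ws) .nil 0 0 0 l
        ((x.joinTo es ws).reverse.flatMap Item.toList ++ r) i := by
  induction ws generalizing x es r k with
  | nil =>
    obtain rfl : es = [] := List.length_eq_zero_iff.1 hl.symm
    exact can_star_zero ⟨by simp, rfl⟩
  | cons w ws ih =>
    rcases es with - | ⟨e, es⟩
    · cases hl
    simp only [List.length_cons] at hl hk
    have he := hes e (by simp)
    have hw := hws w (by simp)
    have hx' := hx.mono (k' := K) (by omega)
    have h0 : M ≤ M * M := Nat.le_mul_self M
    have h1 : w * e.f ≤ M * M := Nat.mul_le_mul hw he.1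
    have h2 : w * x.f ≤ M * M := Nat.mul_le_mul hw hx.1
    have h3 : 0 ≤ K * (M * M) := Nat.zero_le _
    rw [add_mul] at hB
    have hj := hx.join (e := e) he.1 hw
    have hxb : x.Bdd B := hx'.bdd le_rfl (by rw [add_mul]; exact hB)
    have heb : e.Bdd B := he.bdd le_rfl (by rw [add_mul]; exact hB)
    have := can_entry (B := B) (k := w) (x := x) (e := e) (l := es.flatMap Item.toList ++ l) (r := r)
      (i := ws.flatMap (fun k => .comma :: encodeNatSym k) ++ i)
      (Q' := fun m s => Can (BddStep B) (RegularExpression.star entry) s fun m' s' =>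
        m + m' ≤ (16 * B + 76) * (w :: ws).length ∧ s' = st (x.joinAll (e :: es) (w :: ws)) .nil 0 0
        0 l ((x.joinTo (e :: es) (w :: ws)).reverse.flatMap Item.toList ++ r) i)
      (bdd_st_zero hxb) heb (by linarith) (by linarith) (by linarith)
      (by linarith [he.2.2.1]) (by linarith [hx'.2.2.2.1]) (by linarith [he.2.2.2.1])
      (by linarith [hx'.2.2.1]) (by linarith [hx'.2.2.2.2]) (by linarith [he.2.2.2.2]) ?_
    · refine can_star_succ ?_
      simpa using this
    · intro j hj' _
      refine (ih es (by omega) hj (by omega) (fun e' he' => hes e' (by simp [he']))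
        fun w' hw' => hws w' (by simp [hw'])).mono ?_
      rintro m _ ⟨hm, rfl⟩
      refine ⟨?_, ?_⟩
      · rw [List.length_cons, mul_add]
        omega
      · simp [Item.joinAll, Item.joinTo]
        rfl

theorem Item.joinAll_le {M k : ℕ} (ws : List ℕ) (es : List Item) (hx : x.Le M k)
    (hes : ∀ e ∈ es, e.f ≤ M) (hws : ∀ w ∈ ws, w ≤ M) (hl : ws.length = es.length) :
    (x.joinAll es ws).Le M (k + ws.length) := by
  induction ws generalizing x es k with
  | nil =>
    obtain rfl : es = [] := List.length_eq_zero_iff.1 hl.symm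
    exact hx
  | cons w ws ih =>
    rcases es with - | ⟨e, es⟩
    · cases hl
    have := ih es (hx.join (e := e) (hes e (by simp)) (hws w (by simp)))
      (fun e' he' => hes e' (by simp [he'])) (fun w' hw' => hws w' (by simp [hw']))
      (by simpa using hl)
    rwa [add_assoc, add_comm 1] at this

/-- The numbers in a row are bounded by `M`. -/
def Row.Le (M : ℕ) (R : Row) : Prop :=
  R.d.natAbs ≤ M ∧ (∀ w ∈ R.ws, w ≤ M) ∧ R.f ≤ M ∧ R.t ≤ M

theorem Row.init_le {M : ℕ} {R : Row} (h : R.Le M) : R.init.Le M 0 := by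
  refine ⟨h.2.2.1, h.2.2.2, ?_, ?_, by simp [Row.init]⟩ <;>
  · simp only [Row.init, zero_mul, add_zero]
    have := h.1
    omega

theorem addRow_le {M : ℕ} {R : Row} (h : R.Le M) {es : List Item} (hl : R.ws.length = es.length)
    (hes : ∀ e ∈ es, e.Le M es.length) : ∀ e ∈ addRow es R, e.Le M (es.length + 1) := by
  intro e he
  rw [addRow, List.mem_append, List.mem_singleton] at he
  rcases he with he | rfl
  · obtain ⟨j, hj, rfl⟩ := List.getElem_of_mem he
    simp only [Item.joinTo, List.length_zipWith, lt_inf_iff] at hj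
    simp only [Item.joinTo, List.getElem_zipWith]
    exact (hes _ (List.getElem_mem hj.1)).join h.2.2.1 (h.2.1 _ (List.getElem_mem hj.2))
  · have := Item.joinAll_le R.ws es (Row.init_le h) (fun e he => (hes e he).1) h.2.1 hl
    exact this.mono (by omega)

theorem can_row {M K : ℕ} (hB : M + (K + 2) * (M * M) < 2 ^ B) {R : Row} (hR : R.Le M)
    {es : List Item} (hl : R.ws.length = es.length) (hK : es.length + 1 ≤ K)
    (hes : ∀ e ∈ es, e.Le M es.length)
    (h : ∀ j ≤ (16 * B + 100) * K, Q' j (idle (addRow es R) i)) :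
    Can (BddStep B) row (idle es (R.word ++ i)) Q' := by
  have hM : M < 2 ^ B := lt_of_le_of_lt (Nat.le_add_right _ _) hB
  have hw : R.word ++ i = encodeIntSym R.d ++ (R.ws.flatMap (fun k => .comma :: encodeNatSym k) ++
      .semicolon :: i) := by simp [Row.word, rowWord]
  rw [idle, hw]
  refine can_mul.2 (can_readInt (bdd_st_zero Item.nil_bdd) (hR.1.trans_lt hM) fun j₁ hj₁ hs =>
    can_mul.2 (can_guess hs (hR.2.2.1.trans_lt hM) fun hs => can_mul.2 (can_guess hs
    (hR.2.2.2.trans_lt hM) fun hs => can_mul.2 ?_)))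
  simp only [setReg_st] at hs ⊢
  have hse := can_star_entry (x := R.init) (k := 0) (l := []) (r := []) (i := .semicolon :: i) hB
    R.ws es hl (Row.init_le hR) (by omega) (fun e he => (hes e he).mono (by omega)) hR.2.1
  rw [List.append_nil] at hse
  refine hse.mono ?_
  rintro m _ ⟨hm, rfl⟩
  have hes' := addRow_le hR hl hes
  have hbd : ∀ e ∈ addRow es R, e.Bdd B := fun e he => (hes' e he).bdd hK hB
  refine can_mul.2 (can_readSym (i := i) (bdd_st_zero (hbd _ (by simp [addRow]))) rfl fun hs =>
    can_mul.2 (can_isNil hs rfl (can_mul.2 ?_)))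
  simp only [setInp_st] at hs ⊢
  refine can_pushCurrent hs fun hs => ?_
  have := can_moveItems (x := .nil) (i := i) (B := B) (Q' := fun n s' => Q' (j₁ + (1 + (1 +
      (m + (1 + (1 + (5 + n))))))) s')
    (es := R.init.joinAll es R.ws :: (R.init.joinTo es R.ws).reverse)
    (bdd_st_zero Item.nil_bdd) (fun e he => hbd e (by simpa [addRow, or_comm] using he)) ?_
  · simpa using this
  · have := h (j₁ + (1 + (1 + (m + (1 + (1 + (5 + (10 *
      (R.init.joinAll es R.ws :: (R.init.joinTo es R.ws).reverse).length + 1)))))))) ?_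
    · simpa [idle, addRow] using this
    · simp only [List.length_cons, List.length_reverse, Item.joinTo, List.length_zipWith, ← hl,
        min_self]
      have h1 : (16 * B + 100) * (R.ws.length + 1) ≤ (16 * B + 100) * K :=
        Nat.mul_le_mul_left _ (by omega)
      have h2 : (16 * B + 100) * (R.ws.length + 1) = (16 * B + 76) * R.ws.length +
        24 * R.ws.length + 16 * B + 100 := by ring
      omega

/-- The rest `i` of the input is left open because a malformed word, too, is read in this way up to
its first bad row. -/
theorem can_star_row {M K : ℕ} (hB : M + (K + 2) * (M * M) < 2 ^ B) (rows : List Row)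
    (hrows : ∀ R ∈ rows, R.Le M) (es : List Item) (hK : es.length + rows.length ≤ K)
    (hw : rows.map (fun R => R.ws.length) = List.range' es.length rows.length)
    (hes : ∀ e ∈ es, e.Le M es.length) :
    Can (BddStep B) (RegularExpression.star row) (idle es (rows.flatMap Row.word ++ i)) fun m s =>
      m ≤ (16 * B + 100) * K * rows.length ∧
      (rows.foldl addRow es).length = es.length + rows.length ∧
      (∀ e ∈ rows.foldl addRow es, e.Le M (es.length + rows.length)) ∧
      s = idle (rows.foldl addRow es) i := by
  induction rows generalizing es with
  | nil => exact can_star_zero ⟨by simp, rfl, hes, rfl⟩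
  | cons R rows ih =>
    simp only [List.map_cons, List.length_cons, List.range'_succ, List.cons.injEq] at hw hK
    have hl : (addRow es R).length = es.length + 1 := by simp [addRow, Item.joinTo, hw.1]
    refine can_star_succ ?_
    have := can_row (i := rows.flatMap Row.word ++ i) (Q' := fun m s => Can (BddStep B)
      (RegularExpression.star row) s fun m' s' => m + m' ≤ (16 * B + 100) * K * (R :: rows).length ∧
      ((R :: rows).foldl addRow es).length = es.length + (R :: rows).length ∧
      (∀ e ∈ (R :: rows).foldl addRow es, e.Le M (es.length + (R :: rows).length)) ∧
      s' = idle ((R :: rows).foldl addRow es) i) hB (hrows R (by simp)) hw.1 (by omega) hes ?_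
    · simpa using this
    · intro j hj
      refine (ih (fun R' hR' => hrows R' (by simp [hR'])) (addRow es R) (by omega)
        (by rw [hl]; exact hw.2) ?_).mono ?_
      · rw [hl]
        exact addRow_le (hrows R (by simp)) hw.1 hes
      · rintro m _ ⟨hm, h1, h2, rfl⟩
        rw [hl, add_assoc, add_comm 1] at h1 h2
        refine ⟨?_, h1, h2, rfl⟩
        rw [List.length_cons, mul_add]
        omega

theorem can_readInstance_rows {M : ℕ} (rows : List Row)
    (hB : M + (rows.length + 2) * (M * M) < 2 ^ B) (hrows : ∀ R ∈ rows, R.Le M)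
    (hw : rows.map (fun R => R.ws.length) = List.range rows.length)
    (h : ∀ j ≤ (16 * B + 100) * rows.length * rows.length + 1,
      Q' j (idle (rows.foldl addRow []) [])) :
    Can (BddStep B) readInstance (.init (rows.flatMap Row.word)) Q' := by
  rw [init_eq_idle]
  refine can_mul.2 ?_
  have := can_star_row (i := []) hB rows hrows [] (by simp) (by simpa [List.range_eq_range'] using hw)
    (by simp)
  rw [List.append_nil] at this
  refine this.mono ?_
  rintro m _ ⟨hm, -, -, rfl⟩
  exact can_isEnd (bdd_st_zero Item.nil_bdd) rfl (h _ (by omega))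

end NumProgram

/-! ### The sums after reading, in closed form -/

namespace NumProgram

open RegularExpression NumInstr NumState

/-- The number of edges between `i` and `j` if `w` contains the numbers below the diagonal. -/
def multOf (w : ℕ → ℕ → ℕ) (i j : ℕ) : ℕ := if j < i then w i j else if i < j then w j i else 0

/-- The word with `n` rows for the integers `d i` and the multiplicities `w i j`. -/
def instWord (n : ℕ) (d : ℕ → ℤ) (w : ℕ → ℕ → ℕ) : List InstSym :=
  (List.range n).flatMap fun i => rowWord (d i) ((List.range i).map (w i))

/-- The item of the vertex `i` after `n` rows. -/
def itemOf (d : ℕ → ℤ) (w : ℕ → ℕ → ℕ) (f t : ℕ → ℕ) (n i : ℕ) : Item where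
  f := f i
  t := t i
  p := (d i).toNat + ∑ j ∈ Finset.range n, multOf w i j * f j
  n := (-d i).toNat + ∑ j ∈ Finset.range n, multOf w i j * f i
  c := ∑ j ∈ Finset.range n, if t j < t i then multOf w i j else 0

/-- The items after `n` rows. -/
def itemsOf (d : ℕ → ℤ) (w : ℕ → ℕ → ℕ) (f t : ℕ → ℕ) (n : ℕ) : List Item :=
  (List.range n).map (itemOf d w f t n)

/-- The row of the vertex `i`. -/
def rowOf (d : ℕ → ℤ) (w : ℕ → ℕ → ℕ) (f t : ℕ → ℕ) (i : ℕ) : Row :=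
  ⟨d i, (List.range i).map (w i), f i, t i⟩

theorem joinAll_range (x : Item) (e : ℕ → Item) (w : ℕ → ℕ) (n : ℕ) :
    x.joinAll ((List.range n).map e) ((List.range n).map w) =
      ⟨x.f, x.t, x.p + ∑ j ∈ Finset.range n, w j * (e j).f, x.n + ∑ j ∈ Finset.range n, w j * x.f,
        x.c + ∑ j ∈ Finset.range n, if (e j).t < x.t then w j else 0⟩ := by
  rw [Item.joinAll]
  induction n with
  | zero => rfl
  | succ n ih =>
    rw [List.range_succ, List.map_append, List.map_append, List.zip_append (by simp),
      List.foldl_append, ih]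
    simp [Item.join, Finset.sum_range_succ, add_assoc]

/-- The row of `n` adds the term `j = n` to the sums of all earlier vertices, and its own sums run
over `j < n`. The diagonal term vanishes, so both agree with sums over all vertices read so far. -/
theorem foldl_addRow_range (d : ℕ → ℤ) (w : ℕ → ℕ → ℕ) (f t : ℕ → ℕ) (n : ℕ) :
    ((List.range n).map (rowOf d w f t)).foldl addRow [] = itemsOf d w f t n := by
  induction n with
  | zero => rfl
  | succ n ih =>
    rw [List.range_succ, List.map_append, List.foldl_append, ih, List.map_singleton,
      List.foldl_cons, List.foldl_nil, addRow, itemsOf, itemsOf, List.range_succ, List.map_append,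
      List.map_singleton]
    congr 1
    · rw [Item.joinTo, rowOf, List.zipWith_map, List.zipWith_self]
      refine List.map_congr_left fun i hi => ?_
      have hi : i < n := List.mem_range.1 hi
      have h : multOf w i n = w n i := by rw [multOf, if_neg hi.not_gt, if_pos hi]
      simp [Item.join, itemOf, Row.init, Finset.sum_range_succ, h, add_assoc]
      rfl
    · rw [rowOf, joinAll_range]
      have h : ∀ j ∈ Finset.range n, multOf w n j = w n j := fun j hj => by
        rw [multOf, if_pos (Finset.mem_range.1 hj)]
      have h0 : multOf w n n = 0 := by simp [multOf]
      simp only [itemOf, Row.init, Finset.sum_range_succ, h0, zero_mul, add_zero, zero_add,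
        ite_self, List.cons.injEq, and_true, Item.mk.injEq, true_and]
      refine ⟨?_, ?_, ?_⟩
      · exact congrArg _ (Finset.sum_congr rfl fun j hj => by rw [h j hj])
      · exact congrArg _ (Finset.sum_congr rfl fun j hj => by rw [h j hj])
      · exact Finset.sum_congr rfl fun j hj => by rw [h j hj]; rfl

theorem flatMap_rowOf (d : ℕ → ℤ) (w : ℕ → ℕ → ℕ) (f t : ℕ → ℕ) (n : ℕ) :
    ((List.range n).map (rowOf d w f t)).flatMap Row.word = instWord n d w := by
  rw [List.flatMap_map]
  rfl

theorem exists_eq_map_rowOf {rows : List Row}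
    (h : rows.map (fun R => R.ws.length) = List.range rows.length) :
    ∃ d w f t, rows = (List.range rows.length).map (rowOf d w f t) := by
  -- The default values are never seen: only indices below the length of the list and of the
  -- respective row occur.
  let R : ℕ → Row := fun i => rows.getD i ⟨0, [], 0, 0⟩
  refine ⟨fun i => (R i).d, fun i j => (R i).ws.getD j 0, fun i => (R i).f, fun i => (R i).t,
    List.ext_getElem (by simp) fun i h1 h2 => ?_⟩
  have hR : R i = rows[i] := List.getD_eq_getElem _ _ h1
  have hl : rows[i].ws.length = i := by
    have := congrArg (fun l => l[i]?) h
    simpa [h1] using this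
  have hw : rows[i].ws = (List.range i).map fun j => rows[i].ws.getD j 0 := by
    refine List.ext_getElem (by simp [hl]) fun j h3 h4 => ?_
    simp [List.getElem?_eq_getElem h3]
  simp only [List.getElem_map, List.getElem_range, rowOf, hR]
  rw [← hw]

variable {Q : State → Prop} {Q' : ℕ → State → Prop} {B : ℕ}

theorem must_readInstance {x : List InstSym}
    (h : ∀ n d w f t, x = instWord n d w → Q (idle (itemsOf d w f t n) [])) :
    Must Step readInstance (.init x) Q := by
  refine must_readInstance_rows fun rows hx hw => ?_
  obtain ⟨d, w, f, t, hr⟩ := exists_eq_map_rowOf hw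
  have := h rows.length d w f t (by rw [hx, ← flatMap_rowOf d w f t, ← hr])
  rwa [← foldl_addRow_range, ← hr] at this

theorem can_readInstance {M n : ℕ} {d : ℕ → ℤ} {w : ℕ → ℕ → ℕ} {f t : ℕ → ℕ}
    (hB : M + (n + 2) * (M * M) < 2 ^ B) (hd : ∀ i < n, (d i).natAbs ≤ M)
    (hw : ∀ i < n, ∀ j < i, w i j ≤ M) (hf : ∀ i < n, f i ≤ M) (ht : ∀ i < n, t i ≤ M)
    (h : ∀ j ≤ (16 * B + 100) * n * n + 1, Q' j (idle (itemsOf d w f t n) [])) :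
    Can (BddStep B) readInstance (.init (instWord n d w)) Q' := by
  rw [← flatMap_rowOf d w f t]
  refine can_readInstance_rows (M := M) _ (by simpa using hB) ?_ ?_ ?_
  · intro R hR
    obtain ⟨i, hi, rfl⟩ := List.mem_map.1 hR
    have hi : i < n := List.mem_range.1 hi
    refine ⟨hd i hi, fun k hk => ?_, hf i hi, ht i hi⟩
    obtain ⟨j, hj, rfl⟩ := List.mem_map.1 hk
    exact hw i hi j (List.mem_range.1 hj)
  · refine List.ext_getElem (by simp) fun i h1 h2 => ?_
    simp [rowOf]
  · rw [foldl_addRow_range]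
    simpa using h

/-- The items are bounded. -/
theorem itemOf_le {M n : ℕ} {d : ℕ → ℤ} {w : ℕ → ℕ → ℕ} {f t : ℕ → ℕ}
    (hd : ∀ i < n, (d i).natAbs ≤ M) (hw : ∀ i < n, ∀ j < i, w i j ≤ M) (hf : ∀ i < n, f i ≤ M)
    (ht : ∀ i < n, t i ≤ M) {i : ℕ} (hi : i < n) : (itemOf d w f t n i).Le M n := by
  have hm : ∀ j < n, multOf w i j ≤ M := by
    intro j hj
    rw [multOf]
    split_ifs with h1 h2
    exacts [hw i hi j h1, hw j hj i h2, Nat.zero_le _]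
  have hsum : ∀ g : ℕ → ℕ, (∀ j < n, g j ≤ M * M) → ∑ j ∈ Finset.range n, g j ≤ n * (M * M) := by
    intro g hg
    refine (Finset.sum_le_card_nsmul _ _ _ fun j hj => hg j (Finset.mem_range.1 hj)).trans_eq ?_
    simp
  have h1 := hsum (fun j => multOf w i j * f j) fun j hj => Nat.mul_le_mul (hm j hj) (hf j hj)
  have h2 := hsum (fun j => multOf w i j * f i) fun j hj => Nat.mul_le_mul (hm j hj) (hf i hi)
  have h3 := hsum (fun j => if t j < t i then multOf w i j else 0) fun j hj =>
    (ite_le_sup _ _ _).trans ((sup_le (hm j hj) (Nat.zero_le _)).trans (Nat.le_mul_self M))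
  have h4 := hd i hi
  refine ⟨hf i hi, ht i hi, ?_, ?_, ?_⟩ <;> simp only [itemOf] at h1 h2 h3 ⊢ <;> omega

end NumProgram

/-! ### Final checks -/

namespace NumProgram

open RegularExpression NumInstr NumState

theorem bdd_st_item {e : Item} {l r : List ℕ} {i : List InstSym} {B : ℕ} (he : e.Bdd B) :
    (st .nil e 0 0 0 l r i).Bdd B :=
  bdd_st Item.nil_bdd he (by positivity) (by positivity) (by positivity)

/-- Clear the second item. -/
def clearItem : Program :=
  setZero .f' * (setZero .t' * (setZero .p' * (setZero .n' * setZero .c')))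

/-- Pop an item and apply a test to it. -/
def testItem (P : Program) : Program := popItem .left * (P * clearItem)

/-- A program that tests whether the second item has a property. -/
structure IsTest (P : Program) (T : Item → Prop) : Prop where
  must : ∀ e l r i, Must Step P (st .nil e 0 0 0 l r i) fun s =>
    T e ∧ ∃ y, s = st .nil y 0 0 0 l r i
  can : ∀ B e l r i, e.Bdd B → e.n + e.c < 2 ^ B → T e →
    Can (BddStep B) P (st .nil e 0 0 0 l r i) fun m s =>
      m ≤ 11 ∧ s.Bdd B ∧ ∃ y, s = st .nil y 0 0 0 l r i

variable {P : Program} {T : Item → Prop} {Q : State → Prop} {Q' : ℕ → State → Prop} {B : ℕ}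
  {i : List InstSym} {es : List Item}

theorem IsTest.must_testItem (hP : IsTest P T)
    (h : ∀ e es', es = e :: es' → T e → Q (idle es' i)) :
    Must Step (testItem P) (idle es i) Q := by
  refine must_mul.2 (must_popItem_left fun e es' he => must_mul.2 (Must.mono
    (hP.must _ _ _ _) ?_))
  rintro _ ⟨hT, y, rfl⟩
  refine must_mul.2 (must_setZero (must_mul.2 (must_setZero (must_mul.2 (must_setZero
    (must_mul.2 (must_setZero (must_setZero ?_))))))))
  simp only [setReg_st]
  exact h e es' he hT

/-- Five instructions for popping, at most eleven for the test, ten for clearing. A test may spoil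
the item, since it is cleared afterwards. -/
theorem IsTest.can_testItem (hP : IsTest P T) {e : Item} (he : e.Bdd B) (hc : e.n + e.c < 2 ^ B)
    (hT : T e) (h : ∀ j ≤ 26, Q' j (idle es i)) :
    Can (BddStep B) (testItem P) (idle (e :: es) i) Q' := by
  rw [idle, List.flatMap_cons]
  refine can_mul.2 (can_popItem_left he (bdd_st_zero Item.nil_bdd) fun _ => can_mul.2
    ((hP.can B e _ _ _ he hc hT).mono ?_))
  rintro m _ ⟨hm, hs, y, rfl⟩
  refine can_mul.2 (can_setZero hs fun hs => can_mul.2 (can_setZero hs fun hs => can_mul.2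
    (can_setZero hs fun hs => can_mul.2 (can_setZero hs fun hs => can_setZero hs fun hs => ?_))))
  simp only [setReg_st]
  exact h _ (by omega)

theorem IsTest.must_star_testItem (hP : IsTest P T)
    (h : ∀ es₁ es₂, es = es₁ ++ es₂ → (∀ e ∈ es₁, T e) → Q (idle es₂ i)) :
    Must Step (RegularExpression.star (testItem P)) (idle es i) Q := by
  refine (must_star (I := fun s => ∃ es₁ es₂, es = es₁ ++ es₂ ∧ (∀ e ∈ es₁, T e) ∧
    s = idle es₂ i) ?_ ⟨[], es, rfl, by simp, rfl⟩).mono ?_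
  · rintro _ ⟨es₁, es₂, he, h1, rfl⟩
    refine hP.must_testItem fun e es' he' hT => ⟨es₁ ++ [e], es', ?_, ?_, rfl⟩
    · simp [he, he']
    · intro e' he''
      rcases List.mem_append.1 he'' with h' | h'
      · exact h1 e' h'
      · rw [List.mem_singleton] at h'
        rwa [h']
  · rintro _ ⟨es₁, es₂, he, h1, rfl⟩
    exact h es₁ es₂ he h1

theorem IsTest.can_star_testItem (hP : IsTest P T) {es' : List Item}
    (hes : ∀ e ∈ es, e.Bdd B ∧ e.n + e.c < 2 ^ B ∧ T e)
    (h : ∀ j ≤ 26 * es.length, Q' j (idle es' i)) :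
    Can (BddStep B) (RegularExpression.star (testItem P)) (idle (es ++ es') i) Q' := by
  induction es generalizing Q' with
  | nil => exact can_star_zero (h 0 (by simp))
  | cons e es ih =>
    obtain ⟨h1, h2, h3⟩ := hes e (by simp)
    refine can_star_succ (hP.can_testItem h1 h2 h3 fun j hj => ?_)
    refine ih (fun e' he' => hes e' (by simp [he'])) fun j' hj' => h _ ?_
    rw [List.length_cons]
    omega

theorem isTest_le : IsTest (le .n' .p') fun e => e.n ≤ e.p where
  must e l r i := must_le (by simp) (by simp) rfl fun h => ⟨h, e, rfl⟩
  can B e l r i he hc hT := can_le (bdd_st_item he) (by simp) (by simp) (by simp) rfl hT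
    ⟨by simp, bdd_st_item he, e, rfl⟩

theorem isTest_le_pos : IsTest (le .n' .p' * char (isPos .c')) fun e => e.n ≤ e.p ∧ 0 < e.c where
  must e l r i := must_mul.2 (must_le (by simp) (by simp) rfl fun h => must_isPos.2 fun h' =>
    ⟨⟨h, h'⟩, e, rfl⟩)
  can B e l r i he hc hT :=
    have hs := bdd_st_item (l := l) (r := r) (i := i) he
    can_mul.2 (can_le hs (by simp) (by simp) (by simp) rfl hT.1
      (can_isPos hs hT.2 ⟨by simp, hs, e, rfl⟩))

theorem isTest_c : IsTest (char (isZero .c')) fun e => e.c = 0 where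
  must e l r i := must_isZero.2 fun h => ⟨h, e, rfl⟩
  can B e l r i he hc hT :=
    have hs := bdd_st_item (l := l) (r := r) (i := i) he
    can_isZero hs hT ⟨by simp, hs, e, rfl⟩

theorem isTest_zero_c : IsTest (char (isZero .t') * char (isZero .c')) fun e =>
    e.t = 0 ∧ e.c = 0 where
  must e l r i := must_mul.2 (must_isZero.2 fun h => must_isZero.2 fun h' => ⟨⟨h, h'⟩, e, rfl⟩)
  can B e l r i he hc hT :=
    have hs := bdd_st_item (l := l) (r := r) (i := i) he
    can_mul.2 (can_isZero hs hT.1 (can_isZero hs hT.2 ⟨by simp, hs, e, rfl⟩))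

theorem isTest_pos_c : IsTest (char (isPos .t') * char (isZero .c')) fun e =>
    0 < e.t ∧ e.c = 0 where
  must e l r i := must_mul.2 (must_isPos.2 fun h => must_isZero.2 fun h' => ⟨⟨h, h'⟩, e, rfl⟩)
  can B e l r i he hc hT :=
    have hs := bdd_st_item (l := l) (r := r) (i := i) he
    can_mul.2 (can_isPos hs hT.1 (can_isZero hs hT.2 ⟨by simp, hs, e, rfl⟩))

/-- This is the inequality `D v - G.lap f v < c` of the burning certificate, rearranged so that
nothing is subtracted. -/
theorem isTest_lt : IsTest (add .n' .c' * lt .p' .n') fun e => e.p < e.n + e.c where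
  must e l r i := by
    refine must_mul.2 (must_add_nat (by simp) (by simp) (by simp) rfl rfl ?_)
    simp only [setReg_st, reg_st]
    exact must_lt (by simp) (by simp) rfl fun h => ⟨h, _, rfl⟩
  can B e l r i he hc hT := by
    have hs := bdd_st_item (l := l) (r := r) (i := i) he
    refine can_mul.2 (can_add_nat hs (by simp) (by simp) (by simp) (by simp) rfl rfl hc fun hs => ?_)
    simp only [setReg_st, reg_st] at hs ⊢
    exact can_lt hs (by simp) (by simp) (by simp) rfl hT ⟨by simp, hs, _, rfl⟩

theorem must_isNil_left (h : es = [] → Q (idle es i)) :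
    Must Step (char (isNil .left)) (idle es i) Q :=
  must_isNil.2 fun hn => h (flatMap_toList_eq_nil hn)

theorem can_isNil_left (h : Q' 1 (idle [] i)) :
    Can (BddStep B) (char (isNil .left)) (idle [] i) Q' :=
  can_isNil (bdd_st_zero Item.nil_bdd) rfl h

/-- Check that the first item satisfies `n ≤ p` and that all others satisfy `n ≤ p` and `0 < c`. -/
def checkEffective : Program :=
  testItem (le .n' .p') * (RegularExpression.star (testItem (le .n' .p' * char (isPos .c'))) *
    char (isNil .left))

/-- The first item belongs to the vertex `0`, the root of the certificate for connectedness; it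
alone needs no neighbour of smaller label. -/
theorem must_checkEffective
    (h : ∀ e es', es = e :: es' → e.n ≤ e.p → (∀ e' ∈ es', e'.n ≤ e'.p ∧ 0 < e'.c) →
      Q (idle [] i)) :
    Must Step checkEffective (idle es i) Q := by
  refine must_mul.2 (isTest_le.must_testItem fun e es' he hT => must_mul.2
    (isTest_le_pos.must_star_testItem fun es₁ es₂ he' hT' => must_isNil_left ?_))
  rintro rfl
  rw [List.append_nil] at he'
  subst he'
  exact h e es' he hT hT'

theorem can_checkEffective {e : Item} (hes : ∀ e' ∈ e :: es, e'.Bdd B ∧ e'.n + e'.c < 2 ^ B)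
    (he : e.n ≤ e.p) (hT : ∀ e' ∈ es, e'.n ≤ e'.p ∧ 0 < e'.c)
    (h : ∀ j ≤ 26 * es.length + 27, Q' j (idle [] i)) :
    Can (BddStep B) checkEffective (idle (e :: es) i) Q' := by
  obtain ⟨h1, h2⟩ := hes e (by simp)
  refine can_mul.2 (isTest_le.can_testItem h1 h2 he fun j hj => can_mul.2 ?_)
  have := isTest_le_pos.can_star_testItem (es' := []) (i := i) (B := B) (es := es)
    (Q' := fun m t => Can (BddStep B) (char (isNil .left)) t fun n s' => Q' (j + (m + n)) s')
    (fun e' he' => ⟨(hes e' (by simp [he'])).1, (hes e' (by simp [he'])).2, hT e' he'⟩)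
    fun j' hj' => can_isNil_left (h _ (by omega))
  rwa [List.append_nil] at this

/-- Check that all items satisfy `p < n + c`. -/
def checkIneffective : Program :=
  RegularExpression.star (testItem (add .n' .c' * lt .p' .n')) * char (isNil .left)

theorem must_checkIneffective (h : (∀ e ∈ es, e.p < e.n + e.c) → Q (idle [] i)) :
    Must Step checkIneffective (idle es i) Q := by
  refine must_mul.2 (isTest_lt.must_star_testItem fun es₁ es₂ he' hT' => must_isNil_left ?_)
  rintro rfl
  rw [List.append_nil] at he'
  subst he'
  exact h hT'

theorem can_checkIneffective (hes : ∀ e ∈ es, e.Bdd B ∧ e.n + e.c < 2 ^ B ∧ e.p < e.n + e.c)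
    (h : ∀ j ≤ 26 * es.length + 1, Q' j (idle [] i)) :
    Can (BddStep B) checkIneffective (idle es i) Q' := by
  have := isTest_lt.can_star_testItem (es' := []) (i := i) (B := B) (es := es)
    (Q' := fun m t => Can (BddStep B) (char (isNil .left)) t fun n s' => Q' (m + n) s') hes
    fun j' hj' => can_isNil_left (h _ (by omega))
  rw [List.append_nil] at this
  exact can_mul.2 this

/-- Check that all items satisfy `c = 0`, the first one also `t = 0`, and another one `0 < t`. -/
def checkDisconnected : Program :=
  testItem (char (isZero .t') * char (isZero .c')) * (RegularExpression.star (testItem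
    (char (isZero .c'))) * (testItem (char (isPos .t') * char (isZero .c')) *
    (RegularExpression.star (testItem (char (isZero .c'))) * char (isNil .left))))

/-- The two loops surround one tested vertex whose label must be positive; where it stands is
guessed by leaving the first loop. -/
theorem must_checkDisconnected
    (h : ∀ e es', es = e :: es' → e.t = 0 → (∃ e' ∈ es, 0 < e'.t) → (∀ e' ∈ es, e'.c = 0) →
      Q (idle [] i)) :
    Must Step checkDisconnected (idle es i) Q := by
  refine must_mul.2 (isTest_zero_c.must_testItem fun e es' he hT => must_mul.2
    (isTest_c.must_star_testItem fun es₁ es₂ he₁ hT₁ => must_mul.2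
    (isTest_pos_c.must_testItem fun e' es₃ he₂ hT₂ => must_mul.2
    (isTest_c.must_star_testItem fun es₄ es₅ he₃ hT₃ => must_isNil_left ?_))))
  rintro rfl
  rw [List.append_nil] at he₃
  subst he₁ he₂ he₃ he
  refine h e _ rfl hT.1 ⟨e', by simp, hT₂.1⟩ fun e'' he'' => ?_
  simp only [List.mem_cons, List.mem_append] at he''
  rcases he'' with rfl | he'' | rfl | he''
  exacts [hT.2, hT₁ _ he'', hT₂.2, hT₃ _ he'']

theorem can_checkDisconnected {e : Item} (hes : ∀ e' ∈ e :: es, e'.Bdd B ∧ e'.n + e'.c < 2 ^ B)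
    (he : e.t = 0) (hT : ∃ e' ∈ e :: es, 0 < e'.t) (hc : ∀ e' ∈ e :: es, e'.c = 0)
    (h : ∀ j ≤ 26 * es.length + 27, Q' j (idle [] i)) :
    Can (BddStep B) checkDisconnected (idle (e :: es) i) Q' := by
  obtain ⟨h1, h2⟩ := hes e (by simp)
  obtain ⟨e', he', ht⟩ := hT
  rw [List.mem_cons, or_iff_right (by rintro rfl; omega)] at he'
  obtain ⟨es₁, es₂, rfl⟩ := List.append_of_mem he'
  obtain ⟨h1', h2'⟩ := hes e' (by simp)
  refine can_mul.2 (isTest_zero_c.can_testItem h1 h2 ⟨he, hc e (by simp)⟩ fun j₁ hj₁ => can_mul.2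
    (isTest_c.can_star_testItem (fun a ha => ?_) fun j₂ hj₂ => can_mul.2
    (isTest_pos_c.can_testItem h1' h2' ⟨ht, hc e' (by simp)⟩ fun j₃ hj₃ => can_mul.2 ?_)))
  · have ha : a ∈ e :: (es₁ ++ e' :: es₂) := by simp [ha]
    exact ⟨(hes a ha).1, (hes a ha).2, hc a ha⟩
  have := isTest_c.can_star_testItem (es' := []) (i := i) (B := B) (es := es₂)
    (Q' := fun m t => Can (BddStep B) (char (isNil .left)) t fun n s' =>
      Q' (j₁ + (j₂ + (j₃ + (m + n)))) s') (fun a ha => ?_)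
    fun j' hj' => can_isNil_left (h _ (by simp only [List.length_append, List.length_cons]; omega))
  · rwa [List.append_nil] at this
  · have ha : a ∈ e :: (es₁ ++ e' :: es₂) := by simp [ha]
    exact ⟨(hes a ha).1, (hes a ha).2, hc a ha⟩

end NumProgram

/-! ### The words that describe instances -/

open NumProgram

/-- The words for the entries of a row. -/
def entriesWord (ws : List ℕ) : List InstSym := ws.flatMap fun k => .comma :: encodeNatSym k

theorem rowWord_eq (d : ℤ) (ws : List ℕ) :
    rowWord d ws = encodeIntSym d ++ entriesWord ws ++ [.semicolon] := rfl

/-- The word with the given rows. -/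
def rowsWord (rows : List (ℤ × List ℕ)) : List InstSym := rows.flatMap fun q => rowWord q.1 q.2

theorem rowsWord_cons (q : ℤ × List ℕ) (rows : List (ℤ × List ℕ)) :
    rowsWord (q :: rows) = rowWord q.1 q.2 ++ rowsWord rows := rfl

/-- The row `i` has `i` entries. -/
def IsTriangular (rows : List (ℤ × List ℕ)) : Prop :=
  rows.map (fun q => q.2.length) = List.range rows.length

/-- A comma or a semicolon. -/
def IsSep (a : InstSym) : Prop := a = .comma ∨ a = .semicolon

theorem isBits_append_inj {u u' v v' : List InstSym} {a a' : InstSym} (hu : IsBits u)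
    (hu' : IsBits u') (ha : a ∉ [InstSym.zero, InstSym.one]) (ha' : a' ∉ [InstSym.zero, InstSym.one])
    (h : u ++ a :: v = u' ++ a' :: v') : u = u' ∧ a = a' ∧ v = v' := by
  induction u generalizing u' with
  | nil =>
    rcases u' with - | ⟨c, u'⟩
    · simpa using h
    · simp only [List.nil_append, List.cons_append, List.cons.injEq] at h
      exact absurd (hu' c (by simp)) (h.1 ▸ ha)
  | cons c u ih =>
    rcases u' with - | ⟨c', u'⟩
    · simp only [List.nil_append, List.cons_append, List.cons.injEq] at h
      exact absurd (hu c (by simp)) (h.1 ▸ ha')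
    · simp only [List.cons_append, List.cons.injEq] at h
      obtain ⟨h1, h2, h3⟩ := ih (fun x hx => hu x (by simp [hx])) (fun x hx => hu' x (by simp [hx])) h.2
      exact ⟨by rw [h.1, h1], h2, h3⟩

theorem IsSep.notMem {a : InstSym} (h : IsSep a) : a ∉ [InstSym.zero, InstSym.one] := by
  rcases h with rfl | rfl <;> simp

theorem exists_entriesWord_append_eq_cons (ws : List ℕ) {a : InstSym} (ha : IsSep a)
    (y : List InstSym) : ∃ b z, IsSep b ∧ entriesWord ws ++ a :: y = b :: z := by
  rcases ws with - | ⟨w, ws⟩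
  · exact ⟨a, y, ha, rfl⟩
  · exact ⟨.comma, _, Or.inl rfl, rfl⟩

/-- With a comma for `a`, this compares a row that has been read only in part with a complete one,
as is needed for rows with too many entries. -/
theorem entriesWord_append_inj {ws ws' : List ℕ} {a : InstSym} (ha : IsSep a) {y y' : List InstSym}
    (h : entriesWord ws ++ a :: y = entriesWord ws' ++ .semicolon :: y') :
    (a = .semicolon → ws = ws' ∧ y = y') ∧ (a = .comma → ws.length < ws'.length) := by
  induction ws generalizing ws' with
  | nil =>
    rcases ws' with - | ⟨w', ws'⟩
    · simp only [entriesWord, List.flatMap_nil, List.nil_append, List.cons.injEq] at h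
      obtain ⟨rfl, rfl⟩ := h
      simp
    · simp only [entriesWord, List.flatMap_nil, List.nil_append, List.flatMap_cons, List.cons_append,
        List.cons.injEq] at h
      obtain ⟨rfl, -⟩ := h
      simp
  | cons w ws ih =>
    rcases ws' with - | ⟨w', ws'⟩
    · simp [entriesWord] at h
    · have h : encodeNatSym w ++ (entriesWord ws ++ a :: y) =
          encodeNatSym w' ++ (entriesWord ws' ++ .semicolon :: y') := by
        simpa [entriesWord] using h
      obtain ⟨b, z, hb, hz⟩ := exists_entriesWord_append_eq_cons ws ha y
      obtain ⟨b', z', hb', hz'⟩ := exists_entriesWord_append_eq_cons ws' (Or.inr rfl) y'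
      rw [hz, hz'] at h
      obtain ⟨h1, h2, h3⟩ := isBits_append_inj (isBits_encodeNatSym w) (isBits_encodeNatSym w')
        hb.notMem hb'.notMem h
      obtain rfl := encodeNatSym_injective h1
      have := ih (ws' := ws') (by rw [hz, hz', h2, h3])
      simpa using this

theorem encodeIntSym_append_inj {d d' : ℤ} {a a' : InstSym} (ha : IsSep a) (ha' : IsSep a')
    {y y' : List InstSym} (h : encodeIntSym d ++ a :: y = encodeIntSym d' ++ a' :: y') :
    d = d' ∧ a :: y = a' :: y' := by
  have key : ∀ (m : ℕ) (a : InstSym) (z y : List InstSym), IsSep a →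
      InstSym.minus :: z ≠ encodeNatSym m ++ a :: y := by
    intro m a z y ha h
    have := isBits_append_inj (u := []) (by simp [IsBits]) (isBits_encodeNatSym m) (by simp)
      ha.notMem h
    rcases ha with rfl | rfl <;> simp at this
  rw [encodeIntSym, encodeIntSym] at h
  split_ifs at h with h1 h2 h2
  · simp only [List.cons_append, List.nil_append, List.cons.injEq, true_and] at h
    obtain ⟨h3, h4, h5⟩ := isBits_append_inj (isBits_encodeNatSym _) (isBits_encodeNatSym _)
        ha.notMem ha'.notMem h
    have := encodeNatSym_injective h3
    exact ⟨by omega, by rw [h4, h5]⟩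
  · exact absurd h (key _ _ _ _ ha')
  · exact absurd h.symm (key _ _ _ _ ha)
  · simp only [List.nil_append] at h
    obtain ⟨h3, h4, h5⟩ := isBits_append_inj (isBits_encodeNatSym _) (isBits_encodeNatSym _)
        ha.notMem ha'.notMem h
    have := encodeNatSym_injective h3
    exact ⟨by omega, by rw [h4, h5]⟩

theorem rowWord_append_inj {d d' : ℤ} {ws ws' : List ℕ} {a : InstSym} (ha : IsSep a)
    {y y' : List InstSym}
    (h : encodeIntSym d ++ (entriesWord ws ++ a :: y) = rowWord d' ws' ++ y') :
    d = d' ∧ (a = .semicolon → ws = ws' ∧ y = y') ∧ (a = .comma → ws.length < ws'.length) := by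
  have h : encodeIntSym d ++ (entriesWord ws ++ a :: y) =
      encodeIntSym d' ++ (entriesWord ws' ++ .semicolon :: y') := by
    simpa [rowWord_eq] using h
  obtain ⟨b, z, hb, hz⟩ := exists_entriesWord_append_eq_cons ws ha y
  obtain ⟨b', z', hb', hz'⟩ := exists_entriesWord_append_eq_cons ws' (Or.inr rfl) y'
  rw [hz, hz'] at h
  obtain ⟨h1, h2⟩ := encodeIntSym_append_inj hb hb' h
  exact ⟨h1, entriesWord_append_inj ha (by rw [hz, hz', h2])⟩

/-- A row ends at its semicolon and its numbers end at the separators, so the rows can be compared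
from the left one by one. -/
theorem eq_append_of_rowsWord_eq {r r' : List (ℤ × List ℕ)} {z : List InstSym}
    (h : rowsWord r ++ z = rowsWord r') : ∃ r'', r' = r ++ r'' ∧ z = rowsWord r'' := by
  induction r generalizing r' with
  | nil => exact ⟨r', rfl, h⟩
  | cons q r ih =>
    rcases r' with - | ⟨q', r'⟩
    · simp [rowsWord, rowWord] at h
    · have h : encodeIntSym q.1 ++ (entriesWord q.2 ++ .semicolon :: (rowsWord r ++ z)) =
          rowWord q'.1 q'.2 ++ rowsWord r' := by
        simpa [rowsWord, rowWord_eq] using h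
      obtain ⟨h1, h2, -⟩ := rowWord_append_inj (Or.inr rfl) h
      obtain ⟨h2, h3⟩ := h2 rfl
      obtain ⟨r'', h4, h5⟩ := ih h3
      exact ⟨r'', by rw [h4, List.cons_append, Prod.ext h1 h2], h5⟩

theorem rowsWord_injective : Function.Injective rowsWord := by
  intro r r' h
  obtain ⟨r'', h1, h2⟩ := eq_append_of_rowsWord_eq (r := r) (r' := r') (z := []) (by rwa [List.append_nil])
  obtain rfl : r'' = [] := by
    rcases r'' with - | ⟨q, r''⟩
    · rfl
    · simp [rowsWord, rowWord] at h2
  rw [h1, List.append_nil]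

/-- By unique readability every other reading `r'` begins with the rows `r`, and its next row has
too many entries in the first case and too few in the second. -/
theorem not_isTriangular_of_rowsWord_eq {r r' : List (ℤ × List ℕ)} {d : ℤ} {ws : List ℕ}
    {a : InstSym} {y : List InstSym}
    (h : rowsWord r ++ (encodeIntSym d ++ (entriesWord ws ++ a :: y)) = rowsWord r')
    (ha : a = .comma ∧ ws.length = r.length ∨ a = .semicolon ∧ ws.length < r.length) :
    ¬ IsTriangular r' := by
  intro hr
  obtain ⟨r'', h1, h2⟩ := eq_append_of_rowsWord_eq h
  have hs : IsSep a := ha.imp And.left And.left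
  rcases r'' with - | ⟨q, r''⟩
  · simp [rowsWord] at h2
  · obtain ⟨-, h3, h4⟩ := rowWord_append_inj hs (y' := rowsWord r'') (h2.trans rfl)
    have h5 : q.2.length = r.length := by
      have := congrArg (fun l => l[r.length]?) hr
      simpa [h1] using this
    rcases ha with ⟨ha, hl⟩ | ⟨ha, hl⟩
    · have := h4 ha
      omega
    · have := (h3 ha).1
      subst this
      omega

/-- The pairs of symbols that may follow each other. -/
def okPair : InstSym → InstSym → Bool
  | .zero, .zero => true
  | .zero, .one => true
  | .zero, _ => false
  | .one, .minus => false
  | .one, _ => true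
  | .minus, .zero => true
  | .minus, .one => true
  | .minus, _ => false
  | .comma, .minus => false
  | .comma, _ => true
  | .semicolon, _ => true

/-- All pairs of consecutive symbols may follow each other. -/
def NoBadPair (x : List InstSym) : Prop := ∀ u a b v, x = u ++ a :: b :: v → okPair a b = true

theorem noBadPair_cons {a : InstSym} {x : List InstSym} :
    NoBadPair (a :: x) ↔ (∀ b v, x = b :: v → okPair a b = true) ∧ NoBadPair x := by
  constructor
  · refine fun h => ⟨fun b v hx => h [] a b v (by rw [hx]; rfl), fun u c b v hx =>
      h (a :: u) c b v (by rw [hx]; rfl)⟩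
  · rintro ⟨h1, h2⟩ u c b v hx
    rcases u with - | ⟨d, u⟩
    · simp only [List.nil_append, List.cons.injEq] at hx
      rw [← hx.1]
      exact h1 b v hx.2
    · simp only [List.cons_append, List.cons.injEq] at hx
      exact h2 u c b v hx.2

theorem noBadPair_encodeNatSym_append (m : ℕ) {a : InstSym} (ha : IsSep a) {y : List InstSym}
    (hy : NoBadPair (a :: y)) : NoBadPair (encodeNatSym m ++ a :: y) := by
  induction m using Nat.strong_induction_on with
  | _ m ih =>
    cases hc : encodeNatSym m with
    | nil => exact hy
    | cons c l =>
      obtain ⟨k, b, hk, h0, rfl, rfl⟩ := encodeNatSym_eq_cons.1 hc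
      have hlt : k < m := by
        rcases h0 with h0 | rfl
        · omega
        · simp at hk
          omega
      rw [List.cons_append, noBadPair_cons]
      refine ⟨fun c v hv => ?_, ih k hlt⟩
      have hcb : c ∈ [InstSym.zero, InstSym.one] ∨ (IsSep c ∧ b = true) := by
        cases hd : encodeNatSym k with
        | nil =>
          rw [hd, List.nil_append, List.cons.injEq] at hv
          rw [encodeNatSym_eq_nil] at hd
          exact Or.inr ⟨hv.1 ▸ ha, by simpa [hd] using h0⟩
        | cons e l =>
          rw [hd, List.cons_append, List.cons.injEq] at hv
          exact Or.inl (isBits_encodeNatSym k c (by rw [hd, hv.1]; simp))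
      rcases hcb with hcb | ⟨rfl | rfl, rfl⟩
      · simp only [List.mem_cons, List.not_mem_nil, or_false] at hcb
        rcases hcb with rfl | rfl <;> cases b <;> rfl
      · rfl
      · rfl

theorem noBadPair_entriesWord_append (ws : List ℕ) {y : List InstSym}
    (hy : NoBadPair (.semicolon :: y)) : NoBadPair (entriesWord ws ++ .semicolon :: y) := by
  induction ws with
  | nil => exact hy
  | cons w ws ih =>
    obtain ⟨b, z, hb, hz⟩ := exists_entriesWord_append_eq_cons ws (Or.inr rfl) y
    have e : entriesWord (w :: ws) ++ .semicolon :: y = .comma :: (encodeNatSym w ++ b :: z) := by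
      rw [← hz]
      simp [entriesWord]
    rw [e, noBadPair_cons]
    refine ⟨fun c v hv => ?_, noBadPair_encodeNatSym_append w hb (by rwa [← hz])⟩
    cases hd : encodeNatSym w with
    | nil =>
      rw [hd, List.nil_append, List.cons.injEq] at hv
      rw [← hv.1]
      rcases hb with rfl | rfl <;> rfl
    | cons e l =>
      rw [hd, List.cons_append, List.cons.injEq] at hv
      have := isBits_encodeNatSym w c (by rw [hd, hv.1]; simp)
      simp only [List.mem_cons, List.not_mem_nil, or_false] at this
      rcases this with rfl | rfl <;> rfl

theorem noBadPair_rowsWord (rows : List (ℤ × List ℕ)) : NoBadPair (rowsWord rows) := by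
  induction rows with
  | nil => intro u a b v h; simp [rowsWord] at h
  | cons q rows ih =>
    obtain ⟨d, ws⟩ := q
    have hs : NoBadPair (.semicolon :: rowsWord rows) := noBadPair_cons.2 ⟨fun _ _ _ => rfl, ih⟩
    obtain ⟨b, z, hb, hz⟩ := exists_entriesWord_append_eq_cons ws (Or.inr rfl) (rowsWord rows)
    have e : rowsWord ((d, ws) :: rows) = encodeIntSym d ++ b :: z := by
      rw [← hz]
      simp [rowsWord, rowWord_eq]
    have h1 := noBadPair_encodeNatSym_append d.natAbs hb
      (by rw [← hz]; exact noBadPair_entriesWord_append ws hs)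
    rw [e, encodeIntSym]
    split_ifs with h0
    · rw [List.append_assoc, List.singleton_append, noBadPair_cons]
      refine ⟨fun c v hv => ?_, h1⟩
      cases hd : encodeNatSym d.natAbs with
      | nil =>
        rw [encodeNatSym_eq_nil] at hd
        omega
      | cons e l =>
        rw [hd, List.cons_append, List.cons.injEq] at hv
        have := isBits_encodeNatSym d.natAbs c (by rw [hd, hv.1]; simp)
        simp only [List.mem_cons, List.not_mem_nil, or_false] at this
        rcases this with rfl | rfl <;> rfl
    · exact h1

theorem eq_semicolon_of_rowsWord_eq {rows : List (ℤ × List ℕ)} {u : List InstSym} {a : InstSym}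
    (h : rowsWord rows = u ++ [a]) : a = .semicolon := by
  rcases List.eq_nil_or_concat rows with rfl | ⟨rows, q, rfl⟩
  · simp [rowsWord] at h
  · have e : rowsWord (rows.concat q) = (rowsWord rows ++ (encodeIntSym q.1 ++ entriesWord q.2)) ++
        [.semicolon] := by
      simp [rowsWord, rowWord_eq]
    rw [e] at h
    simpa using (List.append_inj' h rfl).2.symm

/-- Apart from the lengths of the rows, being well-formed is a local property: a `zero` needs a
digit after it, so numerals end in `one`; a sign needs a digit after it and can only stand at the
beginning of a row. -/
theorem exists_eq_rowsWord {x : List InstSym} (h : NoBadPair x)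
    (hx : ∀ u a, x = u ++ [a] → a = .semicolon) : ∃ rows, x = rowsWord rows := by
  -- A suffix may begin inside a row. It then starts with the rest of a numeral, possibly empty, or
  -- with a sign in front of a nonzero number, and the induction adds one symbol on the left.
  suffices H : x = [] ∨ ∃ (m : ℕ) (ws : List ℕ) (rows : List (ℤ × List ℕ)),
      x = encodeNatSym m ++ entriesWord ws ++ .semicolon :: rowsWord rows ∨
      0 < m ∧ x = .minus :: (encodeNatSym m ++ entriesWord ws ++ .semicolon :: rowsWord rows) by
    rcases H with rfl | ⟨m, ws, rows, rfl | ⟨hm, rfl⟩⟩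
    · exact ⟨[], rfl⟩
    · refine ⟨((m : ℤ), ws) :: rows, ?_⟩
      have : ¬ ((m : ℤ) < 0) := by omega
      simp [rowsWord, rowWord_eq, encodeIntSym, this]
    · refine ⟨(-(m : ℤ), ws) :: rows, ?_⟩
      have : (-(m : ℤ) < 0) := by omega
      rw [rowsWord_cons, rowWord_eq, encodeIntSym, if_pos this]
      simp
  induction x with
  | nil => exact Or.inl rfl
  | cons a x ih =>
    obtain ⟨h1, h2⟩ := noBadPair_cons.1 h
    refine Or.inr ?_
    rcases ih h2 fun u b hu => hx (a :: u) b (by rw [hu]; rfl) with rfl | ⟨m, ws, rows, hr⟩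
    · obtain rfl := hx [] a rfl
      exact ⟨0, [], [], Or.inl rfl⟩
    have hbit : (∀ b v, x = b :: v → b ∈ [InstSym.zero, InstSym.one]) → 0 < m ∧
        x = encodeNatSym m ++ entriesWord ws ++ .semicolon :: rowsWord rows := by
      intro hb
      rcases hr with hr | ⟨-, hr⟩
      · refine ⟨Nat.pos_of_ne_zero ?_, hr⟩
        rintro rfl
        obtain ⟨b, z, hs, hz⟩ := exists_entriesWord_append_eq_cons ws (Or.inr rfl) (rowsWord rows)
        rw [encodeNatSym_zero, List.nil_append, hz] at hr
        exact hs.notMem (hb b z hr)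
      · exact absurd (hb _ _ hr) (by simp)
    have hminus : (∀ b v, x = b :: v → b ≠ .minus) →
        x = encodeNatSym m ++ entriesWord ws ++ .semicolon :: rowsWord rows := by
      intro hb
      rcases hr with hr | ⟨-, hr⟩
      · exact hr
      · exact absurd rfl (hb _ _ hr)
    cases a with
    | zero =>
      obtain ⟨hm, hr⟩ := hbit fun b v hv => by
        have := h1 b v hv
        cases b <;> simp [okPair] at this ⊢
      refine ⟨2 * m, ws, rows, Or.inl ?_⟩
      have := encodeNatSym_bit m false (Or.inl hm.ne')
      simp only [Bool.toNat_false, add_zero, bitSym] at this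
      rw [this, hr]
      rfl
    | one =>
      have hr := hminus fun b v hv => by
        have := h1 b v hv
        cases b <;> simp [okPair] at this ⊢
      refine ⟨2 * m + 1, ws, rows, Or.inl ?_⟩
      have := encodeNatSym_bit m true (Or.inr rfl)
      simp only [Bool.toNat_true, bitSym] at this
      rw [this, hr]
      rfl
    | minus =>
      obtain ⟨hm, hr⟩ := hbit fun b v hv => by
        have := h1 b v hv
        cases b <;> simp [okPair] at this ⊢
      exact ⟨m, ws, rows, Or.inr ⟨hm, by rw [hr]⟩⟩
    | comma =>
      have hr := hminus fun b v hv => by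
        have := h1 b v hv
        cases b <;> simp [okPair] at this ⊢
      refine ⟨0, m :: ws, rows, Or.inl ?_⟩
      rw [hr]
      simp [encodeNatSym_zero, entriesWord]
    | semicolon =>
      rcases hr with hr | ⟨hm, hr⟩
      · refine ⟨0, [], ((m : ℤ), ws) :: rows, Or.inl ?_⟩
        have : ¬ ((m : ℤ) < 0) := by omega
        rw [hr]
        simp [encodeNatSym_zero, entriesWord, rowsWord, rowWord_eq, encodeIntSym, this]
      · refine ⟨0, [], (-(m : ℤ), ws) :: rows, Or.inl ?_⟩
        have : (-(m : ℤ) < 0) := by omega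
        rw [hr, rowsWord_cons, rowWord_eq, encodeIntSym, if_pos this]
        simp [encodeNatSym_zero, entriesWord]

/-- Numbers are written in binary within the word, so its length bounds the number of their digits.
-/
theorem lt_two_pow_of_mem_rowsWord {rows : List (ℤ × List ℕ)} {q : ℤ × List ℕ} (hq : q ∈ rows) :
    q.1.natAbs < 2 ^ (rowsWord rows).length ∧ ∀ w ∈ q.2, w < 2 ^ (rowsWord rows).length := by
  have h1 : (rowWord q.1 q.2).length ≤ (rowsWord rows).length := by
    rw [rowsWord, List.length_flatMap]
    exact List.single_le_sum (by simp) _ (List.mem_map_of_mem hq)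
  rw [rowWord_eq, List.length_append, List.length_append] at h1
  constructor
  · refine (lt_two_pow_length_encodeNatSym _).trans_le (Nat.pow_le_pow_right two_pos ?_)
    rw [encodeIntSym, List.length_append] at h1
    omega
  · intro w hw
    refine (lt_two_pow_length_encodeNatSym _).trans_le (Nat.pow_le_pow_right two_pos ?_)
    have h2 : (InstSym.comma :: encodeNatSym w).length ≤ (entriesWord q.2).length := by
      rw [entriesWord, List.length_flatMap]
      exact List.single_le_sum (by simp) _
        (List.mem_map_of_mem (f := fun k => (InstSym.comma :: encodeNatSym k).length) hw)
    rw [List.length_cons] at h2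
    omega

theorem length_le_length_rowsWord (rows : List (ℤ × List ℕ)) :
    rows.length ≤ (rowsWord rows).length := by
  induction rows with
  | nil => simp
  | cons q rows ih =>
    rw [rowsWord_cons, rowWord_eq]
    simp
    omega

/-! ### Recognising words that are not instances -/

namespace NumProgram

open RegularExpression NumInstr NumState

variable {Q : State → Prop} {Q' : ℕ → State → Prop} {B : ℕ} {s : State}

/-- All symbols. -/
def allSyms : List InstSym := [.zero, .one, .minus, .comma, .semicolon]

theorem mem_allSyms (a : InstSym) : a ∈ allSyms := by cases a <;> simp [allSyms]

/-- The sum of a list of programs. -/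
def sumList (l : List Program) : Program := l.foldr (· + ·) 0

theorem must_sumList {l : List Program} (h : ∀ P ∈ l, Must Step P s Q) :
    Must Step (sumList l) s Q := by
  induction l with
  | nil => exact must_zero.2 trivial
  | cons P l ih => exact must_add.2 ⟨h P (by simp), ih fun P' hP' => h P' (by simp [hP'])⟩

theorem can_sumList {l : List Program} {P : Program} (hP : P ∈ l) (h : Can (BddStep B) P s Q') :
    Can (BddStep B) (sumList l) s Q' := by
  induction l with
  | nil => simp at hP
  | cons P' l ih =>
    rcases List.mem_cons.1 hP with rfl | hP
    · exact can_add.2 (Or.inl h)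
    · exact can_add.2 (Or.inr (ih hP))

/-- Skip some symbols. -/
def skip : Program := RegularExpression.star (sumList (allSyms.map fun a => char (readSym a)))

theorem must_skip {i : List InstSym} (h : ∀ u v, i = u ++ v → Q (idle [] v)) :
    Must Step skip (idle [] i) Q := by
  refine (must_star (I := fun s => ∃ u v, i = u ++ v ∧ s = idle [] v) ?_ ⟨[], i, rfl, rfl⟩).mono ?_
  · rintro _ ⟨u, v, hi, rfl⟩
    refine must_sumList fun P hP => ?_
    obtain ⟨a, -, rfl⟩ := List.mem_map.1 hP
    refine must_readSym fun v' hv => ⟨u ++ [a], v', ?_, rfl⟩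
    replace hv : v = a :: v' := hv
    simp [hi, hv]
  · rintro _ ⟨u, v, hi, rfl⟩
    exact h u v hi

theorem bdd_idle {es : List Item} {i : List InstSym} : (idle es i).Bdd B :=
  bdd_st_zero Item.nil_bdd

theorem can_skip (u : List InstSym) {v : List InstSym} (h : Q' u.length (idle [] v)) :
    Can (BddStep B) skip (idle [] (u ++ v)) Q' := by
  induction u generalizing Q' with
  | nil => exact can_star_zero h
  | cons a u ih =>
    refine can_star_succ (can_sumList (List.mem_map_of_mem (mem_allSyms a)) (can_readSym (i := u ++ v)
      bdd_idle rfl fun _ => ih (Q' := fun m s => Q' (1 + m) s) ?_))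
    rwa [List.length_cons, add_comm] at h

/-- Find a pair of symbols that may not follow each other. -/
def findBadPair : Program :=
  skip * sumList (((allSyms ×ˢ allSyms).filter fun q => ¬ okPair q.1 q.2).map fun q =>
    char (readSym q.1) * char (readSym q.2))

theorem must_findBadPair {i : List InstSym} (h : ¬ NoBadPair i → ∀ s, Q s) :
    Must Step findBadPair (idle [] i) Q := by
  refine must_mul.2 (must_skip fun u v hi => must_sumList fun P hP => ?_)
  obtain ⟨⟨a, b⟩, hq, rfl⟩ := List.mem_map.1 hP
  refine must_mul.2 (must_readSym fun v₁ h1 => must_readSym fun v₂ h2 => h (fun hn => ?_) _)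
  have h1 : v = a :: v₁ := h1
  have h2 : v₁ = b :: v₂ := h2
  have := hn u a b v₂ (by rw [hi, h1, h2])
  simp [this] at hq

theorem can_findBadPair {i : List InstSym} (hi : ¬ NoBadPair i)
    (h : ∀ j ≤ i.length, ∀ s, Q' j s) : Can (BddStep B) findBadPair (idle [] i) Q' := by
  simp only [NoBadPair, not_forall] at hi
  obtain ⟨u, a, b, v, rfl, hab⟩ := hi
  refine can_mul.2 (can_skip u (can_sumList (List.mem_map.2 ⟨(a, b), ?_, rfl⟩) (can_mul.2
    (can_readSym (i := b :: v) bdd_idle rfl fun _ => can_readSym (i := v) bdd_idle rfl fun _ =>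
    h _ ?_ _))))
  · simp [List.mem_filter, List.mem_product, mem_allSyms, hab]
  · simp

/-- Find a last symbol that is not a semicolon. -/
def findBadEnd : Program :=
  skip * (sumList ((allSyms.filter fun a => a ≠ .semicolon).map fun a => char (readSym a)) *
    char isEnd)

theorem must_findBadEnd {i : List InstSym} (h : ∀ u a, i = u ++ [a] → a ≠ .semicolon → ∀ s, Q s) :
    Must Step findBadEnd (idle [] i) Q := by
  refine must_mul.2 (must_skip fun u v hi => must_mul.2 (must_sumList fun P hP => ?_))
  obtain ⟨a, ha, rfl⟩ := List.mem_map.1 hP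
  refine must_readSym fun v₁ h1 => must_isEnd.2 fun h2 => ?_
  have h1 : v = a :: v₁ := h1
  obtain rfl : v₁ = [] := h2
  exact h u a (by rw [hi, h1]) (by simpa using (List.mem_filter.1 ha).2) _

theorem can_findBadEnd {u : List InstSym} {a : InstSym} (ha : a ≠ .semicolon)
    (h : ∀ j ≤ (u ++ [a]).length + 1, ∀ s, Q' j s) :
    Can (BddStep B) findBadEnd (idle [] (u ++ [a])) Q' := by
  refine can_mul.2 (can_skip u (can_mul.2 (can_sumList (List.mem_map.2 ⟨a, ?_, rfl⟩)
    (can_readSym (i := []) bdd_idle rfl fun _ => can_isEnd bdd_idle rfl (h _ (by simp) _)))))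
  simp [List.mem_filter, mem_allSyms, ha]

/-- Find a row with too few or too many entries. -/
def findBadRow : Program :=
  RegularExpression.star row * (readInt * (RegularExpression.star entry *
    (char (readSym .comma) * char (isNil .left) + char (readSym .semicolon) * popItem .left)))

theorem must_findBadRow {i : List InstSym}
    (h : ¬ (∃ rows, IsTriangular rows ∧ i = rowsWord rows) → ∀ s, Q s) :
    Must Step findBadRow (idle [] i) Q := by
  refine must_mul.2 (must_star_row fun rows i₁ hi hw hl => must_mul.2 (must_readInt fun d i₂ h2 =>
    must_mul.2 (must_star_entry fun ws es₁ es₂ i₃ h3 he hl' => must_add.2 ⟨must_mul.2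
    (must_readSym fun i₄ h4 => must_isNil.2 fun h5 => ?_), must_mul.2
    (must_readSym fun i₄ h4 => must_popItem_left fun e es₃ h5 => ?_)⟩)))
  · refine h ?_ _
    rintro ⟨rows', ht, hr⟩
    replace h4 : i₃ = .comma :: i₄ := h4
    obtain rfl := flatMap_toList_eq_nil h5
    refine not_isTriangular_of_rowsWord_eq (r := rows.map fun R => (R.d, R.ws)) (d := d) (ws := ws)
      (a := .comma) (y := i₄) (r' := rows') ?_ (Or.inl ⟨rfl, ?_⟩) ht
    · rw [← hr, hi, h2, h3, h4, rowsWord, List.flatMap_map]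
      rfl
    · rw [List.length_map, ← hl, he, hl', List.append_nil]
  · refine h ?_ _
    rintro ⟨rows', ht, hr⟩
    replace h4 : i₃ = .semicolon :: i₄ := h4
    refine not_isTriangular_of_rowsWord_eq (r := rows.map fun R => (R.d, R.ws)) (d := d) (ws := ws)
      (a := .semicolon) (y := i₄) (r' := rows') ?_ (Or.inr ⟨rfl, ?_⟩) ht
    · rw [← hr, hi, h2, h3, h4, rowsWord, List.flatMap_map]
      rfl
    · rw [List.length_map, ← hl, he, hl', h5]
      simp

/-- The rows before the first bad one can be read by the ordinary program, which stores exactly one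
item for each of them. -/
theorem exists_first_bad_row {rows : List (ℤ × List ℕ)} (h : ¬ IsTriangular rows) :
    ∃ r q r', rows = r ++ q :: r' ∧ IsTriangular r ∧ q.2.length ≠ r.length := by
  induction rows using List.reverseRecOn with
  | nil => exact absurd rfl h
  | append_singleton rows q ih =>
    by_cases hr : IsTriangular rows
    · refine ⟨rows, q, [], rfl, hr, fun hq => h ?_⟩
      rw [IsTriangular] at hr ⊢
      simp [hr, hq, List.range_succ]
    · obtain ⟨r, q', r', rfl, h1, h2⟩ := ih hr
      exact ⟨r, q', r' ++ [q], by simp, h1, h2⟩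

/-- In the first bad row, entries are read while both entries and stored items remain. What is left
over reveals the error: an item at the semicolon, or a comma when no item remains. -/
theorem can_findBadRow {M : ℕ} {rows : List (ℤ × List ℕ)} (h0 : ¬ IsTriangular rows)
    (hrows : ∀ q ∈ rows, q.1.natAbs ≤ M ∧ ∀ w ∈ q.2, w ≤ M)
    (hB : M + (rows.length + 2) * (M * M) < 2 ^ B)
    (h : ∀ j ≤ (16 * B + 100) * (rows.length + 1) * (rows.length + 1), ∀ s, Q' j s) :
    Can (BddStep B) findBadRow (idle [] (rowsWord rows)) Q' := by
  obtain ⟨r, q, r', rfl, hr, hq⟩ := exists_first_bad_row h0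
  set K := (r ++ q :: r').length with hK
  have hK' : r.length + 1 ≤ K := by
    rw [hK]
    simp
  -- The parts `f` and `t` of the certificate play no role here and are taken to be zero.
  let R : List Row := r.map fun q => ⟨q.1, q.2, 0, 0⟩
  have hRr : R.length = r.length := by simp [R]
  have hRw : R.flatMap Row.word = rowsWord r := by
    rw [List.flatMap_map]
    rfl
  have e : rowsWord (r ++ q :: r') = R.flatMap Row.word ++ (encodeIntSym q.1 ++ (entriesWord q.2 ++
      .semicolon :: rowsWord r')) := by
    rw [hRw]
    simp [rowsWord, rowWord_eq]
  obtain ⟨hq1, hq2⟩ := hrows q (by simp)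
  rw [e]
  refine can_mul.2 ((can_star_row (M := M) (K := K) hB R ?_ [] ?_ ?_ (by simp)).mono ?_)
  · intro R' hR'
    obtain ⟨q', hq', rfl⟩ := List.mem_map.1 hR'
    obtain ⟨h1, h2⟩ := hrows q' (by simp [hq'])
    exact ⟨h1, h2, Nat.zero_le _, Nat.zero_le _⟩
  · rw [hRr, List.length_nil]
    omega
  · rw [List.length_nil, ← List.range_eq_range', hRr, ← hr]
    simp [R]
  rintro m _ ⟨hm, hlen, hle, rfl⟩
  rw [List.length_nil, zero_add, hRr] at hlen hle
  set es := R.foldl addRow []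
  have hM : M < 2 ^ B := lt_of_le_of_lt (Nat.le_add_right _ _) hB
  have hes : ∀ e ∈ es, e.Le M K := fun e he => (hle e he).mono (by omega)
  refine can_mul.2 (can_readInt bdd_idle (hq1.trans_lt hM) fun j₁ hj₁ _ => can_mul.2 ?_)
  have hx : (⟨0, 0, q.1.toNat, (-q.1).toNat, 0⟩ : Item).Le M 0 :=
    Row.init_le (R := ⟨q.1, [], 0, 0⟩) ⟨hq1, by simp, Nat.zero_le _, Nat.zero_le _⟩
  -- The six further instructions read the separator and pop an item.
  have hcost : ∀ l m' : ℕ, l ≤ r.length → m' ≤ (16 * B + 76) * l →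
      m + (j₁ + (m' + 6)) ≤ (16 * B + 100) * (K + 1) * (K + 1) := by
    intro l m' hl hm'
    have h1 : (16 * B + 76) * l ≤ (16 * B + 76) * K := Nat.mul_le_mul_left _ (by omega)
    have h2 : (16 * B + 100) * K * R.length ≤ (16 * B + 100) * K * K :=
      Nat.mul_le_mul_left _ (by omega)
    have h3 : (16 * B + 76) * K ≤ (16 * B + 100) * K := Nat.mul_le_mul_right _ (by omega)
    have h4 : (16 * B + 100) * (K + 1) * (K + 1) = (16 * B + 100) * K * K +
      2 * ((16 * B + 100) * K) + (16 * B + 100) := by ring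
    omega
  rcases lt_or_gt_of_ne hq with hlt | hlt
  · have hl1 : (es.take q.2.length).length = q.2.length := by
      rw [List.length_take, hlen]
      omega
    obtain ⟨e₀, es', hes'⟩ : ∃ e₀ es', es.drop q.2.length = e₀ :: es' := by
      cases hd : es.drop q.2.length with
      | nil =>
        have := congrArg List.length hd
        rw [List.length_drop, hlen, List.length_nil] at this
        omega
      | cons e₀ es' => exact ⟨e₀, es', rfl⟩
    have he₀ : e₀ ∈ es := List.mem_of_mem_drop (hes' ▸ List.mem_cons_self)
    have hse := can_star_entry (k := 0) (l := e₀.toList ++ es'.flatMap Item.toList) (r := [])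
      (i := .semicolon :: rowsWord r') hB q.2 (es.take q.2.length) hl1.symm hx (by omega)
      (fun e he => hes e (List.mem_of_mem_take he)) hq2
    rw [← List.flatMap_cons, ← hes', ← List.flatMap_append, List.take_append_drop] at hse
    refine hse.mono ?_
    rintro m' _ ⟨hm', rfl⟩
    have hb : ∀ l r i, (st ((⟨0, 0, q.1.toNat, (-q.1).toNat, 0⟩ : Item).joinAll
        (es.take q.2.length) q.2) .nil 0 0 0 l r i).Bdd B := fun l r i =>
      bdd_st_zero ((Item.joinAll_le q.2 _ hx (fun e he =>
        (hes e (List.mem_of_mem_take he)).1) hq2 hl1.symm).bdd (by omega) hB)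
    rw [hes', List.flatMap_cons]
    exact can_add.2 (Or.inr (can_mul.2 (can_readSym (i := rowsWord r') (hb _ _ _) rfl fun _ =>
      can_popItem_left ((hes e₀ he₀).bdd le_rfl hB) (hb _ _ _) fun _ =>
      h _ (hcost _ _ hlt.le hm') _)))
  · have hl1 : (q.2.take r.length).length = es.length := by
      rw [List.length_take, hlen]
      omega
    obtain ⟨w, ws, hws⟩ : ∃ w ws, q.2.drop r.length = w :: ws := by
      cases hd : q.2.drop r.length with
      | nil =>
        have := congrArg List.length hd
        rw [List.length_drop, List.length_nil] at this
        omega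
      | cons w ws => exact ⟨w, ws, rfl⟩
    have hq3 : ∀ w ∈ q.2.take r.length, w ≤ M := fun w hw => hq2 w (List.mem_of_mem_take hw)
    have hse := can_star_entry (k := 0) (l := []) (r := [])
      (i := entriesWord (w :: ws) ++ .semicolon :: rowsWord r') hB (q.2.take r.length) es hl1 hx
      (by omega) hes hq3
    rw [← hws, ← List.append_assoc, ← entriesWord, entriesWord, entriesWord, ← List.flatMap_append,
      List.take_append_drop, List.append_nil, ← entriesWord] at hse
    refine hse.mono ?_
    rintro m' _ ⟨hm', rfl⟩
    have hb : ∀ l r' i, (st ((⟨0, 0, q.1.toNat, (-q.1).toNat, 0⟩ : Item).joinAll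
        es (q.2.take r.length)) .nil 0 0 0 l r' i).Bdd B := fun l r' i =>
      bdd_st_zero ((Item.joinAll_le _ _ hx (fun e he => (hes e he).1) hq3 hl1).bdd (by omega) hB)
    rw [hws]
    have := hcost _ _ (hl1.trans hlen).le hm'
    exact can_add.2 (Or.inl (can_mul.2 (can_readSym (i := encodeNatSym w ++ (entriesWord ws ++
      .semicolon :: rowsWord r')) (hb _ _ _) (by simp [inp_st, entriesWord]) fun _ =>
      can_isNil (hb _ _ _) rfl (h _ (by omega) _))))

/-- The digit bound required for reading, for entries below `2 ^ m`: every term on the left is at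
most a small multiple of `2 ^ (3 * m)`. -/
theorem lt_two_pow_of_le {n m B : ℕ} (hn : n ≤ m) (hB : 3 * m + 3 ≤ B) :
    2 ^ m + (n + 2) * (2 ^ m * 2 ^ m) < 2 ^ B := by
  have h1 : m < 2 ^ m := Nat.lt_two_pow_self
  have h2 : 0 < 2 ^ m := by positivity
  refine lt_of_lt_of_le ?_ (Nat.pow_le_pow_right two_pos hB)
  have h3 : (n + 2) * (2 ^ m * 2 ^ m) ≤ (2 ^ m + 2) * (2 ^ m * 2 ^ m) :=
    Nat.mul_le_mul_right _ (by omega)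
  have h4 : 2 ^ m * 1 ≤ 2 ^ m * 2 ^ m := Nat.mul_le_mul_left _ h2
  have h5 : (2 ^ m * 2 ^ m) * 1 ≤ (2 ^ m * 2 ^ m) * 2 ^ m := Nat.mul_le_mul_left _ h2
  have h6 : 2 ^ (3 * m + 3) = 8 * (2 ^ m * 2 ^ m * 2 ^ m) := by ring
  rw [h6]
  have h7 : (2 ^ m + 2) * (2 ^ m * 2 ^ m) = 2 ^ m * 2 ^ m * 2 ^ m + 2 * (2 ^ m * 2 ^ m) := by ring
  omega

/-- Find out that the input does not describe an instance. -/
def findError : Program := findBadPair + findBadEnd + findBadRow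

theorem must_findError {i : List InstSym}
    (h : ¬ (∃ rows, IsTriangular rows ∧ i = rowsWord rows) → ∀ s, Q s) :
    Must Step findError (.init i) Q := by
  rw [init_eq_idle]
  refine must_add.2 ⟨must_add.2 ⟨must_findBadPair fun hn => h ?_, must_findBadEnd fun u a hi ha =>
    h ?_⟩, must_findBadRow h⟩
  · rintro ⟨rows, -, rfl⟩
    exact hn (noBadPair_rowsWord rows)
  · rintro ⟨rows, -, rfl⟩
    exact ha (eq_semicolon_of_rowsWord_eq hi)

theorem can_findError {i : List InstSym} (hi : ¬ (∃ rows, IsTriangular rows ∧ i = rowsWord rows))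
    (hB : 3 * i.length + 3 ≤ B)
    (h : ∀ j ≤ (16 * B + 100) * (i.length + 1) * (i.length + 1), ∀ s, Q' j s) :
    Can (BddStep B) findError (.init i) Q' := by
  rw [init_eq_idle]
  have hc : i.length + 1 ≤ (16 * B + 100) * (i.length + 1) * (i.length + 1) := by
    nlinarith [Nat.zero_le (16 * B), Nat.zero_le i.length, Nat.zero_le (16 * B * (i.length + 1))]
  by_cases h1 : NoBadPair i
  swap
  · exact can_add.2 (Or.inl (can_add.2 (Or.inl (can_findBadPair h1 fun j hj => h j (by omega)))))
  by_cases h2 : ∀ u a, i = u ++ [a] → a = .semicolon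
  swap
  · simp only [not_forall] at h2
    obtain ⟨u, a, rfl, ha⟩ := h2
    exact can_add.2 (Or.inl (can_add.2 (Or.inr (can_findBadEnd ha fun j hj => h j (by omega)))))
  obtain ⟨rows, rfl⟩ := exists_eq_rowsWord h1 h2
  have hr := length_le_length_rowsWord rows
  refine can_add.2 (Or.inr (can_findBadRow (M := 2 ^ (rowsWord rows).length)
    (fun ht => hi ⟨rows, ht, rfl⟩) (fun q hq => ?_) ?_ fun j hj => h j (hj.trans ?_)))
  · obtain ⟨h3, h4⟩ := lt_two_pow_of_mem_rowsWord hq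
    exact ⟨h3.le, fun w hw => (h4 w hw).le⟩
  · exact lt_two_pow_of_le (hr.trans le_rfl) hB
  · exact Nat.mul_le_mul (Nat.mul_le_mul_left _ (by omega)) (by omega)

end NumProgram

/-! ### Chip firing -/

namespace Multigraph

variable {V : Type} [Fintype V] [DecidableEq V] (G : Multigraph V)

/-- The Laplacian of a multigraph. -/
def lap (f : V → ℤ) (v : V) : ℤ := ∑ u, (G.mult v u : ℤ) * (f v - f u)

theorem lap_add (f g : V → ℤ) : G.lap (f + g) = G.lap f + G.lap g := by
  funext v
  simp only [lap, Pi.add_apply, ← Finset.sum_add_distrib]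
  exact Finset.sum_congr rfl fun u _ => by ring

theorem lap_add_const (f : V → ℤ) (k : ℤ) : G.lap (fun v => f v + k) = G.lap f := by
  funext v
  simp [lap]

theorem lap_zero : G.lap 0 = 0 := by
  funext v
  simp [lap]

theorem lap_single (v u : V) (k : ℤ) :
    G.lap (Pi.single v k) u = if u = v then k * ∑ x, (G.mult v x : ℤ) else -(k * G.mult v u) := by
  rw [lap]
  split_ifs with h
  · subst h
    rw [Finset.mul_sum]
    refine Finset.sum_congr rfl fun x _ => ?_
    by_cases hx : x = u
    · subst hx
      simp [G.mult_self]
    · simp [hx, mul_comm]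
  · rw [Finset.sum_eq_single v]
    · simp [h, G.mult_symm v u, mul_comm]
    · intro x _ hx
      simp [h, hx]
    · simp

theorem lend_eq (v : V) (D : V → ℤ) : G.lend v D = D - G.lap (Pi.single v 1) := by
  funext u
  simp only [lend, Pi.sub_apply, lap_single]
  split_ifs with h
  · subst h
    ring
  · ring

theorem borrow_eq (v : V) (D : V → ℤ) : G.borrow v D = D - G.lap (Pi.single v (-1)) := by
  funext u
  simp only [borrow, Pi.sub_apply, lap_single]
  split_ifs with h
  · subst h
    ring
  · ring

theorem equivalent_sub_lap_single (v : V) (k : ℤ) (D : V → ℤ) :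
    G.Equivalent D (D - G.lap (Pi.single v k)) := by
  induction k using Int.induction_on with
  | zero =>
    rw [Pi.single_zero, lap_zero, sub_zero]
    exact Relation.ReflTransGen.refl
  | succ k ih =>
    refine ih.tail ⟨v, Or.inl ?_⟩
    rw [lend_eq, Pi.single_add, lap_add]
    abel
  | pred k ih =>
    refine ih.tail ⟨v, Or.inr ?_⟩
    rw [borrow_eq, sub_eq_add_neg (-(k : ℤ)), Pi.single_add, lap_add]
    abel

/-- Each move subtracts a fixed vector, so the order of the moves is irrelevant and only the net
number of lendings of each vertex counts. -/
theorem equivalent_iff {D D' : V → ℤ} : G.Equivalent D D' ↔ ∃ f, D' = D - G.lap f := by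
  constructor
  · intro h
    induction h with
    | refl => exact ⟨0, by rw [lap_zero, sub_zero]⟩
    | tail _ h ih =>
      obtain ⟨f, rfl⟩ := ih
      obtain ⟨v, rfl | rfl⟩ := h
      · exact ⟨f + Pi.single v 1, by rw [lend_eq, lap_add]; abel⟩
      · exact ⟨f + Pi.single v (-1), by rw [borrow_eq, lap_add]; abel⟩
  · rintro ⟨f, rfl⟩
    have h : ∀ s : Finset V, G.Equivalent D (D - G.lap (∑ v ∈ s, Pi.single v (f v))) := by
      intro s
      induction s using Finset.induction_on with
      | empty =>
        rw [Finset.sum_empty, lap_zero, sub_zero]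
        exact Relation.ReflTransGen.refl
      | insert v s hv ih =>
        rw [Finset.sum_insert hv, add_comm, lap_add, ← sub_sub]
        exact Relation.ReflTransGen.trans ih (G.equivalent_sub_lap_single v (f v) _)
    have := h Finset.univ
    rwa [Finset.univ_sum_single] at this

theorem equivToEffective_iff {D : V → ℤ} :
    G.EquivToEffective D ↔ ∃ f, ∀ v, 0 ≤ D v - G.lap f v := by
  constructor
  · rintro ⟨D', h, hD'⟩
    obtain ⟨f, rfl⟩ := G.equivalent_iff.1 h
    exact ⟨f, hD'⟩
  · rintro ⟨f, hf⟩
    exact ⟨_, G.equivalent_iff.2 ⟨f, rfl⟩, hf⟩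

/-- The minimum in the rank is zero exactly if removing no chips already leaves a divisor without
effective equivalent. -/
theorem rank_nonneg_iff [Nonempty V] {D : V → ℤ} : 0 ≤ G.rank D ↔ G.EquivToEffective D := by
  have h0 : 0 ∈ G.removalNumbers D ↔ ¬ G.EquivToEffective D := by
    constructor
    · rintro ⟨E, hE, h⟩
      rw [Finset.sum_eq_zero_iff] at hE
      simpa [hE] using h
    · exact fun h => ⟨0, by simp, by simpa using h⟩
  have h1 := Nat.sInf_mem (G.removalNumbers_nonempty D)
  rw [rank]
  constructor
  · intro h
    by_contra hD
    have := Nat.sInf_le (h0.2 hD)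
    omega
  · intro h
    have : sInf (G.removalNumbers D) ≠ 0 := fun h2 => h0.1 (h2 ▸ h1) h
    omega

/-! ### Bounds for firing scripts -/

/-- Let `A` be the set where `f` is at least `f u`. Summed over `A`, the Laplacian is the flux of
`f` across the boundary of `A`; all its terms are nonnegative, and the edge from `u` to `v` alone
contributes at least `f u - f v`. -/
theorem sub_le_sum_abs_lap {u v : V} (huv : 0 < G.mult u v) (f : V → ℤ) :
    f u - f v ≤ ∑ x, |G.lap f x| := by
  rcases le_or_gt (f u) (f v) with h | h
  · exact (sub_nonpos.2 h).trans (Finset.sum_nonneg fun x _ => abs_nonneg _)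
  set A : Finset V := Finset.univ.filter fun x => f u ≤ f x with hA
  have hu : u ∈ A := by simp [hA]
  have hv : v ∈ Aᶜ := by simp [hA, h]
  -- The flux inside `A` cancels by antisymmetry.
  have h0 : ∑ x ∈ A, ∑ y ∈ A, (G.mult x y : ℤ) * (f x - f y) = 0 := by
    have h1 : ∑ x ∈ A, ∑ y ∈ A, (G.mult x y : ℤ) * (f x - f y) =
        -∑ x ∈ A, ∑ y ∈ A, (G.mult x y : ℤ) * (f x - f y) := by
      conv_lhs => rw [Finset.sum_comm]
      simp only [← Finset.sum_neg_distrib]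
      refine Finset.sum_congr rfl fun x _ => Finset.sum_congr rfl fun y _ => ?_
      rw [G.mult_symm y x]
      ring
    linarith
  have hpos : ∀ x ∈ A, ∀ y ∈ Aᶜ, 0 ≤ (G.mult x y : ℤ) * (f x - f y) := by
    intro x hx y hy
    simp only [hA, Finset.compl_filter, Finset.mem_filter, Finset.mem_univ, true_and, not_le] at hx hy
    exact mul_nonneg (Int.natCast_nonneg _) (by linarith)
  have h2 : ∑ x ∈ A, G.lap f x = ∑ x ∈ A, ∑ y ∈ Aᶜ, (G.mult x y : ℤ) * (f x - f y) := by
    simp only [lap]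
    rw [← zero_add (∑ x ∈ A, ∑ y ∈ Aᶜ, _), ← h0, ← Finset.sum_add_distrib]
    exact Finset.sum_congr rfl fun x _ => (Finset.sum_add_sum_compl A _).symm
  calc f u - f v ≤ (G.mult u v : ℤ) * (f u - f v) :=
        le_mul_of_one_le_left (by linarith) (by exact_mod_cast huv)
    _ ≤ ∑ y ∈ Aᶜ, (G.mult u y : ℤ) * (f u - f y) :=
        Finset.single_le_sum (f := fun y => (G.mult u y : ℤ) * (f u - f y)) (hpos u hu) hv
    _ ≤ ∑ x ∈ A, ∑ y ∈ Aᶜ, (G.mult x y : ℤ) * (f x - f y) :=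
        Finset.single_le_sum (f := fun x => ∑ y ∈ Aᶜ, (G.mult x y : ℤ) * (f x - f y))
          (fun x hx => Finset.sum_nonneg (hpos x hx)) hu
    _ = ∑ x ∈ A, G.lap f x := h2.symm
    _ ≤ ∑ x ∈ A, |G.lap f x| := Finset.sum_le_sum fun x _ => le_abs_self _
    _ ≤ ∑ x, |G.lap f x| :=
        Finset.sum_le_sum_of_subset_of_nonneg (Finset.subset_univ _) fun x _ _ => abs_nonneg _

variable {G}

/-- The estimate for one edge is added up along a path, which has fewer edges than there are
vertices. -/
theorem Connected.sub_le (hG : G.Connected) (f : V → ℤ) (u v : V) :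
    f u - f v ≤ Fintype.card V * ∑ x, |G.lap f x| := by
  have h : ∀ {u v : V} (p : G.toSimpleGraph.Walk u v),
      f u - f v ≤ p.length * ∑ x, |G.lap f x| := by
    intro u v p
    induction p with
    | nil => simp
    | cons h p ih =>
      have := G.sub_le_sum_abs_lap h f
      rw [SimpleGraph.Walk.length_cons]
      push_cast
      linarith
  obtain ⟨p, hp⟩ := hG.exists_isPath u v
  refine (h p).trans (mul_le_mul_of_nonneg_right ?_ (Finset.sum_nonneg fun x _ => abs_nonneg _))
  exact_mod_cast hp.length_lt.le

theorem sum_sub_lap (D f : V → ℤ) : ∑ v, (D v - G.lap f v) = ∑ v, D v :=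
  (G.equivalent_iff.2 ⟨f, rfl⟩ : G.Equivalent D (D - G.lap f)).sum_eq

/-- A total debt of at most that of `D` bounds the Laplacian of a firing script. -/
theorem sum_abs_lap_le {D f : V → ℤ}
    (h : ∑ v, (-(D v - G.lap f v)).toNat ≤ ∑ v, (-D v).toNat) :
    ∑ v, |G.lap f v| ≤ 4 * ∑ v, |D v| := by
  -- For `E = D - G.lap f` the triangle inequality gives `|D| + |E|`, and `|E|` is `E` plus twice
  -- the debt. As `E` and `D` have the same sum, the total is at most `∑ |D|` taken `1 + 1 + 2`
  -- times.
  have h1 : ∀ v, |G.lap f v| ≤ |D v| + (D v - G.lap f v) + 2 * ((-(D v - G.lap f v)).toNat : ℤ) := by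
    intro v
    rcases abs_cases (D v) with h | h <;> rcases abs_cases (G.lap f v) with h' | h' <;> omega
  have h2 : ∀ v, ((-D v).toNat : ℤ) ≤ |D v| := by
    intro v
    rcases abs_cases (D v) with h | h <;> omega
  have h3 : (∑ v, (-(D v - G.lap f v)).toNat : ℤ) ≤ ∑ v, ((-D v).toNat : ℤ) := by
    exact_mod_cast h
  have h4 := Finset.sum_le_sum fun v (_ : v ∈ Finset.univ) => h1 v
  rw [Finset.sum_add_distrib, Finset.sum_add_distrib, sum_sub_lap, ← Finset.mul_sum] at h4
  have h5 := Finset.sum_le_sum fun v (_ : v ∈ Finset.univ) => h2 v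
  have h6 := Finset.sum_le_sum fun v (_ : v ∈ Finset.univ) => le_abs_self (D v)
  linarith

/-- A bound for the entries of firing scripts. -/
def bound (D : V → ℤ) : ℤ := Fintype.card V * (4 * ∑ v, |D v|)

theorem Connected.sub_le_bound (hG : G.Connected) {D f : V → ℤ}
    (h : ∑ v, (-(D v - G.lap f v)).toNat ≤ ∑ v, (-D v).toNat) (u v : V) :
    f u - f v ≤ bound D :=
  (hG.sub_le f u v).trans (mul_le_mul_of_nonneg_left (sum_abs_lap_le h) (Int.natCast_nonneg _))

/-- Adding a constant does not change the Laplacian. The shift by `bound D - f q` brings all values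
between `0` and `2 * bound D`. -/
theorem Connected.exists_nat_script (hG : G.Connected) {D f : V → ℤ}
    (h : ∑ v, (-(D v - G.lap f v)).toNat ≤ ∑ v, (-D v).toNat) :
    ∃ g : V → ℕ, (∀ v, (g v : ℤ) ≤ 2 * bound D) ∧ G.lap (fun v => g v) = G.lap f := by
  obtain ⟨q⟩ := hG.nonempty
  have h1 : ∀ v, 0 ≤ f v + (bound D - f q) := fun v => by linarith [hG.sub_le_bound h q v]
  have h2 : ∀ v, f v + (bound D - f q) ≤ 2 * bound D := fun v => by
    linarith [hG.sub_le_bound h v q]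
  refine ⟨fun v => (f v + (bound D - f q)).toNat, fun v => ?_, ?_⟩
  · rw [Int.toNat_of_nonneg (h1 v)]
    exact h2 v
  · rw [← G.lap_add_const f (bound D - f q)]
    congr 1
    funext v
    exact Int.toNat_of_nonneg (h1 v)

theorem Connected.exists_script_of_equivToEffective (hG : G.Connected) {D : V → ℤ}
    (h : G.EquivToEffective D) :
    ∃ g : V → ℕ, (∀ v, (g v : ℤ) ≤ 2 * bound D) ∧ ∀ v, 0 ≤ D v - G.lap (fun v => g v) v := by
  obtain ⟨f, hf⟩ := G.equivToEffective_iff.1 h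
  obtain ⟨g, h1, h2⟩ := hG.exists_nat_script (D := D) (f := f) (by
    rw [Finset.sum_eq_zero fun v _ => by have := hf v; omega]
    exact Nat.zero_le _)
  exact ⟨g, h1, fun v => by rw [h2]; exact hf v⟩

/-! ### Divisors that are not equivalent to an effective one -/

/-- If every set of vertices that does not contain `q` has a vertex that cannot afford to lend to
the outside of the set, then fire spreads from `q` to the whole graph. -/
theorem exists_burning {E : V → ℤ} {q : V}
    (h : ∀ U : Finset V, U.Nonempty → q ∉ U → ∃ v ∈ U, E v < ∑ u ∈ Uᶜ, (G.mult v u : ℤ))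
    (U : Finset V) (hU : q ∉ U) :
    ∃ t : V → ℕ, (∀ v ∈ U, 0 < t v ∧ t v ≤ U.card) ∧ (∀ v ∉ U, t v = 0) ∧
      ∀ v ∈ U, E v < ∑ u, if t u < t v then (G.mult v u : ℤ) else 0 := by
  induction hc : U.card generalizing U with
  | zero =>
    rw [Finset.card_eq_zero] at hc
    subst hc
    exact ⟨0, by simp, by simp, by simp⟩
  | succ k ih =>
    -- This `v` burns first: its chips do not cover its edges to the outside of `U`, which is
    -- already on fire.
    obtain ⟨v, hv, hE⟩ := h U (Finset.card_pos.1 (by omega)) hU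
    obtain ⟨t, h1, h2, h3⟩ := ih (U.erase v) (fun hq => hU (Finset.mem_of_mem_erase hq))
      (by rw [Finset.card_erase_of_mem hv, hc]; rfl)
    have ht : ∀ u, (if u ∈ U then t u + 1 else 0) = if u = v then 1 else
        if u ∈ U then t u + 1 else 0 := by
      intro u
      split_ifs with h4 h5 h5
      · subst h5
        rw [h2 u (Finset.notMem_erase u U)]
      · rfl
      · exact absurd (h5 ▸ hv) h4
      · rfl
    -- The labels of the remaining process vanish at `v` and outside `U`. Raising them by one on `U`
    -- gives `v` the label `1`, below all later vertices and above the outside.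
    refine ⟨fun u => if u ∈ U then t u + 1 else 0, fun u hu => ?_, fun u hu => by simp [hu],
      fun w hw => ?_⟩
    · simp only [hu, if_true, Nat.succ_pos, true_and]
      by_cases huv : u = v
      · subst huv
        rw [h2 u (Finset.notMem_erase u U)]
        omega
      · have := (h1 u (Finset.mem_erase.2 ⟨huv, hu⟩)).2
        omega
    · simp only [hw, if_true]
      have hnn : ∀ u, 0 ≤ (G.mult w u : ℤ) := fun u => Int.natCast_nonneg _
      by_cases hwv : w = v
      · subst hwv
        refine hE.trans_le ?_
        rw [← Finset.sum_filter]
        refine Finset.sum_le_sum_of_subset_of_nonneg (fun u hu => ?_) fun u _ _ => hnn u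
        simp only [Finset.mem_compl] at hu
        simp [hu]
      · refine (h3 w (Finset.mem_erase.2 ⟨hwv, hw⟩)).trans_le (Finset.sum_le_sum fun u _ => ?_)
        by_cases hu : u ∈ U
        · simp [hu]
        · simp only [hu, if_false, h2 u (fun h => hu (Finset.mem_of_mem_erase h)), Nat.succ_pos,
            if_true]
          split_ifs
          exacts [le_rfl, hnn u]

theorem lap_indicator (U : Finset V) (v : V) :
    G.lap (fun u => if u ∈ U then 1 else 0) v =
      if v ∈ U then ∑ u ∈ Uᶜ, (G.mult v u : ℤ) else -∑ u ∈ U, (G.mult v u : ℤ) := by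
  rw [lap, ← Finset.sum_add_sum_compl U]
  split_ifs with hv
  · rw [Finset.sum_eq_zero fun u hu => by simp [hu], zero_add]
    refine Finset.sum_congr rfl fun u hu => ?_
    simp [Finset.mem_compl.1 hu]
  · rw [Finset.sum_eq_zero (s := Uᶜ) fun u hu => by simp [Finset.mem_compl.1 hu], add_zero,
      ← Finset.sum_neg_distrib]
    refine Finset.sum_congr rfl fun u hu => ?_
    simp [hu]

/-- Two extremal choices replace an algorithm: least total debt, which bounds the script, and then
the largest sum, which makes sure that no further set can lend without harm. -/
theorem Connected.exists_script_of_not_equivToEffective (hG : G.Connected) {D : V → ℤ}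
    (h : ¬ G.EquivToEffective D) :
    ∃ g t : V → ℕ, (∀ v, (g v : ℤ) ≤ 2 * bound D) ∧ (∀ v, t v ≤ Fintype.card V) ∧
      ∀ v, D v - G.lap (fun v => g v) v < ∑ u, if t u < t v then (G.mult v u : ℤ) else 0 := by
  let debt : (V → ℤ) → ℕ := fun f => ∑ v, (-(D v - G.lap f v)).toNat
  let f₀ := Function.argmin debt
  have hmin : ∀ f, debt f₀ ≤ debt f := fun f => Function.argmin_le debt f
  have hle : ∀ f, debt f = debt f₀ →
      ∑ v, (-(D v - G.lap f v)).toNat ≤ ∑ v, (-D v).toNat := by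
    intro f hf
    have := hmin 0
    rw [← hf] at this
    simpa [debt, lap_zero] using this
  obtain ⟨q, hq⟩ : ∃ q, D q - G.lap f₀ q < 0 := by
    by_contra! hn
    exact h (G.equivToEffective_iff.2 ⟨f₀, hn⟩)
  -- The sums of the scripts of minimal debt that vanish at `q` and leave `q` in debt. They are
  -- bounded above since every entry differs from `f q = 0` by at most `bound D`; a shift of `f₀` is
  -- one such script.
  let S : ℤ → Prop := fun z => ∃ f : V → ℤ, f q = 0 ∧ debt f = debt f₀ ∧ D q - G.lap f q < 0 ∧
    ∑ v, f v = z
  obtain ⟨z, ⟨f, hf0, hf, hfq, hz⟩, hmax⟩ := Int.exists_greatest_of_bdd (P := S)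
    ⟨Fintype.card V * bound D, by
      rintro _ ⟨f, hf0, hf, -, rfl⟩
      refine (Finset.sum_le_card_nsmul Finset.univ f (bound D) fun v _ => ?_).trans_eq
        (by rw [nsmul_eq_mul, Finset.card_univ])
      have := hG.sub_le_bound (hle f hf) v q
      rwa [hf0, sub_zero] at this⟩
    ⟨_, fun v => f₀ v + -f₀ q, by simp, by simp only [debt, lap_add_const], by
      rwa [lap_add_const], rfl⟩
  -- Otherwise all of `U` could lend once without getting into debt, and the other vertices only
  -- gain. The debt would not increase and so stays minimal, while the sum of the script grows by
  -- the size of `U`.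
  have hburn : ∀ U : Finset V, U.Nonempty → q ∉ U →
      ∃ v ∈ U, D v - G.lap f v < ∑ u ∈ Uᶜ, (G.mult v u : ℤ) := by
    intro U hU hqU
    by_contra! hn
    let i : V → ℤ := fun u => if u ∈ U then 1 else 0
    have hnn : ∀ v : V, ∀ s : Finset V, 0 ≤ ∑ u ∈ s, (G.mult v u : ℤ) := fun v s =>
      Finset.sum_nonneg fun u _ => Int.natCast_nonneg _
    have hv : ∀ v, (-(D v - G.lap (f + i) v)).toNat ≤ (-(D v - G.lap f v)).toNat := by
      intro v
      rw [lap_add, Pi.add_apply, lap_indicator]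
      have h1 := hnn v U
      split_ifs with hvU
      · have := hn v hvU
        omega
      · omega
    have hd : debt (f + i) = debt f₀ :=
      le_antisymm ((Finset.sum_le_sum fun v _ => hv v).trans hf.le) (hmin _)
    -- Debts that are termwise at most the old ones and have the same sum are equal; in particular
    -- `q` remains in debt.
    have hq' : (-(D q - G.lap (f + i) q)).toNat = (-(D q - G.lap f q)).toNat :=
      (Finset.sum_eq_sum_iff_of_le fun v _ => hv v).1 (hd.trans hf.symm) q (Finset.mem_univ q)
    have := hmax (∑ v, (f + i) v) ⟨f + i, by simp [i, hf0, hqU], hd, by omega, rfl⟩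
    rw [← hz] at this
    simp only [Pi.add_apply, Finset.sum_add_distrib, i, Finset.sum_ite_mem, Finset.univ_inter,
      Finset.sum_const, nsmul_eq_mul, mul_one] at this
    have := Finset.card_pos.2 hU
    omega
  obtain ⟨t, h1, h2, h3⟩ := exists_burning hburn (Finset.univ.erase q) (Finset.notMem_erase q _)
  obtain ⟨g, hg1, hg2⟩ := hG.exists_nat_script (hle f hf)
  refine ⟨g, t, hg1, fun v => ?_, fun v => ?_⟩
  · by_cases hv : v = q
    · rw [h2 v (by simp [hv])]
      exact Nat.zero_le _
    · exact (h1 v (by simp [hv])).2.trans (Finset.card_le_univ _)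
  · rw [hg2]
    -- The vertex `q` has label zero, hence an empty sum on the right; there the inequality says
    -- that `q` is in debt.
    by_cases hv : v = q
    · subst hv
      refine hfq.trans_le (Finset.sum_nonneg fun u _ => ?_)
      split_ifs
      exacts [Int.natCast_nonneg _, le_rfl]
    · exact h3 v (by simp [hv])

/-- Maximum principle for the difference `k` of the two scripts: among its maximisers, the vertex
`v` of least label loses at least one chip along each edge to a smaller label, more than `D v -
G.lap f v` in total. -/
theorem not_equivToEffective_of_script [Nonempty V] {D f : V → ℤ} {t : V → ℕ}
    (h : ∀ v, D v - G.lap f v < ∑ u, if t u < t v then (G.mult v u : ℤ) else 0) :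
    ¬ G.EquivToEffective D := by
  rw [equivToEffective_iff]
  rintro ⟨g, hg⟩
  let k := g - f
  have hk : ∀ v, G.lap g v = G.lap f v + G.lap k v := by
    intro v
    rw [← Pi.add_apply, ← lap_add]
    simp [k]
  obtain ⟨w, -, hw⟩ := Finset.exists_max_image Finset.univ k Finset.univ_nonempty
  obtain ⟨v, hv, hmin⟩ := Finset.exists_min_image (Finset.univ.filter fun v => k v = k w) t
    ⟨w, by simp⟩
  simp only [Finset.mem_filter, Finset.mem_univ, true_and] at hv hmin
  have h1 : (∑ u, if t u < t v then (G.mult v u : ℤ) else 0) ≤ G.lap k v := by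
    refine Finset.sum_le_sum fun u _ => ?_
    have h2 := hw u (Finset.mem_univ u)
    split_ifs with h3
    -- A vertex of smaller label is not a maximiser, and for integers this means a drop of at least
    -- one.
    · have h4 : k u ≠ k w := fun h4 => absurd (hmin u h4) (by omega)
      exact le_mul_of_one_le_right (Int.natCast_nonneg _) (by omega)
    · exact mul_nonneg (Int.natCast_nonneg _) (by omega)
  have h2 := h v
  have h3 := hg v
  rw [hk] at h3
  linarith

/-! ### Certificates for connectivity -/

/-- The label is the distance to `r`; the next vertex on a shortest path is the required neighbour.
-/
theorem Connected.exists_rank (hG : G.Connected) (r : V) :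
    ∃ t : V → ℕ, (∀ v, t v ≤ Fintype.card V) ∧
      ∀ v, v ≠ r → ∃ u, t u < t v ∧ 0 < G.mult v u := by
  refine ⟨fun v => G.toSimpleGraph.dist v r, fun v => ?_, fun v hv => ?_⟩
  · obtain ⟨p, hp⟩ := hG.exists_isPath v r
    exact (SimpleGraph.dist_le p).trans hp.length_lt.le
  · obtain ⟨p, hp⟩ := hG.exists_walk_length_eq_dist v r
    cases p with
    | nil => exact absurd rfl hv
    | cons h p =>
      refine ⟨_, ?_, h⟩
      have := SimpleGraph.dist_le p
      rw [SimpleGraph.Walk.length_cons] at hp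
      simp only
      omega

theorem connected_of_rank {r : V} {t : V → ℕ}
    (h : ∀ v, v ≠ r → ∃ u, t u < t v ∧ 0 < G.mult v u) : G.Connected := by
  have h1 : ∀ k v, t v = k → G.toSimpleGraph.Reachable v r := by
    intro k
    induction k using Nat.strong_induction_on with
    | _ k ih =>
      rintro v rfl
      by_cases hv : v = r
      · rw [hv]
      · obtain ⟨u, h2, h3⟩ := h v hv
        exact (SimpleGraph.Adj.reachable (G := G.toSimpleGraph) h3).trans (ih _ h2 u rfl)
  have : Nonempty V := ⟨r⟩
  exact ⟨fun u v => (h1 _ u rfl).trans (h1 _ v rfl).symm⟩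

/-- The component of `r` has the colour `0` and everything else the colour `1`. -/
theorem exists_coloring_of_not_connected (hG : ¬ G.Connected) (r : V) :
    ∃ t : V → ℕ, (∀ v, t v ≤ 1) ∧ t r = 0 ∧ (∃ v, 0 < t v) ∧
      ∀ u v, t u < t v → G.mult v u = 0 := by
  classical
  refine ⟨fun v => if G.toSimpleGraph.Reachable r v then 0 else 1, fun v => ?_, by simp, ?_, ?_⟩
  · dsimp only
    split_ifs <;> simp
  · by_contra! h
    have h1 : ∀ v, G.toSimpleGraph.Reachable r v := by simpa using h
    have : Nonempty V := ⟨r⟩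
    exact hG ⟨fun u v => (h1 u).symm.trans (h1 v)⟩
  · intro u v huv
    by_contra h
    simp only at huv
    split_ifs at huv with h1 h2 h2 <;> try omega
    refine h2 (h1.trans (SimpleGraph.Adj.reachable (G := G.toSimpleGraph) (?_ : 0 < G.mult u v)))
    rw [G.mult_symm]
    omega

theorem not_connected_of_coloring {r w : V} {t : V → ℕ} (hr : t r = 0) (hw : 0 < t w)
    (h : ∀ u v, t u < t v → G.mult v u = 0) : ¬ G.Connected := by
  intro hG
  have h1 : ∀ {u v : V} (p : G.toSimpleGraph.Walk u v), t u = t v := by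
    intro u v p
    induction p with
    | nil => rfl
    | @cons u v w huv p ih =>
      rw [← ih]
      have huv : 0 < G.mult u v := huv
      by_contra hne
      rcases lt_or_gt_of_ne hne with hlt | hlt
      · have := h _ _ hlt
        rw [G.mult_symm] at this
        omega
      · have := h _ _ hlt
        omega
  obtain ⟨p⟩ := hG.preconnected r w
  have := h1 p
  omega

end Multigraph

/-! ### The verifiers -/

open NumProgram

/-- The multigraph on the vertices `0, …, n - 1` with the given numbers of edges. -/
def graphOf (n : ℕ) (w : ℕ → ℕ → ℕ) : Multigraph (Fin n) where
  mult i j := multOf w i j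
  mult_symm i j := by
    rcases lt_trichotomy (i : ℕ) j with h | h | h
    · simp [multOf, h, h.not_gt]
    · simp [multOf, h]
    · simp [multOf, h, h.not_gt]
  mult_self i := by simp [multOf]

/-- The instance given by `n`, `d` and `w` has the property in question. -/
def IsPositive (n : ℕ) (d : ℕ → ℤ) (w : ℕ → ℕ → ℕ) : Prop :=
  (graphOf n w).Connected ∧ 0 ≤ (graphOf n w).rank fun i => d i

theorem map_val_filter_finRange {n : ℕ} (i : Fin n) :
    ((List.finRange n).filter fun j => j < i).map Fin.val = List.range i := by
  have h : (List.range n).filter (fun j => j < i.val) = List.range i := by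
    obtain ⟨k, e⟩ : ∃ k, n = i + k := ⟨n - i, by omega⟩
    generalize (i : ℕ) = i at e ⊢
    rw [e, List.range_add, List.filter_append, List.filter_eq_self.2 (by simp),
      List.filter_eq_nil_iff.2 (by simp), List.append_nil]
  rw [← h, ← List.map_coe_finRange_eq_range, List.filter_map]
  rfl

theorem encodeInstance_graphOf (n : ℕ) (d : ℕ → ℤ) (w : ℕ → ℕ → ℕ) :
    encodeInstance (graphOf n w) (fun i => d i) = instWord n d w := by
  rw [encodeInstance, instWord, ← List.map_coe_finRange_eq_range, List.flatMap_map]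
  congr 1
  funext i
  rw [encodeRow, rowWord, ← map_val_filter_finRange i, List.map_map, List.flatMap_map]
  congr 2
  refine List.flatMap_congr fun j hj => ?_
  have hj : j < i := by simpa using hj
  have : multOf w i j = w i j := by rw [multOf, if_pos (Fin.lt_def.1 hj)]
  simp [graphOf, this]

theorem exists_eq_graphOf {n : ℕ} (G : Multigraph (Fin n)) (D : Fin n → ℤ) :
    ∃ (d : ℕ → ℤ) (w : ℕ → ℕ → ℕ), G = graphOf n w ∧ D = fun i : Fin n => d i := by
  refine ⟨fun i => if h : i < n then D ⟨i, h⟩ else 0, fun i j => if h : i < n ∧ j < n then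
    G.mult ⟨i, h.1⟩ ⟨j, h.2⟩ else 0, ?_, by simp⟩
  obtain ⟨mult, hs, h0⟩ := G
  rw [graphOf, Multigraph.mk.injEq]
  funext i j
  rcases lt_trichotomy i j with h | h | h
  · have h : (i : ℕ) < j := h
    simp [multOf, h, h.not_gt, hs i j]
  · subst h
    simp [multOf, h0]
  · have h : (j : ℕ) < i := h
    simp [multOf, h]

theorem mem_rankNonnegProblem {x : List InstSym} :
    x ∈ rankNonnegProblem ↔ ∃ n d w, x = instWord n d w ∧ IsPositive n d w := by
  constructor
  · rintro ⟨n, G, D, hG, hD, rfl⟩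
    obtain ⟨d, w, rfl, rfl⟩ := exists_eq_graphOf G D
    exact ⟨n, d, w, encodeInstance_graphOf n d w, hG, hD⟩
  · rintro ⟨n, d, w, rfl, hG, hD⟩
    exact ⟨n, _, _, hG, hD, encodeInstance_graphOf n d w⟩

/-- The rows of an instance. -/
def instRows (n : ℕ) (d : ℕ → ℤ) (w : ℕ → ℕ → ℕ) : List (ℤ × List ℕ) :=
  (List.range n).map fun i => (d i, (List.range i).map (w i))

theorem instWord_eq (n : ℕ) (d : ℕ → ℤ) (w : ℕ → ℕ → ℕ) :
    instWord n d w = rowsWord (instRows n d w) := by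
  rw [rowsWord, instRows, List.flatMap_map]
  rfl

theorem exists_eq_instWord_iff {x : List InstSym} :
    (∃ rows, IsTriangular rows ∧ x = rowsWord rows) ↔ ∃ n d w, x = instWord n d w := by
  constructor
  · rintro ⟨rows, ht, rfl⟩
    obtain ⟨d, w, f, t, h⟩ := exists_eq_map_rowOf (rows := rows.map fun q => ⟨q.1, q.2, 0, 0⟩)
      (by simpa [IsTriangular, Function.comp_def] using ht)
    refine ⟨rows.length, d, w, ?_⟩
    have := congrArg (fun l => l.flatMap Row.word) h
    simp only [List.length_map, flatMap_rowOf] at this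
    rw [← this, List.flatMap_map]
    rfl
  · rintro ⟨n, d, w, rfl⟩
    refine ⟨instRows n d w, ?_, instWord_eq n d w⟩
    simp [IsTriangular, instRows, Function.comp_def]

/-- A verifier reads a word in some way chosen by the run. Unique readability makes this irrelevant
for the property that is decided. -/
theorem IsPositive.of_instWord_eq {n n' : ℕ} {d d' : ℕ → ℤ} {w w' : ℕ → ℕ → ℕ}
    (h : instWord n d w = instWord n' d' w') (hp : IsPositive n d w) : IsPositive n' d' w' := by
  rw [instWord_eq, instWord_eq] at h
  have h := rowsWord_injective h
  obtain rfl : n = n' := by simpa [instRows] using congrArg List.length h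
  have h1 : ∀ i < n, d i = d' i ∧ ∀ j < i, w i j = w' i j := by
    intro i hi
    have h2 := congrArg (fun l => l[i]?) h
    simpa [instRows, hi] using h2
  have hg : graphOf n w = graphOf n w' := by
    rw [graphOf, graphOf, Multigraph.mk.injEq]
    funext i j
    rw [multOf, multOf]
    split_ifs with h3 h4
    exacts [(h1 i i.2).2 j h3, (h1 j j.2).2 i h4, rfl]
  have hd : (fun i : Fin n => d i) = fun i : Fin n => d' i := funext fun i => (h1 i i.2).1
  rwa [IsPositive, hg, hd] at hp

theorem instWord_bounds {n : ℕ} {d : ℕ → ℤ} {w : ℕ → ℕ → ℕ} :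
    n ≤ (instWord n d w).length ∧ ∀ i < n, (d i).natAbs < 2 ^ (instWord n d w).length ∧
      ∀ j < i, w i j < 2 ^ (instWord n d w).length := by
  rw [instWord_eq]
  refine ⟨(by simp [instRows] : n = (instRows n d w).length).trans_le
    (length_le_length_rowsWord _), fun i hi => ?_⟩
  obtain ⟨h1, h2⟩ := lt_two_pow_of_mem_rowsWord (rows := instRows n d w)
    (q := (d i, (List.range i).map (w i))) (List.mem_map_of_mem (List.mem_range.2 hi))
  exact ⟨h1, fun j hj => h2 _ (List.mem_map_of_mem (List.mem_range.2 hj))⟩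

section Items

variable {n : ℕ} {d : ℕ → ℤ} {w : ℕ → ℕ → ℕ} {f t : ℕ → ℕ}

/-- This gives the sums their meaning: gains minus losses are the chips left after firing the script
`f`. -/
theorem itemOf_sub (i : Fin n) : ((itemOf d w f t n i).p : ℤ) - (itemOf d w f t n i).n =
    d i - (graphOf n w).lap (fun j => (f j : ℤ)) i := by
  have h : (((d i).toNat : ℕ) : ℤ) - ((-d i).toNat : ℕ) = d i := by omega
  simp only [itemOf, Multigraph.lap, graphOf, Finset.sum_range]
  push_cast [mul_sub, Finset.sum_sub_distrib] at h ⊢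
  linarith

theorem itemOf_c (i : Fin n) : ((itemOf d w f t n i).c : ℤ) =
    ∑ u : Fin n, if t u < t i then ((graphOf n w).mult i u : ℤ) else 0 := by
  simp only [itemOf, graphOf, Finset.sum_range]
  push_cast
  rfl

theorem itemOf_c_eq_zero {i : Fin n} : (itemOf d w f t n i).c = 0 ↔
    ∀ u : Fin n, t u < t i → (graphOf n w).mult i u = 0 := by
  simp [itemOf, graphOf, Finset.sum_range]

theorem itemsOf_succ : itemsOf d w f t (n + 1) = itemOf d w f t (n + 1) 0 ::
    (List.range n).map fun i => itemOf d w f t (n + 1) (i + 1) := by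
  rw [itemsOf, List.range_succ_eq_map, List.map_cons, List.map_map]
  rfl

theorem mem_itemsOf {e : Item} :
    e ∈ itemsOf d w f t n ↔ ∃ i : Fin n, e = itemOf d w f t n i := by
  rw [itemsOf, List.mem_map]
  constructor
  · rintro ⟨i, hi, rfl⟩
    exact ⟨⟨i, List.mem_range.1 hi⟩, rfl⟩
  · rintro ⟨i, rfl⟩
    exact ⟨i, List.mem_range.2 i.2, rfl⟩

/-- The bounds that hold if `f` and `t` have at most `3 * S + 3` digits, where `S` is the length of
the input. -/
theorem can_readInstance_of_le {Q' : ℕ → State → Prop} {S : ℕ} (hS : (instWord n d w).length = S)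
    (hf : ∀ i < n, f i ≤ 2 ^ (3 * S + 3)) (ht : ∀ i < n, t i ≤ n)
    (h : (∀ e ∈ itemsOf d w f t n, e.Bdd (9 * S + 13) ∧ e.n + e.c < 2 ^ (9 * S + 13)) →
      ∀ j ≤ (16 * (9 * S + 13) + 100) * S * S + 1, Q' j (idle (itemsOf d w f t n) [])) :
    Can (NumInstr.BddStep (9 * S + 13)) readInstance (.init (instWord n d w)) Q' := by
  obtain ⟨h1, h2⟩ := instWord_bounds (n := n) (d := d) (w := w)
  rw [hS] at h1 h2
  have hn : n ≤ 3 * S + 3 := by omega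
  have hpow : 2 ^ S ≤ 2 ^ (3 * S + 3) := Nat.pow_le_pow_right two_pos (by omega)
  have hd' : ∀ i < n, (d i).natAbs ≤ 2 ^ (3 * S + 3) := fun i hi => ((h2 i hi).1.le).trans hpow
  have hw' : ∀ i < n, ∀ j < i, w i j ≤ 2 ^ (3 * S + 3) := fun i hi j hj =>
    ((h2 i hi).2 j hj).le.trans hpow
  have ht' : ∀ i < n, t i ≤ 2 ^ (3 * S + 3) := fun i hi =>
    (ht i hi).trans (hn.trans Nat.lt_two_pow_self.le)
  -- With entries up to `2 ^ (3 * S + 3)` reading needs `3 * (3 * S + 3) + 3` digits; one more digit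
  -- makes room for `e.n + e.c`.
  have hB1 := lt_two_pow_of_le hn (B := 9 * S + 12) (by omega)
  have hB2 := lt_two_pow_of_le hn (B := 9 * S + 13) (by omega)
  refine can_readInstance hB2 hd' hw' hf ht' fun j hj => h (fun e he => ?_) j (hj.trans ?_)
  · obtain ⟨i, rfl⟩ := mem_itemsOf.1 he
    have hle := itemOf_le hd' hw' hf ht' i.2
    obtain ⟨-, -, -, h3, h4⟩ := hle.bdd le_rfl hB1
    refine ⟨hle.bdd le_rfl hB2, ?_⟩
    rw [pow_succ]
    omega
  · exact Nat.add_le_add_right (Nat.mul_le_mul (Nat.mul_le_mul_left _ h1) h1) _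

/-- The number of vertices and each `|d i|` are at most `2 ^ S`, so `2 * bound` is at most `8 * (2 ^
S) ^ 3`. -/
theorem script_le {S : ℕ} (hS : (instWord n d w).length = S) {g : ℕ}
    (hg : (g : ℤ) ≤ 2 * Multigraph.bound fun i : Fin n => d i) : g ≤ 2 ^ (3 * S + 3) := by
  obtain ⟨h1, h2⟩ := instWord_bounds (n := n) (d := d) (w := w)
  rw [hS] at h1 h2
  have h3 : ∑ i : Fin n, |d i| ≤ n * 2 ^ S := by
    refine (Finset.sum_le_card_nsmul Finset.univ _ (2 ^ S) fun i _ => ?_).trans_eq (by simp)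
    have := (h2 i i.2).1
    rw [Int.abs_eq_natAbs]
    exact_mod_cast this.le
  have h4 : (n : ℤ) ≤ 2 ^ S := by exact_mod_cast h1.trans Nat.lt_two_pow_self.le
  have h5 : (0 : ℤ) < 2 ^ S := by positivity
  have h6 : ∑ i : Fin n, |d i| ≤ 2 ^ S * 2 ^ S :=
    h3.trans (mul_le_mul_of_nonneg_right h4 h5.le)
  rw [Multigraph.bound, Fintype.card_fin] at hg
  have h7 : (n : ℤ) * (4 * ∑ i : Fin n, |d i|) ≤ 2 ^ S * (4 * (2 ^ S * 2 ^ S)) :=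
    mul_le_mul h4 (by linarith) (by positivity) h5.le
  have h8 : (2 : ℤ) ^ (3 * S + 3) = 2 * (2 ^ S * (4 * (2 ^ S * 2 ^ S))) := by ring
  have h9 : (g : ℤ) ≤ 2 ^ (3 * S + 3) := by rw [h8]; linarith
  exact_mod_cast h9

end Items

/-- The numbers of digits and steps that suffice for the verifiers. -/
noncomputable def digitBound : Polynomial ℕ := 9 * Polynomial.X + 13

/-- A bound for the length of the runs of the verifiers. -/
noncomputable def stepBound : Polynomial ℕ :=
  (16 * (9 * Polynomial.X + 13) + 100) * (Polynomial.X + 1) * (Polynomial.X + 1) +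
    26 * Polynomial.X + 28

theorem eval_digitBound (S : ℕ) : digitBound.eval S = 9 * S + 13 := by simp [digitBound]

theorem eval_stepBound (S : ℕ) : stepBound.eval S =
    (16 * (9 * S + 13) + 100) * (S + 1) * (S + 1) + 26 * S + 28 := by simp [stepBound]

theorem le_stepBound {S j k : ℕ} (hj : j ≤ (16 * (9 * S + 13) + 100) * S * S + 1)
    (hk : k ≤ 26 * S + 27) : j + k ≤ stepBound.eval S := by
  rw [eval_stepBound]
  have : (16 * (9 * S + 13) + 100) * S * S ≤ (16 * (9 * S + 13) + 100) * (S + 1) * (S + 1) :=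
    Nat.mul_le_mul (Nat.mul_le_mul_left _ (by omega)) (by omega)
  omega

open RegularExpression in
-- The certificate consists of a script `f` with effective result and of the distances `t` to the
-- vertex `0`.
theorem rankNonnegProblem_mem_classNP : rankNonnegProblem ∈ classNP InstSym := by
  refine mem_classNP_of_numProgram (readInstance * checkEffective) _ digitBound stepBound ?_ ?_
  · intro x hx
    obtain ⟨n, d, w, rfl, hG, hD⟩ := mem_rankNonnegProblem.1 hx
    generalize hS : (instWord n d w).length = S
    rw [eval_digitBound]
    have := hG.nonempty
    obtain ⟨g, hg, hg'⟩ := hG.exists_script_of_equivToEffective ((graphOf n w).rank_nonneg_iff.1 hD)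
    -- A connected graph has a vertex, so there is a first item, which acts as root.
    obtain ⟨n, rfl⟩ : ∃ m, n = m + 1 := ⟨n - 1, by have := (Classical.arbitrary (Fin n)).2; omega⟩
    obtain ⟨t, ht, ht'⟩ := hG.exists_rank 0
    let f' : ℕ → ℕ := fun i => if h : i < n + 1 then g ⟨i, h⟩ else 0
    let t' : ℕ → ℕ := fun i => if h : i < n + 1 then t ⟨i, h⟩ else 0
    have hf' : ∀ i : Fin (n + 1), f' i = g i := fun i => dif_pos i.2
    have htt : ∀ i : Fin (n + 1), t' i = t i := fun i => dif_pos i.2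
    have hp : ∀ i : Fin (n + 1), (itemOf d w f' t' (n + 1) i).n ≤ (itemOf d w f' t' (n + 1) i).p := by
      intro i
      have h1 := hg' i
      have h2 := itemOf_sub (d := d) (w := w) (f := f') (t := t') i
      simp only [hf'] at h2
      omega
    have hc : ∀ i : Fin (n + 1), i ≠ 0 → 0 < (itemOf d w f' t' (n + 1) i).c := by
      intro i hi
      obtain ⟨u, h1, h2⟩ := ht' i hi
      refine Nat.pos_of_ne_zero fun h3 => ?_
      have := itemOf_c_eq_zero.1 h3 u (by rwa [htt, htt])
      omega
    refine can_mul.2 (can_readInstance_of_le (f := f') (t := t') hS (fun i hi => ?_)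
      (fun i hi => ?_) fun hb j hj => ?_)
    · rw [hf' ⟨i, hi⟩]
      exact script_le hS (hg _)
    · rw [htt ⟨i, hi⟩]
      simpa using ht ⟨i, hi⟩
    · rw [itemsOf_succ] at hb ⊢
      have hn : n + 1 ≤ S := hS ▸ instWord_bounds.1
      refine can_checkEffective hb (hp 0) (fun e he => ?_) fun k hk => le_stepBound hj ?_
      · obtain ⟨i, hi, rfl⟩ := List.mem_map.1 he
        have hi : i < n := List.mem_range.1 hi
        exact ⟨hp ⟨i + 1, by omega⟩, hc ⟨i + 1, by omega⟩ (by simp [Fin.ext_iff])⟩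
      · rw [List.length_map, List.length_range] at hk
        omega
  · intro x hx
    refine must_mul.2 (must_readInstance fun n d w f t hw => must_checkEffective
      fun e es he h1 h2 => hx (mem_rankNonnegProblem.2 ⟨n, d, w, hw, ?_⟩))
    rcases n with - | n
    · simp [itemsOf] at he
    rw [itemsOf_succ, List.cons.injEq] at he
    obtain ⟨rfl, rfl⟩ := he
    have h3 : ∀ i : Fin (n + 1), i ≠ 0 → (itemOf d w f t (n + 1) i).n ≤
        (itemOf d w f t (n + 1) i).p ∧ 0 < (itemOf d w f t (n + 1) i).c := by
      intro i hi
      obtain ⟨j, rfl⟩ := Fin.exists_succ_eq.2 hi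
      exact h2 _ (List.mem_map_of_mem (f := fun i => itemOf d w f t (n + 1) (i + 1))
        (List.mem_range.2 j.2))
    refine ⟨Multigraph.connected_of_rank (r := 0) (t := fun i => t i) fun v hv => ?_,
      (graphOf (n + 1) w).rank_nonneg_iff.2 ((graphOf (n + 1) w).equivToEffective_iff.2
        ⟨fun i => f i, fun v => ?_⟩)⟩
    · by_contra! hn
      exact (h3 v hv).2.ne' (itemOf_c_eq_zero.2 fun u hu => Nat.le_zero.1 (hn u hu))
    · rw [← itemOf_sub (t := t)]
      by_cases hv : v = 0
      · subst hv
        have h1 : (itemOf d w f t (n + 1) (0 : Fin (n + 1))).n ≤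
          (itemOf d w f t (n + 1) (0 : Fin (n + 1))).p := h1
        omega
      · have := (h3 v hv).1
        omega

open RegularExpression in
-- A word is outside the problem for one of three reasons: it is malformed, the graph is
-- disconnected, or the divisor has no effective equivalent. Each has its own branch of the program.
theorem compl_rankNonnegProblem_mem_classNP : rankNonnegProblemᶜ ∈ classNP InstSym := by
  refine mem_classNP_of_numProgram
    (findError + readInstance * (checkIneffective + checkDisconnected)) _ digitBound stepBound ?_ ?_
  · intro x hx
    rw [eval_digitBound]
    by_cases hw : ∃ n d w, x = instWord n d w
    swap
    · refine can_add.2 (Or.inl (can_findError (mt exists_eq_instWord_iff.1 hw) (by omega)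
        fun j hj _ => ?_))
      rw [eval_stepBound]
      omega
    obtain ⟨n, d, w, rfl⟩ := hw
    have hp : ¬ IsPositive n d w := fun h => hx (mem_rankNonnegProblem.2 ⟨n, d, w, rfl, h⟩)
    generalize hS : (instWord n d w).length = S
    have hn : n ≤ S := hS ▸ instWord_bounds.1
    refine can_add.2 (Or.inr (can_mul.2 ?_))
    by_cases hG : (graphOf n w).Connected
    · have := hG.nonempty
      have hD : ¬ (graphOf n w).EquivToEffective fun i => d i := fun h =>
        hp ⟨hG, (graphOf n w).rank_nonneg_iff.2 h⟩
      obtain ⟨g, t, hg, ht, hgt⟩ := hG.exists_script_of_not_equivToEffective hD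
      let f' : ℕ → ℕ := fun i => if h : i < n then g ⟨i, h⟩ else 0
      let t' : ℕ → ℕ := fun i => if h : i < n then t ⟨i, h⟩ else 0
      have hf' : ∀ i : Fin n, f' i = g i := fun i => dif_pos i.2
      have htt : ∀ i : Fin n, t' i = t i := fun i => dif_pos i.2
      refine can_readInstance_of_le (f := f') (t := t') hS (fun i hi => ?_) (fun i hi => ?_)
        fun hb j hj => can_add.2 (Or.inl (can_checkIneffective (fun e he => ?_) fun k hk =>
        le_stepBound hj ?_))
      · rw [hf' ⟨i, hi⟩]
        exact script_le hS (hg _)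
      · rw [htt ⟨i, hi⟩]
        simpa using ht ⟨i, hi⟩
      · refine ⟨(hb e he).1, (hb e he).2, ?_⟩
        obtain ⟨i, rfl⟩ := mem_itemsOf.1 he
        have h1 := hgt i
        have h2 := itemOf_sub (d := d) (w := w) (f := f') (t := t') i
        have h3 := itemOf_c (d := d) (w := w) (f := f') (t := t') i
        simp only [hf', htt] at h2 h3
        omega
      · simp only [itemsOf, List.length_map, List.length_range] at hk
        omega
    -- The empty word describes the graph without vertices, which is not connected. It has no vertex
    -- whose label could be positive, but `checkIneffective` accepts it vacuously.
    · rcases n with - | n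
      · refine can_readInstance_of_le (f := 0) (t := 0) hS (by simp) (by simp) fun hb j hj =>
          can_add.2 (Or.inl (can_checkIneffective (by simp [itemsOf]) fun k hk => le_stepBound hj ?_))
        simp only [itemsOf, List.length_map, List.length_range] at hk
        omega
      obtain ⟨t, ht, h0, ⟨v, hv⟩, htt⟩ := Multigraph.exists_coloring_of_not_connected hG 0
      let t' : ℕ → ℕ := fun i => if h : i < n + 1 then t ⟨i, h⟩ else 0
      have ht' : ∀ i : Fin (n + 1), t' i = t i := fun i => dif_pos i.2
      refine can_readInstance_of_le (f := 0) (t := t') hS (by simp) (fun i hi => ?_)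
        fun hb j hj => can_add.2 (Or.inr ?_)
      · rw [ht' ⟨i, hi⟩]
        exact (ht _).trans (by omega)
      have hv' : ∃ e ∈ itemsOf d w 0 t' (n + 1), 0 < e.t :=
        ⟨_, mem_itemsOf.2 ⟨v, rfl⟩, by simpa [itemOf, ht'] using hv⟩
      have hc : ∀ e ∈ itemsOf d w 0 t' (n + 1), e.c = 0 := by
        intro e he
        obtain ⟨i, rfl⟩ := mem_itemsOf.1 he
        refine itemOf_c_eq_zero.2 fun u hu => ?_
        exact htt u i (by rwa [ht', ht'] at hu)
      rw [itemsOf_succ] at hb hv' hc ⊢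
      refine can_checkDisconnected hb ?_ hv' hc fun k hk => le_stepBound hj ?_
      · exact (ht' 0).trans h0
      · rw [List.length_map, List.length_range] at hk
        omega
  · intro x hx
    -- The instance read by the program may be given by other data `n'`, `d'`, `w'`, to which the
    -- property of `n`, `d`, `w` has to be transferred.
    obtain ⟨n, d, w, rfl, hp⟩ := mem_rankNonnegProblem.1 (Set.notMem_compl_iff.1 hx)
    refine must_add.2 ⟨must_findError fun h => absurd (exists_eq_instWord_iff.2 ⟨n, d, w, rfl⟩) h,
      must_mul.2 (must_readInstance fun n' d' w' f t hw => must_add.2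
        ⟨must_checkIneffective fun h => ?_, must_checkDisconnected fun e es he h1 h2 h3 => ?_⟩)⟩
    all_goals obtain ⟨hG, hD⟩ := hp.of_instWord_eq hw
    · have := hG.nonempty
      refine Multigraph.not_equivToEffective_of_script (f := fun i : Fin n' => (f i : ℤ))
        (t := fun i : Fin n' => t i) (fun i => ?_) ((graphOf n' w').rank_nonneg_iff.1 hD)
      rw [← itemOf_sub (t := t), ← itemOf_c (f := f) (d := d')]
      have := h _ (mem_itemsOf.2 ⟨i, rfl⟩)
      omega
    · rcases n' with - | n'
      · simp [itemsOf] at he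
      obtain ⟨e', he', h4⟩ := h2
      obtain ⟨v, rfl⟩ := mem_itemsOf.1 he'
      rw [itemsOf_succ, List.cons.injEq] at he
      obtain ⟨rfl, rfl⟩ := he
      refine Multigraph.not_connected_of_coloring (r := 0) (w := v) (t := fun i => t i) h1 h4
        (fun u i hu => ?_) hG
      exact itemOf_c_eq_zero.1 (h3 _ (mem_itemsOf.2 ⟨i, rfl⟩)) u hu

theorem mainTheorem4 : rankNonnegProblem ∈ classNP InstSym ∩ classCoNP InstSym :=
  ⟨rankNonnegProblem_mem_classNP, compl_rankNonnegProblem_mem_classNP⟩
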